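/- **Definition of $(X_\infty,\omega_\infty)$.** In the plane let $P$ be the union of the upper rectangle $[0,1]\times[\tfrac12,1]$ and the lower rectangle $[-\tfrac12,\tfrac12]\times[0,\tfrac12]$. Identify the following pairs of open boundary segments by translations, where $n\ge 0$ and $h=2^{-n}$: the segments of length $\tfrac h4$ on the top side of the upper rectangle with left endpoints $(1-h,1)$ and $(1-\tfrac34h,1)$ with the segments of the same length on the bottom side of the lower rectangle with left endpoints $(\tfrac12-\tfrac34h,0)$ and $(\tfrac12-h,0)$, respectively; the segment $(-\tfrac12,0)\times\{\tfrac12\}$ with $(\tfrac12,1)\times\{\tfrac12\}$; and vertical segments of length $\tfrac h4$ whose lower endpoints are, for $n$ even, $(\tfrac12,\tfrac h4)\sim(0,\tfrac23+\tfrac h{12})$ and $(1,1-\tfrac h2)\sim(-\tfrac12,\tfrac13-\tfrac h3)$, and, for $n$ odd, $(1,1-\tfrac h2)\sim(0,\tfrac23-\tfrac h3)$ and $(\tfrac12,\tfrac h4)\sim(-\tfrac12,\tfrac13+\tfrac h{12})$. Let $X_\infty$ be the quotient of the interior of $P$ together with these open segments, and let $\omega_\infty$ be the $1$-form induced by $dz$.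 An affine homeomorphism of $(X_\infty,\omega_\infty)$ is a homeomorphism $X_\infty\to X_\infty$ that is real-affine in the canonical charts (local primitives) of $\omega_\infty$; these form the group $\mathrm{Aff}(X_\infty,\omega_\infty)$. Let $\rho_\infty$ be the glide reflection with $\rho_\infty(x,y)=(x+\tfrac12,1-y)$ on the lower rectangle and $\rho_\infty(x,y)=(x-\tfrac12,1-y)$ on the upper rectangle. Let $\psi_\infty(x,y)=(2x-\tfrac12,\tfrac y2)$ on $[0,\tfrac12]\times[0,1]$, $\psi_\infty(x,y)=(2x+1,\tfrac{y+1}2)$ on $[-\tfrac12,0]\times[0,\tfrac12]$ and $\psi_\infty(x,y)=(2x-1,\tfrac{y+1}2)$ on $[\tfrac12,1]\times[\tfrac12,1]$. **Theorem.** The maps $\psi_\infty$ and $\rho_\infty$ are well defined elements of $\mathrm{Aff}(X_\infty,\omega_\infty)$, with derivatives $\begin{pmatrix}2&0\\0&1/2\end{pmatrix}$ (so $\psi_\infty$ is pseudo-Anosov with expansion constant $2$) and $\begin{pmatrix}1&0\\0&-1\end{pmatrix}$ (so $\rho_\infty$ reverses orientation). They generate $\mathrm{Aff}(X_\infty,\omega_\infty)$,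 and there is an isomorphism $\mathbb Z\times\mathbb Z/2\mathbb Z\cong\mathrm{Aff}(X_\infty,\omega_\infty)$ that takes $(1,0)$ to $\psi_\infty$ and $(0,1)$ to $\rho_\infty$; in particular $\rho_\infty$ is an involution. Moreover, every $\phi\in\mathrm{Aff}(X_\infty,\omega_\infty)$ has a unique globally constant derivative in $M_2(\mathbb R)$; this derivative preserves the vertical direction, it is not parabolic (that is, it is scalar or its characteristic polynomial has non-zero discriminant), and it is the identity only if $\phi$ is the identity. -/

import Mathlib

open Set Filter Topology Complex

namespace ArnouxYoccoz

/-! ### Translation surfaces and their affine groups -/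

/-- A translation surface, given by its atlas of canonical charts (local primitives of the
`1`-form `ω`): any two charts differ, locally, by an additive constant, so the local forms `dz`
glue to a nowhere vanishing holomorphic `1`-form. -/
class TranslationAtlas (X : Type*) [TopologicalSpace X] [ChartedSpace ℂ X] : Prop where
  eq_add_const : ∀ e ∈ atlas ℂ X, ∀ e' ∈ atlas ℂ X, ∀ x ∈ e.source, x ∈ e'.source →
    ∃ c : ℂ, ∀ᶠ y in 𝓝 x, e' y = e y + c

/-- A homeomorphism is affine if it is given, in canonical charts, by (invertible) real affine
maps of the plane. -/
def IsAffine {X : Type*} [TopologicalSpace X] [ChartedSpace ℂ X] (φ : X ≃ₜ X) : Prop :=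
  ∀ e ∈ atlas ℂ X, ∀ e' ∈ atlas ℂ X, ∀ x ∈ e.source, φ x ∈ e'.source →
    ∃ A : ℂ ≃ᵃ[ℝ] ℂ, ∀ᶠ y in 𝓝 x, e' (φ y) = A (e y)

/-- The real-linear endomorphism of `ℂ = ℝ²` with matrix `M` in the basis `1, I`. -/
noncomputable def planeMap (M : Matrix (Fin 2) (Fin 2) ℝ) : ℂ →ₗ[ℝ] ℂ :=
  Matrix.toLin Complex.basisOneI Complex.basisOneI M

/-- `φ` has the globally constant derivative `M` in canonical charts. -/
def HasDerivative {X : Type*} [TopologicalSpace X] [ChartedSpace ℂ X] (φ : X ≃ₜ X)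
    (M : Matrix (Fin 2) (Fin 2) ℝ) : Prop :=
  ∀ e ∈ atlas ℂ X, ∀ e' ∈ atlas ℂ X, ∀ x ∈ e.source, φ x ∈ e'.source →
    ∃ c : ℂ, ∀ᶠ y in 𝓝 x, e' (φ y) = planeMap M (e y) + c

/-- The group of affine homeomorphisms of a translation surface. -/
def affineGroup (X : Type*) [TopologicalSpace X] [ChartedSpace ℂ X] [TranslationAtlas X] :
    Subgroup (X ≃ₜ X) where
  carrier := {φ | IsAffine φ}
  one_mem' := by
    intro e he e' he' x hx hx'
    obtain ⟨c, hc⟩ := TranslationAtlas.eq_add_const e he e' he' x hx hx'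
    refine ⟨AffineEquiv.constVAdd ℝ ℂ c, ?_⟩
    filter_upwards [hc] with y hy
    simp [hy, add_comm]
  mul_mem' := by
    intro φ χ hφ hχ e he e' he' x hx hx'
    obtain ⟨A, hA⟩ := hχ e he (chartAt ℂ (χ x)) (chart_mem_atlas ℂ _) x hx
      (mem_chart_source ℂ _)
    obtain ⟨A', hA'⟩ := hφ (chartAt ℂ (χ x)) (chart_mem_atlas ℂ _) e' he' (χ x)
      (mem_chart_source ℂ _) hx'
    refine ⟨A.trans A', ?_⟩
    filter_upwards [hA, χ.continuous.continuousAt.eventually hA'] with y h1 h2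
    simp [h1, h2]
  inv_mem' := by
    intro φ hφ e he e' he' x hx hx'
    obtain ⟨A, hA⟩ := hφ e' he' e he (φ⁻¹ x) hx' (by simpa using hx)
    refine ⟨A.symm, ?_⟩
    filter_upwards [φ.symm.continuous.continuousAt.eventually hA] with y h1
    simp only [Homeomorph.apply_symm_apply] at h1
    simp [h1]

/-! ### The polygon and its edges

The polygon is the union of the upper rectangle `[0,1] × [1/2,1]` and the lower rectangle
`[-1/2,1/2] × [0,1/2]` in the plane.  Its boundary, except for the vertices and their four
accumulation points, is cut into open segments that are identified in pairs by translations. -/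

/-- The labels of the pairs of identified edges.  The labels `C₁ n`, `C₂ n`, `A n`, `B n` stand
for pairs of edges of length `1 / 2 ^ (n + 2)`; `S` is the remaining pair, of length `1 / 2`. -/
inductive Edge : Type
  | C₁ (n : ℕ)
  | C₂ (n : ℕ)
  | S
  | A (n : ℕ)
  | B (n : ℕ)

namespace Edge

/-- The common direction of the two edges of a pair: `1` (horizontal) or `I` (vertical). -/
noncomputable def dir : Edge → ℂ
  | C₁ _ => 1
  | C₂ _ => 1
  | S => 1
  | A _ => I
  | B _ => I

/-- The common length of the two edges of a pair. -/
noncomputable def len : Edge → ℝ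
  | C₁ n => (1 / 2) ^ n / 4
  | C₂ n => (1 / 2) ^ n / 4
  | S => 1 / 2
  | A n => (1 / 2) ^ n / 4
  | B n => (1 / 2) ^ n / 4

/-- Initial point of the first edge of a pair.  The first edge lies on the top side of the upper
rectangle (`C₁`, `C₂`), on the top side of the lower rectangle (`S`), or on the right side of the
upper or lower rectangle (`A`, `B`, depending on parity). -/
noncomputable def start₁ : Edge → ℂ
  | C₁ n => ⟨1 - (1 / 2) ^ n, 1⟩
  | C₂ n => ⟨1 - (1 / 2) ^ n * (3 / 4), 1⟩
  | S => ⟨-1 / 2, 1 / 2⟩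
  | A n => if Even n then ⟨1 / 2, (1 / 2) ^ n / 4⟩ else ⟨1, 1 - (1 / 2) ^ n / 2⟩
  | B n => if Even n then ⟨1, 1 - (1 / 2) ^ n / 2⟩ else ⟨1 / 2, (1 / 2) ^ n / 4⟩

/-- Initial point of the second edge of a pair.  The second edge lies on the bottom side of the
lower rectangle (`C₁`, `C₂`), on the bottom side of the upper rectangle (`S`), on the left side of
the upper rectangle (`A`), or on the left side of the lower rectangle (`B`). -/
noncomputable def start₂ : Edge → ℂ
  | C₁ n => ⟨1 / 2 - (1 / 2) ^ n * (3 / 4), 0⟩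
  | C₂ n => ⟨1 / 2 - (1 / 2) ^ n, 0⟩
  | S => ⟨1 / 2, 1 / 2⟩
  | A n => if Even n then ⟨0, 2 / 3 + (1 / 2) ^ n / 12⟩ else ⟨0, 2 / 3 - (1 / 2) ^ n / 3⟩
  | B n => if Even n then ⟨-1 / 2, 1 / 3 - (1 / 2) ^ n / 3⟩
      else ⟨-1 / 2, 1 / 3 + (1 / 2) ^ n / 12⟩

end Edge

/-- `z` lies on the first edge of some pair, and `w` is the point of the second edge of that pair
to which `z` is translated. -/
def Glued (z w : ℂ) : Prop :=
  ∃ (e : Edge) (t : ℝ), 0 < t ∧ t < e.len ∧ z = e.start₁ + t * e.dir ∧ w = e.start₂ + t * e.dir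

/-- The interior of the polygon: the interiors of the upper rectangle, of the lower rectangle, and
of the central rectangle `[0,1/2] × [0,1]`. -/
def polygonInterior : Set ℂ :=
  Ioo 0 1 ×ℂ Ioo (1 / 2) 1 ∪ Ioo (-1 / 2) (1 / 2) ×ℂ Ioo 0 (1 / 2) ∪ Ioo 0 (1 / 2) ×ℂ Ioo 0 1

/-- The polygon without its vertices and their accumulation points: the interior together with
all open edges. -/
def polygon : Set ℂ :=
  polygonInterior ∪ {z | ∃ w, Glued z w ∨ Glued w z}

/-- The surface `X_∞`: the quotient of the polygon (without vertices) by the identifications of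
its edges, with the quotient topology. -/
def Surface : Type :=
  Quot fun p q : polygon => Glued p q

instance : TopologicalSpace Surface :=
  inferInstanceAs (TopologicalSpace (Quot fun p q : polygon => Glued p q))

/-- The projection of the polygon onto the surface. -/
def proj (p : polygon) : Surface := Quot.mk _ p

/-- The canonical charts of the `1`-form `ω_∞` that `dz` induces on the quotient: local
homeomorphisms to the plane that pull back to `z + const`, locally, on the polygon. -/
def canonicalCharts : Set (OpenPartialHomeomorph Surface ℂ) :=
  {e | ∀ p : polygon, proj p ∈ e.source → ∃ c : ℂ, ∀ᶠ q in 𝓝 p, e (proj q) = (q : ℂ) + c}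

lemma isQuotientMap_proj : IsQuotientMap proj := isQuotientMap_quot_mk

lemma proj_eq {p q : polygon} (h : Glued p q) : proj p = proj q := Quot.sound h

/-- A construction of charts around an edge: a chart on a plane open set `B` of which the part
`ℓ ≤ c` lies in the polygon and the part `c ≤ ℓ` does so after translation by `v`. -/
lemma exists_chart (B : Set ℂ) (hB : IsOpen B) (v : ℂ) (l : ℂ → ℝ) (hl : Continuous l) (c : ℝ)
    (h1 : ∀ w ∈ B, l w ≤ c → w ∈ polygon) (h2 : ∀ w ∈ B, c ≤ l w → w + v ∈ polygon)
    (h3 : ∀ w ∈ B, l w = c → Glued w (w + v))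
    (h4 : ∀ w ∈ B, w ∈ polygon → l w ≤ c) (h4' : ∀ w ∈ B, w + v ∈ polygon → c ≤ l w)
    (h5 : ∀ w ∈ B, w + v ∉ B)
    (h6 : ∀ p q, Glued p q → (p ∈ B ∨ p - v ∈ B ∨ q ∈ B ∨ q - v ∈ B) → p ∈ B ∧ q = p + v) :
    ∃ e ∈ canonicalCharts, ∀ p : polygon, (p : ℂ) ∈ B → proj p ∈ e.source := by
  classical
  have h5' : ∀ w ∈ B, w - v ∉ B := fun w hw hw' => h5 _ hw' (by simpa using hw)
  by_cases hne : ∃ p : polygon, (p : ℂ) ∈ B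
  swap
  · refine ⟨⟨⟨⟨fun _ => 0, fun _ => proj ⟨⟨1/4, 3/4⟩, Or.inl (Or.inl (Or.inl (by
      simp [mem_reProdIm]; norm_num)))⟩, ∅, ∅, by simp, by simp, by simp, by simp⟩, by simp, by simp⟩,
      by simp, by simp⟩, by simp [canonicalCharts], fun p hp => (hne ⟨p, hp⟩).elim⟩
  obtain ⟨p₀, -⟩ := hne
  -- the chart on the polygon, and its descent
  let f : polygon → ℂ := fun p => if (p : ℂ) ∈ B then p else p - v
  have hfB : ∀ p : polygon, (p : ℂ) ∈ B → f p = p := fun p hp => if_pos hp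
  have hfB' : ∀ p : polygon, (p : ℂ) - v ∈ B → f p = p - v := fun p hp =>
    if_neg (fun h => h5' _ h hp)
  let S : Set polygon := {p | (p : ℂ) ∈ B ∨ (p : ℂ) - v ∈ B}
  have hSopen : IsOpen S := by
    refine IsOpen.union (hB.preimage continuous_subtype_val) ?_
    exact hB.preimage (f := fun p : polygon => (p : ℂ) - v) (by fun_prop)
  have key : ∀ p q : polygon, Glued p q → ((p ∈ S) = (q ∈ S)) := by
    intro p q h
    apply propext
    constructor
    · intro hp
      obtain ⟨ha, hb⟩ := h6 _ _ h (by rcases hp with hp | hp <;> simp [hp])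
      exact Or.inr (by simpa [hb] using ha)
    · intro hp
      obtain ⟨ha, hb⟩ := h6 _ _ h (by rcases hp with hp | hp <;> simp [hp])
      exact Or.inl ha
  let g : polygon → ℂ := fun p => if p ∈ S then f p else 0
  have hg : ∀ p q : polygon, Glued p q → g p = g q := by
    intro p q h
    by_cases hp : p ∈ S
    · have hq : q ∈ S := by rwa [← key p q h]
      obtain ⟨ha, hb⟩ := h6 _ _ h (by rcases hp with hp | hp <;> simp [hp])
      simp only [g, if_pos hp, if_pos hq]
      rw [hfB p ha, hfB' q (by simpa [hb] using ha), hb]; simp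
    · have hq : q ∉ S := by rwa [← key p q h]
      simp only [g, if_neg hp, if_neg hq]
  let V : Set Surface := {x | Quot.lift (fun p => p ∈ S) key x}
  let F : Surface → ℂ := Quot.lift g hg
  have hV : ∀ p, proj p ∈ V ↔ p ∈ S := fun p => Iff.rfl
  have hF : ∀ p ∈ S, F (proj p) = f p := fun p hp => if_pos hp
  have hVopen : IsOpen V := isQuotientMap_proj.isOpen_preimage.1 hSopen
  let G : ℂ → Surface := fun w =>
    if h : l w ≤ c ∧ w ∈ polygon then proj ⟨w, h.2⟩
    else if h : w + v ∈ polygon then proj ⟨w + v, h⟩ else proj p₀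
  have hG1 : ∀ w ∈ B, ∀ h : w ∈ polygon, G w = proj ⟨w, h⟩ := by
    intro w hw h
    exact dif_pos ⟨h4 w hw h, h⟩
  have hG2 : ∀ w ∈ B, ∀ h : w + v ∈ polygon, G w = proj ⟨w + v, h⟩ := by
    intro w hw h
    by_cases h' : l w ≤ c ∧ w ∈ polygon
    · have : l w = c := le_antisymm h'.1 (h4' w hw h)
      rw [hG1 w hw h'.2]
      exact proj_eq (h3 w hw this)
    · simp only [G, dif_neg h', dif_pos h]
  have hFeq : ∀ p ∈ S, ∀ᶠ q in 𝓝 p, ∃ d, d = f p - p ∧ F (proj q) = q + d := by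
    rintro p (hp | hp)
    · have : ∀ᶠ q : polygon in 𝓝 p, (q : ℂ) ∈ B :=
        continuous_subtype_val.continuousAt.eventually (hB.mem_nhds hp)
      filter_upwards [this] with q hq
      refine ⟨_, rfl, ?_⟩
      rw [hF q (Or.inl hq), hfB q hq, hfB p hp]; simp
    · have : ∀ᶠ q : polygon in 𝓝 p, (q : ℂ) - v ∈ B :=
        (show Continuous fun q : polygon => (q : ℂ) - v by fun_prop).continuousAt.eventually
          (hB.mem_nhds hp)
      filter_upwards [this] with q hq
      refine ⟨_, rfl, ?_⟩
      rw [hF q (Or.inr hq), hfB' q hq, hfB' p hp]; ring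
  have hFcont : ContinuousOn F V := by
    rw [isQuotientMap_proj.continuousOn_isOpen_iff hVopen]
    intro p hp
    apply ContinuousAt.continuousWithinAt
    have h0 : ContinuousAt (fun q : polygon => (q : ℂ) + (f p - p)) p := by fun_prop
    refine h0.congr ?_
    filter_upwards [hFeq p hp] with q hq
    obtain ⟨d, rfl, hd⟩ := hq
    exact hd.symm
  have hGcont : ContinuousOn G B := by
    have c1 : ContinuousOn G (B ∩ {w | l w ≤ c}) := by
      rw [continuousOn_iff_continuous_domRestrict]
      have : Continuous fun w : ↥(B ∩ {w | l w ≤ c}) =>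
          proj ⟨w, h1 w w.2.1 w.2.2⟩ :=
        isQuotientMap_proj.continuous.comp (by fun_prop)
      refine this.congr fun w => (hG1 w w.2.1 _).symm
    have c2 : ContinuousOn G (B ∩ {w | c ≤ l w}) := by
      rw [continuousOn_iff_continuous_domRestrict]
      have : Continuous fun w : ↥(B ∩ {w | c ≤ l w}) =>
          proj ⟨w + v, h2 w w.2.1 w.2.2⟩ :=
        isQuotientMap_proj.continuous.comp (by fun_prop)
      refine this.congr fun w => (hG2 w w.2.1 _).symm
    intro w hw
    rcases lt_trichotomy (l w) c with h | h | h
    · refine ((c1 w ⟨hw, h.le⟩).continuousAt ?_).continuousWithinAt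
      filter_upwards [hB.mem_nhds hw, hl.continuousAt.eventually (gt_mem_nhds h)] with y a b
      exact ⟨a, le_of_lt b⟩
    · have := (c1 w ⟨hw, h.le⟩).union (c2 w ⟨hw, h.ge⟩)
      refine this.mono fun y hy => ?_
      rcases le_total (l y) c with h | h
      · exact Or.inl ⟨hy, h⟩
      · exact Or.inr ⟨hy, h⟩
    · refine ((c2 w ⟨hw, h.le⟩).continuousAt ?_).continuousWithinAt
      filter_upwards [hB.mem_nhds hw, hl.continuousAt.eventually (lt_mem_nhds h)] with y a b
      exact ⟨a, le_of_lt b⟩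
  have hFG : ∀ w ∈ B, G w ∈ V ∧ F (G w) = w := by
    intro w hw
    rcases le_total (l w) c with h | h
    · have hw' := h1 w hw h
      have hS : (⟨w, hw'⟩ : polygon) ∈ S := Or.inl hw
      rw [hG1 w hw hw']
      exact ⟨hS, by rw [hF _ hS, hfB _ hw]⟩
    · have hw' := h2 w hw h
      have hS : (⟨w + v, hw'⟩ : polygon) ∈ S := Or.inr (by simpa using hw)
      rw [hG2 w hw hw']
      exact ⟨hS, by rw [hF _ hS, hfB' _ (by simpa using hw)]; simp⟩
  have hGF : ∀ x ∈ V, F x ∈ B ∧ G (F x) = x := by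
    intro x hx
    obtain ⟨p, rfl⟩ := isQuotientMap_proj.surjective x
    have hpS : p ∈ S := hx
    rw [hF p hpS]
    rcases hpS with hp | hp
    · rw [hfB p hp]
      exact ⟨hp, hG1 _ hp p.2⟩
    · rw [hfB' p hp]
      refine ⟨hp, ?_⟩
      rw [hG2 _ hp (by simp)]
      simp
  let e : OpenPartialHomeomorph Surface ℂ :=
    ⟨⟨⟨F, G, V, B, fun x hx => (hGF x hx).1, fun w hw => (hFG w hw).1,
      fun x hx => (hGF x hx).2, fun w hw => (hFG w hw).2⟩, hFcont, hGcont⟩, hVopen, hB⟩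
  refine ⟨e, ?_, fun p hp => Or.inl hp⟩
  intro p hp
  refine ⟨f p - p, ?_⟩
  filter_upwards [hFeq p hp] with q hq
  obtain ⟨d, rfl, hd⟩ := hq
  exact hd


lemma dyadic_pos (n : ℕ) : (0 : ℝ) < (1 / 2) ^ n ∧ ((1 : ℝ) / 2) ^ n ≤ 1 :=
  ⟨by positivity, pow_le_one₀ (by norm_num) (by norm_num)⟩

lemma dyadic_odd {n : ℕ} (h : ¬ Even n) : ((1 : ℝ) / 2) ^ n ≤ 1 / 2 := by
  have h0 : 1 ≤ n := by
    rcases n with _ | n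
    · simp at h
    · omega
  calc ((1 : ℝ) / 2) ^ n ≤ (1 / 2) ^ 1 := pow_le_pow_of_le_one (by norm_num) (by norm_num) h0
    _ = 1 / 2 := by norm_num

lemma dyadic_le {n m k : ℕ} (h : n + k ≤ m) :
    ((1 : ℝ) / 2) ^ m ≤ (1 / 2) ^ n * (1 / 2) ^ k := by
  rw [← pow_add]
  exact pow_le_pow_of_le_one (by norm_num) (by norm_num) h

lemma dyadic_trichotomy (n m : ℕ) : n = m ∨ (n ≠ m ∧ ((1 : ℝ) / 2) ^ m ≤ (1 / 2) ^ n / 2 ∧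
      ((Even n ↔ Even m) → ((1 : ℝ) / 2) ^ m ≤ (1 / 2) ^ n / 4)) ∨
    (n ≠ m ∧ ((1 : ℝ) / 2) ^ n ≤ (1 / 2) ^ m / 2 ∧
      ((Even n ↔ Even m) → ((1 : ℝ) / 2) ^ n ≤ (1 / 2) ^ m / 4)) := by
  have aux : ∀ n m : ℕ, n < m → ((1 : ℝ) / 2) ^ m ≤ (1 / 2) ^ n / 2 ∧
      ((Even n ↔ Even m) → ((1 : ℝ) / 2) ^ m ≤ (1 / 2) ^ n / 4) := by
    intro n m h
    refine ⟨?_, fun hp => ?_⟩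
    · have := dyadic_le (n := n) (m := m) (k := 1) (by omega)
      linarith
    · have h2 : n + 2 ≤ m := by
        rcases Nat.lt_or_ge m (n + 2) with h' | h'
        · obtain rfl : m = n + 1 := by omega
          rw [Nat.even_add_one] at hp
          tauto
        · exact h'
      have := dyadic_le h2
      linarith
  rcases lt_trichotomy n m with h | h | h
  · exact Or.inr (Or.inl ⟨h.ne, aux n m h⟩)
  · exact Or.inl h
  · exact Or.inr (Or.inr ⟨h.ne', (aux m n h).1, fun hp => (aux m n h).2 hp.symm⟩)

/-- The identifications in coordinates. -/
lemma glued_cases {z w : ℂ} (h : Glued z w) :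
    (∃ n : ℕ, ∃ t : ℝ, 0 < t ∧ t < (1 / 2) ^ n / 4 ∧ z.re = 1 - (1 / 2) ^ n + t ∧ z.im = 1 ∧
      w.re = 1 / 2 - (1 / 2) ^ n * (3 / 4) + t ∧ w.im = 0) ∨
    (∃ n : ℕ, ∃ t : ℝ, 0 < t ∧ t < (1 / 2) ^ n / 4 ∧ z.re = 1 - (1 / 2) ^ n * (3 / 4) + t ∧
      z.im = 1 ∧ w.re = 1 / 2 - (1 / 2) ^ n + t ∧ w.im = 0) ∨
    (∃ t : ℝ, 0 < t ∧ t < 1 / 2 ∧ z.re = -1 / 2 + t ∧ z.im = 1 / 2 ∧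
      w.re = 1 / 2 + t ∧ w.im = 1 / 2) ∨
    (∃ n : ℕ, Even n ∧ ∃ t : ℝ, 0 < t ∧ t < (1 / 2) ^ n / 4 ∧ z.re = 1 / 2 ∧
      z.im = (1 / 2) ^ n / 4 + t ∧ w.re = 0 ∧ w.im = 2 / 3 + (1 / 2) ^ n / 12 + t) ∨
    (∃ n : ℕ, ¬ Even n ∧ ∃ t : ℝ, 0 < t ∧ t < (1 / 2) ^ n / 4 ∧ z.re = 1 ∧
      z.im = 1 - (1 / 2) ^ n / 2 + t ∧ w.re = 0 ∧ w.im = 2 / 3 - (1 / 2) ^ n / 3 + t) ∨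
    (∃ n : ℕ, Even n ∧ ∃ t : ℝ, 0 < t ∧ t < (1 / 2) ^ n / 4 ∧ z.re = 1 ∧
      z.im = 1 - (1 / 2) ^ n / 2 + t ∧ w.re = -1 / 2 ∧ w.im = 1 / 3 - (1 / 2) ^ n / 3 + t) ∨
    (∃ n : ℕ, ¬ Even n ∧ ∃ t : ℝ, 0 < t ∧ t < (1 / 2) ^ n / 4 ∧ z.re = 1 / 2 ∧
      z.im = (1 / 2) ^ n / 4 + t ∧ w.re = -1 / 2 ∧ w.im = 1 / 3 + (1 / 2) ^ n / 12 + t) := by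
  obtain ⟨e, t, ht0, ht1, rfl, rfl⟩ := h
  rcases e with n | n | _ | n | n
  · refine Or.inl ⟨n, t, ht0, ht1, ?_⟩
    simp [Edge.start₁, Edge.start₂, Edge.dir]
  · refine Or.inr (Or.inl ⟨n, t, ht0, ht1, ?_⟩)
    simp [Edge.start₁, Edge.start₂, Edge.dir]
  · refine Or.inr (Or.inr (Or.inl ⟨t, ht0, ht1, ?_⟩))
    simp [Edge.start₁, Edge.start₂, Edge.dir]
  · by_cases hn : Even n
    · refine Or.inr (Or.inr (Or.inr (Or.inl ⟨n, hn, t, ht0, ht1, ?_⟩)))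
      simp [Edge.start₁, Edge.start₂, Edge.dir, hn]
    · refine Or.inr (Or.inr (Or.inr (Or.inr (Or.inl ⟨n, hn, t, ht0, ht1, ?_⟩))))
      simp [Edge.start₁, Edge.start₂, Edge.dir, hn]
  · by_cases hn : Even n
    · refine Or.inr (Or.inr (Or.inr (Or.inr (Or.inr (Or.inl ⟨n, hn, t, ht0, ht1, ?_⟩)))))
      simp [Edge.start₁, Edge.start₂, Edge.dir, hn]
    · refine Or.inr (Or.inr (Or.inr (Or.inr (Or.inr (Or.inr ⟨n, hn, t, ht0, ht1, ?_⟩)))))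
      simp [Edge.start₁, Edge.start₂, Edge.dir, hn]

lemma polygon_subset {z : ℂ} (h : z ∈ polygon) :
    (0 ≤ z.re ∧ z.re ≤ 1 ∧ 1 / 2 ≤ z.im ∧ z.im ≤ 1) ∨
    (-1 / 2 ≤ z.re ∧ z.re ≤ 1 / 2 ∧ 0 ≤ z.im ∧ z.im ≤ 1 / 2) := by
  rcases h with ((h | h) | h) | ⟨w, h | h⟩
  · obtain ⟨⟨a, b⟩, c, d⟩ := h
    exact Or.inl ⟨a.le, b.le, c.le, d.le⟩
  · obtain ⟨⟨a, b⟩, c, d⟩ := h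
    exact Or.inr ⟨a.le, b.le, c.le, d.le⟩
  · obtain ⟨⟨a, b⟩, c, d⟩ := h
    rcases le_total z.im (1 / 2) with h | h
    · exact Or.inr ⟨by linarith, b.le, c.le, h⟩
    · exact Or.inl ⟨a.le, by linarith, h, d.le⟩
  all_goals
    rcases glued_cases h with ⟨n, t, h⟩ | ⟨n, t, h⟩ | ⟨t, h⟩ | ⟨n, hn, t, h⟩ | ⟨n, hn, t, h⟩ |
      ⟨n, hn, t, h⟩ | ⟨n, hn, t, h⟩
  all_goals
    obtain ⟨a, b, c, d, e, f⟩ := h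
    try have h0 := dyadic_pos n
    try have h1 := dyadic_odd hn
    try generalize ((1 : ℝ) / 2) ^ n = N at *
    first
      | exact Or.inl ⟨by linarith, by linarith, by linarith, by linarith⟩
      | exact Or.inr ⟨by linarith, by linarith, by linarith, by linarith⟩

lemma glued_not_interior {z w : ℂ} (h : Glued z w) :
    z ∉ polygonInterior ∧ w ∉ polygonInterior := by
  rcases glued_cases h with ⟨n, t, h⟩ | ⟨n, t, h⟩ | ⟨t, h⟩ | ⟨n, hn, t, h⟩ | ⟨n, hn, t, h⟩ |
    ⟨n, hn, t, h⟩ | ⟨n, hn, t, h⟩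
  all_goals
    obtain ⟨a, b, c, d, e, f⟩ := h
    try have h0 := dyadic_pos n
    try have h1 := dyadic_odd hn
    try generalize ((1 : ℝ) / 2) ^ n = N at *
    constructor
    all_goals
      rintro ((⟨⟨h1, h2⟩, h3, h4⟩ | ⟨⟨h1, h2⟩, h3, h4⟩) | ⟨⟨h1, h2⟩, h3, h4⟩) <;> linarith

set_option maxHeartbeats 1000000 in
/-- Each point of an open edge is identified with exactly one other point. -/
lemma glued_unique {p q p' q' : ℂ} (h : Glued p q) (h' : Glued p' q') :
    (p = p' ↔ q = q') ∧ q ≠ p' := by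
  have key : ((p.re = p'.re ∧ p.im = p'.im → q.re = q'.re ∧ q.im = q'.im) ∧
      (q.re = q'.re ∧ q.im = q'.im → p.re = p'.re ∧ p.im = p'.im)) ∧
      ¬ (q.re = p'.re ∧ q.im = p'.im) := by
    rcases glued_cases h with ⟨n, t, h⟩ | ⟨n, t, h⟩ | ⟨t, h⟩ | ⟨n, hn, t, h⟩ | ⟨n, hn, t, h⟩ |
      ⟨n, hn, t, h⟩ | ⟨n, hn, t, h⟩ <;>
    rcases glued_cases h' with ⟨m, s, h'⟩ | ⟨m, s, h'⟩ | ⟨s, h'⟩ | ⟨m, hm, s, h'⟩ |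
      ⟨m, hm, s, h'⟩ | ⟨m, hm, s, h'⟩ | ⟨m, hm, s, h'⟩
    all_goals
      obtain ⟨a, b, c, d, e, f⟩ := h
      obtain ⟨a', b', c', d', e', f'⟩ := h'
      rw [c, d, e, f, c', d', e', f']
      clear c d e f c' d' e' f'
      try have h0 := dyadic_pos n
      try have h0' := dyadic_pos m
      try have h1 := dyadic_odd hn
      try have h1' := dyadic_odd hm
      try have h2 := dyadic_trichotomy n m
      refine ⟨⟨?_, ?_⟩, ?_⟩ <;> rintro ⟨i, j⟩
    all_goals
      first
        | (exfalso; linarith)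
        | (constructor <;> linarith)
        | (rcases h2 with rfl | ⟨-, g, g'⟩ | ⟨-, g, g'⟩
           · first
               | contradiction
               | (exfalso; linarith)
               | (constructor <;> linarith)
           all_goals
             exfalso
             first
               | linarith
               | (have g := g' (by tauto); linarith))
  simp only [Complex.ext_iff, ne_eq]
  exact ⟨⟨key.1.1, key.1.2⟩, key.2⟩

lemma isOpen_polygonInterior : IsOpen polygonInterior :=
  ((isOpen_Ioo.reProdIm isOpen_Ioo).union (isOpen_Ioo.reProdIm isOpen_Ioo)).union
    (isOpen_Ioo.reProdIm isOpen_Ioo)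

lemma exists_chart_interior :
    ∃ e ∈ canonicalCharts, ∀ p : polygon, (p : ℂ) ∈ polygonInterior → proj p ∈ e.source := by
  have hre : ∀ z ∈ polygonInterior, -1 / 2 ≤ z.re ∧ z.re ≤ 1 := by
    intro z hz
    rcases polygon_subset (Or.inl hz) with h | h
    · exact ⟨by linarith, by linarith⟩
    · exact ⟨by linarith, by linarith⟩
  refine exists_chart polygonInterior isOpen_polygonInterior 100 (fun _ => 0) continuous_const 1
    (fun w hw _ => Or.inl hw) (fun w _ h => absurd h (by norm_num))
    (fun w _ h => absurd h (by norm_num)) (fun w _ _ => by norm_num) ?_ ?_ ?_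
  · intro w hw hw'
    exfalso
    have h1 := hre w hw
    rcases polygon_subset hw' with h2 | h2 <;> simp at h2 <;> linarith
  · intro w hw hw'
    have h1 := hre w hw
    have h2 := hre _ hw'
    simp at h2
    linarith
  · intro p q h hor
    exfalso
    have hp := polygon_subset (Or.inr ⟨q, Or.inl h⟩)
    have hq := polygon_subset (Or.inr ⟨p, Or.inr h⟩)
    rcases hor with h1 | h1 | h1 | h1
    · exact (glued_not_interior h).1 h1
    · have h2 := hre _ h1
      simp at h2
      rcases hp with hp | hp <;> linarith
    · exact (glued_not_interior h).2 h1
    · have h2 := hre _ h1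
      simp at h2
      rcases hq with hq | hq <;> linarith

/-- The open rectangle `(a, b) × (c, d)`. -/
def openBox (a b c d : ℝ) : Set ℂ := Ioo a b ×ℂ Ioo c d

lemma mem_openBox {a b c d : ℝ} {z : ℂ} :
    z ∈ openBox a b c d ↔ a < z.re ∧ z.re < b ∧ c < z.im ∧ z.im < d := by
  simp [openBox, mem_reProdIm, and_assoc]

/-- Charts around horizontal edges. -/
lemma exists_chart_horizontal (x₁ y₁ x₂ y₂ s : ℝ)
    (hG : ∀ t, 0 < t → t < s → Glued ⟨x₁ + t, y₁⟩ ⟨x₂ + t, y₂⟩)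
    (h1 : openBox x₁ (x₁ + s) (y₁ - 1 / 4) y₁ ⊆ polygonInterior)
    (h2 : openBox x₂ (x₂ + s) y₂ (y₂ + 1 / 4) ⊆ polygonInterior)
    (h3 : Disjoint (openBox x₁ (x₁ + s) y₁ (y₁ + 1 / 4)) polygon)
    (h4 : Disjoint (openBox x₂ (x₂ + s) (y₂ - 1 / 4) y₂) polygon)
    (h5 : x₁ + s ≤ x₂ ∨ x₂ + s ≤ x₁ ∨ y₂ + 1 / 2 ≤ y₁) :
    ∃ e ∈ canonicalCharts, ∀ p : polygon,
      (p : ℂ) ∈ openBox x₁ (x₁ + s) (y₁ - 1 / 4) (y₁ + 1 / 4) → proj p ∈ e.source := by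
  have hv : ∀ z : ℂ, z + ⟨x₂ - x₁, y₂ - y₁⟩ ∈ openBox x₂ (x₂ + s) y₂ (y₂ + 1 / 4) ↔
      z ∈ openBox x₁ (x₁ + s) y₁ (y₁ + 1 / 4) := by
    intro z
    simp only [mem_openBox, add_re, add_im]
    constructor <;> rintro ⟨a, b, c, d⟩ <;>
      exact ⟨by linarith, by linarith, by linarith, by linarith⟩
  have hG' : ∀ w ∈ openBox x₁ (x₁ + s) (y₁ - 1 / 4) (y₁ + 1 / 4), w.im = y₁ →
      Glued w (w + ⟨x₂ - x₁, y₂ - y₁⟩) := by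
    intro w hw h
    rw [mem_openBox] at hw
    have := hG (w.re - x₁) (by linarith) (by linarith)
    convert this using 1
    · apply Complex.ext
      · simp
      · simp [h]
    · apply Complex.ext
      · simp; ring
      · simp [h]
  refine exists_chart (openBox x₁ (x₁ + s) (y₁ - 1 / 4) (y₁ + 1 / 4))
    (isOpen_Ioo.reProdIm isOpen_Ioo) ⟨x₂ - x₁, y₂ - y₁⟩ (fun z => z.im) continuous_im y₁
    ?_ ?_ hG' ?_ ?_ ?_ ?_
  · intro w hw h
    rcases h.lt_or_eq with h | h
    · rw [mem_openBox] at hw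
      exact Or.inl (h1 (mem_openBox.2 ⟨hw.1, hw.2.1, hw.2.2.1, h⟩))
    · exact Or.inr ⟨_, Or.inl (hG' w hw h)⟩
  · intro w hw h
    rcases h.lt_or_eq with h | h
    · rw [mem_openBox] at hw
      exact Or.inl (h2 ((hv w).2 (mem_openBox.2 ⟨hw.1, hw.2.1, h, hw.2.2.2⟩)))
    · exact Or.inr ⟨_, Or.inr (hG' w hw h.symm)⟩
  · intro w hw hw'
    rw [mem_openBox] at hw
    by_contra! h
    exact Set.disjoint_left.1 h3 (mem_openBox.2 ⟨hw.1, hw.2.1, h, hw.2.2.2⟩) hw'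
  · intro w hw hw'
    rw [mem_openBox] at hw
    by_contra! h
    refine Set.disjoint_left.1 h4 (mem_openBox.2 ?_) hw'
    simp only [add_re, add_im]
    exact ⟨by linarith, by linarith, by linarith, by linarith⟩
  · intro w hw hw'
    rw [mem_openBox] at hw hw'
    simp only [add_re, add_im] at hw'
    rcases h5 with h5 | h5 | h5 <;> linarith
  · have hb : ∀ z ∈ openBox x₁ (x₁ + s) (y₁ - 1 / 4) (y₁ + 1 / 4), z ∈ polygon →
        z ∉ polygonInterior → Glued z (z + ⟨x₂ - x₁, y₂ - y₁⟩) := by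
      intro z hz hz' hz''
      refine hG' z hz ?_
      obtain ⟨j1, j2, j3, j4⟩ := mem_openBox.1 hz
      rcases lt_trichotomy z.im y₁ with lt | eq | lt
      · exact absurd (h1 (mem_openBox.2 ⟨j1, j2, j3, lt⟩)) hz''
      · exact eq
      · exact absurd hz' (Set.disjoint_left.1 h3 (mem_openBox.2 ⟨j1, j2, lt, j4⟩))
    have hb' : ∀ z, z - ⟨x₂ - x₁, y₂ - y₁⟩ ∈ openBox x₁ (x₁ + s) (y₁ - 1 / 4) (y₁ + 1 / 4) →
        z ∈ polygon → z ∉ polygonInterior → Glued (z - ⟨x₂ - x₁, y₂ - y₁⟩) z := by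
      intro z hz hz' hz''
      have hz0 := hG' _ hz
      rw [sub_add_cancel] at hz0
      obtain ⟨j1, j2, j3, j4⟩ := mem_openBox.1 hz
      simp only [sub_re, sub_im] at j1 j2 j3 j4 hz0
      rcases lt_trichotomy z.im y₂ with lt | eq | lt
      · refine absurd hz' (Set.disjoint_left.1 h4 (mem_openBox.2 ?_))
        exact ⟨by linarith, by linarith, by linarith, by linarith⟩
      · exact hz0 (by linarith)
      · refine absurd (h2 (mem_openBox.2 ?_)) hz''
        exact ⟨by linarith, by linarith, by linarith, by linarith⟩
    intro p q h hor
    have hp : p ∈ polygon := Or.inr ⟨q, Or.inl h⟩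
    have hq : q ∈ polygon := Or.inr ⟨p, Or.inr h⟩
    obtain ⟨hpi, hqi⟩ := glued_not_interior h
    rcases hor with k | k | k | k
    · exact ⟨k, (glued_unique h (hb p k hp hpi)).1.1 rfl⟩
    · exact absurd rfl (glued_unique (hb' p k hp hpi) h).2
    · exact absurd rfl (glued_unique h (hb q k hq hqi)).2
    · obtain rfl := (glued_unique h (hb' q k hq hqi)).1.2 rfl
      exact ⟨k, by simp⟩

/-- Charts around vertical edges. -/
lemma exists_chart_vertical (x₁ y₁ x₂ y₂ s : ℝ)
    (hG : ∀ t, 0 < t → t < s → Glued ⟨x₁, y₁ + t⟩ ⟨x₂, y₂ + t⟩)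
    (h1 : openBox (x₁ - 1 / 4) x₁ y₁ (y₁ + s) ⊆ polygonInterior)
    (h2 : openBox x₂ (x₂ + 1 / 4) y₂ (y₂ + s) ⊆ polygonInterior)
    (h3 : Disjoint (openBox x₁ (x₁ + 1 / 4) y₁ (y₁ + s)) polygon)
    (h4 : Disjoint (openBox (x₂ - 1 / 4) x₂ y₂ (y₂ + s)) polygon)
    (h5 : x₂ + 1 / 2 ≤ x₁) :
    ∃ e ∈ canonicalCharts, ∀ p : polygon,
      (p : ℂ) ∈ openBox (x₁ - 1 / 4) (x₁ + 1 / 4) y₁ (y₁ + s) → proj p ∈ e.source := by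
  have hv : ∀ z : ℂ, z + ⟨x₂ - x₁, y₂ - y₁⟩ ∈ openBox x₂ (x₂ + 1 / 4) y₂ (y₂ + s) ↔
      z ∈ openBox x₁ (x₁ + 1 / 4) y₁ (y₁ + s) := by
    intro z
    simp only [mem_openBox, add_re, add_im]
    constructor <;> rintro ⟨a, b, c, d⟩ <;>
      exact ⟨by linarith, by linarith, by linarith, by linarith⟩
  have hG' : ∀ w ∈ openBox (x₁ - 1 / 4) (x₁ + 1 / 4) y₁ (y₁ + s), w.re = x₁ →
      Glued w (w + ⟨x₂ - x₁, y₂ - y₁⟩) := by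
    intro w hw h
    rw [mem_openBox] at hw
    have := hG (w.im - y₁) (by linarith) (by linarith)
    convert this using 1
    · apply Complex.ext
      · simp [h]
      · simp
    · apply Complex.ext
      · simp [h]
      · simp; ring
  refine exists_chart (openBox (x₁ - 1 / 4) (x₁ + 1 / 4) y₁ (y₁ + s))
    (isOpen_Ioo.reProdIm isOpen_Ioo) ⟨x₂ - x₁, y₂ - y₁⟩ (fun z => z.re) continuous_re x₁
    ?_ ?_ hG' ?_ ?_ ?_ ?_
  · intro w hw h
    rcases h.lt_or_eq with h | h
    · rw [mem_openBox] at hw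
      exact Or.inl (h1 (mem_openBox.2 ⟨hw.1, h, hw.2.2⟩))
    · exact Or.inr ⟨_, Or.inl (hG' w hw h)⟩
  · intro w hw h
    rcases h.lt_or_eq with h | h
    · rw [mem_openBox] at hw
      exact Or.inl (h2 ((hv w).2 (mem_openBox.2 ⟨h, hw.2⟩)))
    · exact Or.inr ⟨_, Or.inr (hG' w hw h.symm)⟩
  · intro w hw hw'
    rw [mem_openBox] at hw
    by_contra! h
    exact Set.disjoint_left.1 h3 (mem_openBox.2 ⟨h, hw.2⟩) hw'
  · intro w hw hw'
    rw [mem_openBox] at hw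
    by_contra! h
    refine Set.disjoint_left.1 h4 (mem_openBox.2 ?_) hw'
    simp only [add_re, add_im]
    exact ⟨by linarith, by linarith, by linarith, by linarith⟩
  · intro w hw hw'
    rw [mem_openBox] at hw hw'
    simp only [add_re, add_im] at hw'
    linarith
  · have hb : ∀ z ∈ openBox (x₁ - 1 / 4) (x₁ + 1 / 4) y₁ (y₁ + s), z ∈ polygon →
        z ∉ polygonInterior → Glued z (z + ⟨x₂ - x₁, y₂ - y₁⟩) := by
      intro z hz hz' hz''
      refine hG' z hz ?_
      obtain ⟨j1, j2, j3, j4⟩ := mem_openBox.1 hz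
      rcases lt_trichotomy z.re x₁ with lt | eq | lt
      · exact absurd (h1 (mem_openBox.2 ⟨j1, lt, j3, j4⟩)) hz''
      · exact eq
      · exact absurd hz' (Set.disjoint_left.1 h3 (mem_openBox.2 ⟨lt, j2, j3, j4⟩))
    have hb' : ∀ z, z - ⟨x₂ - x₁, y₂ - y₁⟩ ∈ openBox (x₁ - 1 / 4) (x₁ + 1 / 4) y₁ (y₁ + s) →
        z ∈ polygon → z ∉ polygonInterior → Glued (z - ⟨x₂ - x₁, y₂ - y₁⟩) z := by
      intro z hz hz' hz''
      have hz0 := hG' _ hz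
      rw [sub_add_cancel] at hz0
      obtain ⟨j1, j2, j3, j4⟩ := mem_openBox.1 hz
      simp only [sub_re, sub_im] at j1 j2 j3 j4 hz0
      rcases lt_trichotomy z.re x₂ with lt | eq | lt
      · refine absurd hz' (Set.disjoint_left.1 h4 (mem_openBox.2 ?_))
        exact ⟨by linarith, by linarith, by linarith, by linarith⟩
      · exact hz0 (by linarith)
      · refine absurd (h2 (mem_openBox.2 ?_)) hz''
        exact ⟨by linarith, by linarith, by linarith, by linarith⟩
    intro p q h hor
    have hp : p ∈ polygon := Or.inr ⟨q, Or.inl h⟩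
    have hq : q ∈ polygon := Or.inr ⟨p, Or.inr h⟩
    obtain ⟨hpi, hqi⟩ := glued_not_interior h
    rcases hor with k | k | k | k
    · exact ⟨k, (glued_unique h (hb p k hp hpi)).1.1 rfl⟩
    · exact absurd rfl (glued_unique (hb' p k hp hpi) h).2
    · exact absurd rfl (glued_unique h (hb q k hq hqi)).2
    · obtain rfl := (glued_unique h (hb' q k hq hqi)).1.2 rfl
      exact ⟨k, by simp⟩

lemma box_upper {a b c d : ℝ} (h1 : 0 ≤ a) (h2 : b ≤ 1) (h3 : 1 / 2 ≤ c) (h4 : d ≤ 1) :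
    openBox a b c d ⊆ polygonInterior := by
  intro z hz
  rw [mem_openBox] at hz
  exact Or.inl (Or.inl ⟨⟨by linarith, by linarith⟩, by linarith, by linarith⟩)

lemma box_lower {a b c d : ℝ} (h1 : -1 / 2 ≤ a) (h2 : b ≤ 1 / 2) (h3 : 0 ≤ c) (h4 : d ≤ 1 / 2) :
    openBox a b c d ⊆ polygonInterior := by
  intro z hz
  rw [mem_openBox] at hz
  exact Or.inl (Or.inr ⟨⟨by linarith, by linarith⟩, by linarith, by linarith⟩)

lemma box_outside {a b c d : ℝ} (h1 : b ≤ 0 ∨ 1 ≤ a ∨ d ≤ 1 / 2 ∨ 1 ≤ c)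
    (h2 : b ≤ -1 / 2 ∨ 1 / 2 ≤ a ∨ d ≤ 0 ∨ 1 / 2 ≤ c) : Disjoint (openBox a b c d) polygon := by
  rw [Set.disjoint_left]
  intro z hz hz'
  rw [mem_openBox] at hz
  rcases polygon_subset hz' with h | h
  · rcases h1 with h1 | h1 | h1 | h1 <;> linarith
  · rcases h2 with h2 | h2 | h2 | h2 <;> linarith

set_option maxHeartbeats 1000000 in
/-- Every edge lies in the domain of a canonical chart. -/
lemma exists_chart_edge (e₀ : Edge) : ∃ e ∈ canonicalCharts, ∀ p : polygon, ∀ t : ℝ, 0 < t →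
    t < e₀.len → (p : ℂ) = e₀.start₁ + t * e₀.dir → proj p ∈ e.source := by
  have pow_eq : ∀ m : ℕ, ((1 : ℝ) / 2) ^ m = (2 ^ m)⁻¹ := by simp
  rcases e₀ with m | m | _ | m | m
  all_goals
    try have hm := dyadic_pos m
    try have hm1 := pow_eq m
  · refine Exists.imp ?_ (exists_chart_horizontal (1 - (1 / 2) ^ m) 1
      (1 / 2 - (1 / 2) ^ m * (3 / 4)) 0 ((1 / 2) ^ m / 4)
      (fun t h0 h1 => ⟨Edge.C₁ m, t, h0, h1,
        by apply Complex.ext <;> simp [Edge.start₁, Edge.dir],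
        by apply Complex.ext <;> simp [Edge.start₂, Edge.dir]⟩)
      (box_upper (by linarith) (by linarith) (by linarith) (by linarith))
      (box_lower (by linarith) (by linarith) (by linarith) (by linarith))
      (box_outside (by norm_num) (by norm_num)) (box_outside (by norm_num) (by norm_num))
      (by norm_num))
    rintro e ⟨he, h⟩
    refine ⟨he, fun p t h0 h1 hp => h p ?_⟩
    have hr := congrArg Complex.re hp
    have hi := congrArg Complex.im hp
    simp [Edge.start₁, Edge.dir, Edge.len] at h1 hr hi
    exact mem_openBox.2 ⟨by linarith, by linarith, by linarith, by linarith⟩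
  · refine Exists.imp ?_ (exists_chart_horizontal (1 - (1 / 2) ^ m * (3 / 4)) 1
      (1 / 2 - (1 / 2) ^ m) 0 ((1 / 2) ^ m / 4)
      (fun t h0 h1 => ⟨Edge.C₂ m, t, h0, h1,
        by apply Complex.ext <;> simp [Edge.start₁, Edge.dir],
        by apply Complex.ext <;> simp [Edge.start₂, Edge.dir]⟩)
      (box_upper (by linarith) (by linarith) (by linarith) (by linarith))
      (box_lower (by linarith) (by linarith) (by linarith) (by linarith))
      (box_outside (by norm_num) (by norm_num)) (box_outside (by norm_num) (by norm_num))
      (by norm_num))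
    rintro e ⟨he, h⟩
    refine ⟨he, fun p t h0 h1 hp => h p ?_⟩
    have hr := congrArg Complex.re hp
    have hi := congrArg Complex.im hp
    simp [Edge.start₁, Edge.dir, Edge.len] at h1 hr hi
    exact mem_openBox.2 ⟨by linarith, by linarith, by linarith, by linarith⟩
  · refine Exists.imp ?_ (exists_chart_horizontal (-1 / 2) (1 / 2)
      (1 / 2) (1 / 2) (1 / 2)
      (fun t h0 h1 => ⟨Edge.S, t, h0, h1,
        by apply Complex.ext <;> simp [Edge.start₁, Edge.dir],
        by apply Complex.ext <;> simp [Edge.start₂, Edge.dir]⟩)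
      (box_lower (by linarith) (by linarith) (by linarith) (by linarith))
      (box_upper (by linarith) (by linarith) (by linarith) (by linarith))
      (box_outside (by norm_num) (by norm_num)) (box_outside (by norm_num) (by norm_num))
      (by norm_num))
    rintro e ⟨he, h⟩
    refine ⟨he, fun p t h0 h1 hp => h p ?_⟩
    have hr := congrArg Complex.re hp
    have hi := congrArg Complex.im hp
    simp [Edge.start₁, Edge.dir, Edge.len] at h1 hr hi
    exact mem_openBox.2 ⟨by linarith, by linarith, by linarith, by linarith⟩
  · by_cases hm2 : Even m
    · refine Exists.imp ?_ (exists_chart_vertical (1 / 2) ((1 / 2) ^ m / 4)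
        0 (2 / 3 + (1 / 2) ^ m / 12) ((1 / 2) ^ m / 4)
        (fun t h0 h1 => ⟨Edge.A m, t, h0, h1,
          by apply Complex.ext <;> simp [Edge.start₁, Edge.dir, hm2],
          by apply Complex.ext <;> simp [Edge.start₂, Edge.dir, hm2]⟩)
        (box_lower (by linarith) (by linarith) (by linarith) (by linarith))
        (box_upper (by linarith) (by linarith) (by linarith) (by linarith))
        (box_outside (Or.inr (Or.inr (Or.inl (by linarith)))) (by norm_num)) (box_outside (by norm_num) (Or.inr (Or.inr (Or.inr (by linarith)))))
        (by norm_num))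
      rintro e ⟨he, h⟩
      refine ⟨he, fun p t h0 h1 hp => h p ?_⟩
      have hr := congrArg Complex.re hp
      have hi := congrArg Complex.im hp
      simp [Edge.start₁, Edge.dir, Edge.len, hm2] at h1 hr hi
      exact mem_openBox.2 ⟨by linarith, by linarith, by linarith, by linarith⟩
    · have hm3 := dyadic_odd hm2
      refine Exists.imp ?_ (exists_chart_vertical 1 (1 - (1 / 2) ^ m / 2)
        0 (2 / 3 - (1 / 2) ^ m / 3) ((1 / 2) ^ m / 4)
        (fun t h0 h1 => ⟨Edge.A m, t, h0, h1,
          by apply Complex.ext <;> simp [Edge.start₁, Edge.dir, hm2],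
          by apply Complex.ext <;> simp [Edge.start₂, Edge.dir, hm2]⟩)
        (box_upper (by linarith) (by linarith) (by linarith) (by linarith))
        (box_upper (by linarith) (by linarith) (by linarith) (by linarith))
        (box_outside (by norm_num) (by norm_num)) (box_outside (by norm_num) (Or.inr (Or.inr (Or.inr (by linarith)))))
        (by norm_num))
      rintro e ⟨he, h⟩
      refine ⟨he, fun p t h0 h1 hp => h p ?_⟩
      have hr := congrArg Complex.re hp
      have hi := congrArg Complex.im hp
      simp [Edge.start₁, Edge.dir, Edge.len, hm2] at h1 hr hi
      exact mem_openBox.2 ⟨by linarith, by linarith, by linarith, by linarith⟩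
  · by_cases hm2 : Even m
    · refine Exists.imp ?_ (exists_chart_vertical 1 (1 - (1 / 2) ^ m / 2)
        (-1 / 2) (1 / 3 - (1 / 2) ^ m / 3) ((1 / 2) ^ m / 4)
        (fun t h0 h1 => ⟨Edge.B m, t, h0, h1,
          by apply Complex.ext <;> simp [Edge.start₁, Edge.dir, hm2],
          by apply Complex.ext <;> simp [Edge.start₂, Edge.dir, hm2]⟩)
        (box_upper (by linarith) (by linarith) (by linarith) (by linarith))
        (box_lower (by linarith) (by linarith) (by linarith) (by linarith))
        (box_outside (by norm_num) (by norm_num)) (box_outside (by norm_num) (by norm_num))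
        (by norm_num))
      rintro e ⟨he, h⟩
      refine ⟨he, fun p t h0 h1 hp => h p ?_⟩
      have hr := congrArg Complex.re hp
      have hi := congrArg Complex.im hp
      simp [Edge.start₁, Edge.dir, Edge.len, hm2] at h1 hr hi
      exact mem_openBox.2 ⟨by linarith, by linarith, by linarith, by linarith⟩
    · have hm3 := dyadic_odd hm2
      refine Exists.imp ?_ (exists_chart_vertical (1 / 2) ((1 / 2) ^ m / 4)
        (-1 / 2) (1 / 3 + (1 / 2) ^ m / 12) ((1 / 2) ^ m / 4)
        (fun t h0 h1 => ⟨Edge.B m, t, h0, h1,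
          by apply Complex.ext <;> simp [Edge.start₁, Edge.dir, hm2],
          by apply Complex.ext <;> simp [Edge.start₂, Edge.dir, hm2]⟩)
        (box_lower (by linarith) (by linarith) (by linarith) (by linarith))
        (box_lower (by linarith) (by linarith) (by linarith) (by linarith))
        (box_outside (Or.inr (Or.inr (Or.inl (by linarith)))) (by norm_num)) (box_outside (by norm_num) (by norm_num))
        (by norm_num))
      rintro e ⟨he, h⟩
      refine ⟨he, fun p t h0 h1 hp => h p ?_⟩
      have hr := congrArg Complex.re hp
      have hi := congrArg Complex.im hp
      simp [Edge.start₁, Edge.dir, Edge.len, hm2] at h1 hr hi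
      exact mem_openBox.2 ⟨by linarith, by linarith, by linarith, by linarith⟩

/-- Every point of the surface lies in a canonical chart. -/
lemma exists_canonicalChart (x : Surface) : ∃ e ∈ canonicalCharts, x ∈ e.source := by
  obtain ⟨p, rfl⟩ := isQuotientMap_proj.surjective x
  rcases p with ⟨z, hz⟩
  have aux : ∀ (p q : polygon), Glued p q → ∃ e ∈ canonicalCharts, proj p ∈ e.source := by
    rintro p q ⟨e₀, t, h0, h1, h2, -⟩
    obtain ⟨e, he, h⟩ := exists_chart_edge e₀
    exact ⟨e, he, h p t h0 h1 h2⟩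
  rcases id hz with hz' | ⟨w, hw | hw⟩
  · obtain ⟨e, he, h⟩ := exists_chart_interior
    exact ⟨e, he, h _ hz'⟩
  · exact aux ⟨z, _⟩ ⟨w, Or.inr ⟨z, Or.inr hw⟩⟩ hw
  · have hw' : w ∈ polygon := Or.inr ⟨z, Or.inl hw⟩
    obtain ⟨e, he, h⟩ := aux ⟨w, hw'⟩ ⟨z, hz⟩ hw
    refine ⟨e, he, ?_⟩
    have : proj ⟨w, hw'⟩ = proj ⟨z, hz⟩ := proj_eq hw
    rwa [← this]

/-- The surface with the atlas of all canonical charts of `ω_∞`. -/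
noncomputable instance : ChartedSpace ℂ Surface where
  atlas := canonicalCharts
  chartAt x := (exists_canonicalChart x).choose
  mem_chart_source x := (exists_canonicalChart x).choose_spec.2
  chart_mem_atlas x := (exists_canonicalChart x).choose_spec.1

instance : TranslationAtlas Surface where
  eq_add_const := by
    intro e he e' he' x hx hx'
    refine ⟨e' x - e x, ?_⟩
    let W : Set Surface :=
      {y | y ∈ e.source ∧ y ∈ e'.source ∧ e' y = e y + (e' x - e x)}
    have hW : IsOpen W := by
      rw [← isQuotientMap_proj.isOpen_preimage, isOpen_iff_mem_nhds]
      rintro p ⟨h1, h2, h3⟩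
      obtain ⟨c, hc⟩ := he p h1
      obtain ⟨c', hc'⟩ := he' p h2
      have h4 := hc.self_of_nhds
      have h5 := hc'.self_of_nhds
      filter_upwards [hc, hc',
        isQuotientMap_proj.continuous.continuousAt.eventually (e.open_source.mem_nhds h1),
        isQuotientMap_proj.continuous.continuousAt.eventually (e'.open_source.mem_nhds h2)]
        with q g1 g2 g3 g4
      refine ⟨g3, g4, ?_⟩
      rw [g1, g2, add_assoc]
      rw [h4, h5] at h3
      linear_combination h3
    filter_upwards [hW.mem_nhds ⟨hx, hx', by ring⟩] with y hy using hy.2.2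

/-! ### The two affine maps -/

/-- `f` is the map `ψ_∞`: it stretches the central rectangle `[0,1/2] × [0,1]` horizontally by `2`
and shrinks it vertically by `1/2`, and lays the result over the lower rectangle; it does the same
with the rectangle obtained by stacking the square `[1/2,1] × [1/2,1]` on top of the square
`[-1/2,0] × [0,1/2]`, and lays the result over the upper rectangle. -/
def IsPsi (f : Surface → Surface) : Prop :=
  (∀ p : polygon, (p : ℂ) ∈ Icc 0 (1 / 2) ×ℂ Icc 0 1 →
    ∃ q : polygon, (q : ℂ) = ⟨2 * (p : ℂ).re - 1 / 2, (p : ℂ).im / 2⟩ ∧ f (proj p) = proj q) ∧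
  (∀ p : polygon, (p : ℂ) ∈ Icc (-1 / 2) 0 ×ℂ Icc 0 (1 / 2) →
    ∃ q : polygon, (q : ℂ) = ⟨2 * (p : ℂ).re + 1, (p : ℂ).im / 2 + 1 / 2⟩ ∧
      f (proj p) = proj q) ∧
  (∀ p : polygon, (p : ℂ) ∈ Icc (1 / 2) 1 ×ℂ Icc (1 / 2) 1 →
    ∃ q : polygon, (q : ℂ) = ⟨2 * (p : ℂ).re - 1, (p : ℂ).im / 2 + 1 / 2⟩ ∧ f (proj p) = proj q)

/-- `f` is the map `ρ_∞`: the glide reflection in the horizontal axis `y = 1/2` with translation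
length `1/2`, which exchanges the upper and the lower rectangle. -/
def IsRho (f : Surface → Surface) : Prop :=
  (∀ p : polygon, (p : ℂ) ∈ Icc (-1 / 2) (1 / 2) ×ℂ Icc 0 (1 / 2) →
    ∃ q : polygon, (q : ℂ) = ⟨(p : ℂ).re + 1 / 2, 1 - (p : ℂ).im⟩ ∧ f (proj p) = proj q) ∧
  (∀ p : polygon, (p : ℂ) ∈ Icc 0 1 ×ℂ Icc (1 / 2) 1 →
    ∃ q : polygon, (q : ℂ) = ⟨(p : ℂ).re - 1 / 2, 1 - (p : ℂ).im⟩ ∧ f (proj p) = proj q)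

end ArnouxYoccoz

namespace ArnouxYoccoz

/-! ### Local structure of the surface -/

/-! Existence of `ψ` and `ρ` is a check on edges, with the index n as a parameter. `ρ` exchanges `C₁
n` with `C₂ n` and `A n` with `B n`; `ψ` sends `C₁ (n + 1)` to `C₁ n`, `C₂ (n + 1)` to `C₂ n`, `A n`
to `B (n + 1)` and `B n` to `A (n + 1)`. The remaining edges become interior segments or match the
cuts that the maps make. The graph and its inverse both satisfy `IsPiecewise`, and this produces
affine homeomorphisms.

The converse is rigidity at the points missing from the surface. These are visible from within: by
`mem_polygon_of_tendsto`, polygon points that converge in the plane have converging images on the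
surface only if their planar limit belongs to the polygon. So a sector (`wedge`) with missing points
on one side accumulating at its apex is carried by an affine homeomorphism to another such sector.
To locate all of these, `exists_rect_lift` follows a trajectory of finite length, neither horizontal
nor vertical, back to its start: a potential that drops by at least 1 at every change of rectangle
permits only finitely many changes, so the beginning of the trajectory is a segment in one
rectangle. Hence every sector is a planar sector near its apex, and the accumulation points of the
vertices show (`IsSingular.direction`) that a singular side is vertical or points left; if it points
left and the other side points down, the apex is the corner 1 + I.

At the point (0, 2/3) vertices accumulate from above and from below, and the two image directions
cannot both point left, so the vertical direction is preserved. At 1 + I the image of the leftward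
direction must again point left, so the derivative M is diagonal with `M 0 0 > 0`; if `M 1 1 > 0`,
the corner is mapped to itself. Multiplication by `M 0 0` then respects the distances 2^(-n) and
(3/4) 2^(-n) of the vertices from the corner, so it is a power of 2. If `M 0 0 = 1`, the vertical
saddle connection from 1/4 + I to 1/4 gives `M 1 1 = 1`. Derivative 1 near the corner yields a fixed
point, and connectedness yields the identity. Thus a power of `ψ`, and `ρ` if `M 1 1 < 0`, reduces
every element to 1; as the derivative is faithful, all relations can be read off matrices. -/

lemma Glued.left_mem {p q : ℂ} (h : Glued p q) : p ∈ polygon := Or.inr ⟨q, Or.inl h⟩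

lemma Glued.right_mem {p q : ℂ} (h : Glued p q) : q ∈ polygon := Or.inr ⟨p, Or.inr h⟩

set_option maxHeartbeats 1000000 in
/-- Near a pair of glued points the polygon consists of two complementary half discs. -/
lemma glued_nhds {p q : ℂ} (h : Glued p q) : ∃ (l : ℂ → ℝ) (δ : ℝ), 0 < δ ∧
    ∀ z : ℂ, |z.re| < δ → |z.im| < δ →
      (p + z ∈ polygon → l z ≤ 0) ∧ (l z < 0 → p + z ∈ polygonInterior) ∧
      (q + z ∈ polygon → 0 ≤ l z) ∧ (0 < l z → q + z ∈ polygonInterior) ∧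
      (l z = 0 → Glued (p + z) (q + z)) := by
  have up : ∀ z : ℂ, 0 < z.re → z.re < 1 → 1 / 2 < z.im → z.im < 1 → z ∈ polygonInterior :=
    fun z h1 h2 h3 h4 => Or.inl (Or.inl ⟨⟨h1, h2⟩, h3, h4⟩)
  have lo : ∀ z : ℂ, -1 / 2 < z.re → z.re < 1 / 2 → 0 < z.im → z.im < 1 / 2 →
      z ∈ polygonInterior := fun z h1 h2 h3 h4 => Or.inl (Or.inr ⟨⟨h1, h2⟩, h3, h4⟩)
  obtain ⟨e, t, h0, h1, rfl, rfl⟩ := h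
  have pow_eq : ∀ m : ℕ, ((1 : ℝ) / 2) ^ m = (2 ^ m)⁻¹ := by simp
  -- `l` is the coordinate transverse to the edge. The radius keeps z between the endpoints of the
  -- edge, and the bound 1/4 keeps it away from the opposite sides of the rectangles.
  have main : ∀ (l : ℂ → ℝ), (∀ z, (l z = z.im ∧ e.dir = 1) ∨ (l z = z.re ∧ e.dir = I)) →
    (∀ z : ℂ, |z.re| < min (min t (e.len - t)) (1 / 4) →
        |z.im| < min (min t (e.len - t)) (1 / 4) →
      (e.start₁ + t * e.dir + z ∈ polygon → l z ≤ 0) ∧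
      (l z < 0 → e.start₁ + t * e.dir + z ∈ polygonInterior) ∧
      (e.start₂ + t * e.dir + z ∈ polygon → 0 ≤ l z) ∧
      (0 < l z → e.start₂ + t * e.dir + z ∈ polygonInterior)) →
    ∃ (l : ℂ → ℝ) (δ : ℝ), 0 < δ ∧ ∀ z : ℂ, |z.re| < δ → |z.im| < δ →
      (e.start₁ + t * e.dir + z ∈ polygon → l z ≤ 0) ∧
      (l z < 0 → e.start₁ + t * e.dir + z ∈ polygonInterior) ∧
      (e.start₂ + t * e.dir + z ∈ polygon → 0 ≤ l z) ∧
      (0 < l z → e.start₂ + t * e.dir + z ∈ polygonInterior) ∧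
      (l z = 0 → Glued (e.start₁ + t * e.dir + z) (e.start₂ + t * e.dir + z)) := by
    intro l hl H
    refine ⟨l, min (min t (e.len - t)) (1 / 4), by
      simp only [lt_min_iff]; exact ⟨⟨h0, by linarith⟩, by norm_num⟩, fun z hre him => ?_⟩
    obtain ⟨a, b, c, d⟩ := H z hre him
    refine ⟨a, b, c, d, fun hz => ?_⟩
    simp only [lt_min_iff, abs_lt] at hre him
    rcases hl z with ⟨hz', hd⟩ | ⟨hz', hd⟩
    · refine ⟨e, t + z.re, by linarith, by linarith, ?_, ?_⟩ <;>
      · rw [hd]; apply Complex.ext <;> simp <;> linarith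
    · refine ⟨e, t + z.im, by linarith, by linarith, ?_, ?_⟩ <;>
      · rw [hd]; apply Complex.ext <;> simp <;> linarith
  rcases e with n | n | _ | n | n
  all_goals
    try have hn0 := dyadic_pos n
    try have hn1 := pow_eq n
  · refine main (fun z => z.im) (fun z => Or.inl ⟨rfl, rfl⟩) (fun z hre him => ?_)
    simp only [lt_min_iff, abs_lt, Edge.len] at hre him h1
    refine ⟨fun h => ?_, fun h => up _ ?_ ?_ ?_ ?_, fun h => ?_, fun h => lo _ ?_ ?_ ?_ ?_⟩
    · have := polygon_subset h
      simp [Edge.start₁, Edge.dir] at this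
      rcases this with h | h <;> linarith
    rotate_left 4
    · have := polygon_subset h
      simp [Edge.start₂, Edge.dir] at this
      rcases this with h | h <;> linarith
    all_goals simp [Edge.start₁, Edge.start₂, Edge.dir]; linarith
  · refine main (fun z => z.im) (fun z => Or.inl ⟨rfl, rfl⟩) (fun z hre him => ?_)
    simp only [lt_min_iff, abs_lt, Edge.len] at hre him h1
    refine ⟨fun h => ?_, fun h => up _ ?_ ?_ ?_ ?_, fun h => ?_, fun h => lo _ ?_ ?_ ?_ ?_⟩
    · have := polygon_subset h
      simp [Edge.start₁, Edge.dir] at this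
      rcases this with h | h <;> linarith
    rotate_left 4
    · have := polygon_subset h
      simp [Edge.start₂, Edge.dir] at this
      rcases this with h | h <;> linarith
    all_goals simp [Edge.start₁, Edge.start₂, Edge.dir]; linarith
  · refine main (fun z => z.im) (fun z => Or.inl ⟨rfl, rfl⟩) (fun z hre him => ?_)
    simp only [lt_min_iff, abs_lt, Edge.len] at hre him h1
    refine ⟨fun h => ?_, fun h => lo _ ?_ ?_ ?_ ?_, fun h => ?_, fun h => up _ ?_ ?_ ?_ ?_⟩
    · have := polygon_subset h
      simp [Edge.start₁, Edge.dir] at this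
      rcases this with h | h <;> linarith
    rotate_left 4
    · have := polygon_subset h
      simp [Edge.start₂, Edge.dir] at this
      rcases this with h | h <;> linarith
    all_goals simp [Edge.start₁, Edge.start₂, Edge.dir]; linarith
  · refine main (fun z => z.re) (fun z => Or.inr ⟨rfl, rfl⟩) (fun z hre him => ?_)
    simp only [lt_min_iff, abs_lt, Edge.len] at hre him h1
    by_cases hp : Even n
    · refine ⟨fun h => ?_, fun h => lo _ ?_ ?_ ?_ ?_, fun h => ?_, fun h => up _ ?_ ?_ ?_ ?_⟩
      · have := polygon_subset h
        simp [Edge.start₁, Edge.dir, hp] at this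
        rcases this with h | h <;> linarith
      rotate_left 4
      · have := polygon_subset h
        simp [Edge.start₂, Edge.dir, hp] at this
        rcases this with h | h <;> linarith
      all_goals simp [Edge.start₁, Edge.start₂, Edge.dir, hp]; linarith
    · have hp' := dyadic_odd hp
      refine ⟨fun h => ?_, fun h => up _ ?_ ?_ ?_ ?_, fun h => ?_, fun h => up _ ?_ ?_ ?_ ?_⟩
      · have := polygon_subset h
        simp [Edge.start₁, Edge.dir, hp] at this
        rcases this with h | h <;> linarith
      rotate_left 4
      · have := polygon_subset h
        simp [Edge.start₂, Edge.dir, hp] at this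
        rcases this with h | h <;> linarith
      all_goals simp [Edge.start₁, Edge.start₂, Edge.dir, hp]; linarith
  · refine main (fun z => z.re) (fun z => Or.inr ⟨rfl, rfl⟩) (fun z hre him => ?_)
    simp only [lt_min_iff, abs_lt, Edge.len] at hre him h1
    by_cases hp : Even n
    · refine ⟨fun h => ?_, fun h => up _ ?_ ?_ ?_ ?_, fun h => ?_, fun h => lo _ ?_ ?_ ?_ ?_⟩
      · have := polygon_subset h
        simp [Edge.start₁, Edge.dir, hp] at this
        rcases this with h | h <;> linarith
      rotate_left 4
      · have := polygon_subset h
        simp [Edge.start₂, Edge.dir, hp] at this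
        rcases this with h | h <;> linarith
      all_goals simp [Edge.start₁, Edge.start₂, Edge.dir, hp]; linarith
    · have hp' := dyadic_odd hp
      refine ⟨fun h => ?_, fun h => lo _ ?_ ?_ ?_ ?_, fun h => ?_, fun h => lo _ ?_ ?_ ?_ ?_⟩
      · have := polygon_subset h
        simp [Edge.start₁, Edge.dir, hp] at this
        rcases this with h | h <;> linarith
      rotate_left 4
      · have := polygon_subset h
        simp [Edge.start₂, Edge.dir, hp] at this
        rcases this with h | h <;> linarith
      all_goals simp [Edge.start₁, Edge.start₂, Edge.dir, hp]; linarith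

/-- By `glued_unique` every boundary point has exactly one partner, so gluings never form chains and
the right-hand side is already invariant under the generating relation. -/
lemma proj_eq_iff {p q : polygon} :
    proj p = proj q ↔ p = q ∨ Glued p q ∨ Glued q p := by
  constructor
  · intro h
    have key : ∀ a b : polygon, Glued a b →
        (p = a ∨ Glued p a ∨ Glued a p) = (p = b ∨ Glued p b ∨ Glued b p) := by
      intro a b hab
      apply propext
      constructor
      · rintro (rfl | h | h)
        · exact Or.inr (Or.inl hab)
        · exact absurd rfl (glued_unique h hab).2
        · exact Or.inl (Subtype.ext ((glued_unique h hab).1.1 rfl))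
      · rintro (rfl | h | h)
        · exact Or.inr (Or.inr hab)
        · exact Or.inl (Subtype.ext ((glued_unique h hab).1.2 rfl))
        · exact absurd rfl (glued_unique hab h).2
    have h2 := congrArg (Quot.lift (fun q : polygon => p = q ∨ Glued p q ∨ Glued q p) key) h
    have h3 : (p = p ∨ Glued p p ∨ Glued p p) = (p = q ∨ Glued p q ∨ Glued q p) := h2
    rw [← h3]
    exact Or.inl rfl
  · rintro (rfl | h | h)
    · rfl
    · exact proj_eq h
    · exact (proj_eq h).symm

/-- The points of the polygon that represent a point of the surface. -/
def fibre (x : Surface) : Set ℂ := {z | ∃ h : z ∈ polygon, proj ⟨z, h⟩ = x}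

lemma finite_fibre (x : Surface) : (fibre x).Finite := by
  obtain ⟨p, rfl⟩ := isQuotientMap_proj.surjective x
  have : fibre (proj p) ⊆ {(p : ℂ)} ∪ ({z | Glued z p} ∪ {z | Glued p z}) := by
    rintro z ⟨hz, h⟩
    rcases proj_eq_iff.1 h with h | h | h
    · exact Or.inl (by simp [← h])
    · exact Or.inr (Or.inl h)
    · exact Or.inr (Or.inr h)
  refine Set.Finite.subset ?_ this
  refine (finite_singleton _).union (Set.Finite.union ?_ ?_)
  · exact Set.Subsingleton.finite fun a ha b hb => (glued_unique ha hb).1.2 rfl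
  · exact Set.Subsingleton.finite fun a ha b hb => (glued_unique ha hb).1.1 rfl

/-! ### Saturated neighbourhoods and the Hausdorff property -/

lemma image_mem_nhds_of_saturated {S : Set polygon} (hS : IsOpen S)
    (hsat : ∀ p q : polygon, Glued p q → (p ∈ S ↔ q ∈ S)) {q : polygon} (hq : q ∈ S) :
    ∃ V ∈ 𝓝 (proj q), ∀ p, proj p ∈ V → p ∈ S := by
  refine ⟨{x | Quot.lift (fun p => p ∈ S) (fun p q h => propext (hsat p q h)) x}, ?_,
    fun p hp => hp⟩
  refine IsOpen.mem_nhds ?_ hq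
  exact isQuotientMap_proj.isOpen_preimage.1 hS

/-- At a glued pair the union of two small discs about the representatives is saturated, since by
`glued_nhds` the boundary points near one are the translates of those near the other. At an interior
point a small disc meets no edge. -/
lemma nhds_proj (q : polygon) {δ : ℝ} (hδ : 0 < δ) :
    ∃ V ∈ 𝓝 (proj q), ∀ p, proj p ∈ V → ∃ w ∈ fibre (proj q), dist (p : ℂ) w < δ := by
  have aux : ∀ a b : polygon, Glued a b → proj a = proj q → ∃ V ∈ 𝓝 (proj q),
      ∀ p, proj p ∈ V → ∃ w ∈ fibre (proj q), dist (p : ℂ) w < δ := by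
    intro a b hab haq
    obtain ⟨l, δ', hδ', H⟩ := glued_nhds hab
    have hbq : proj b = proj q := by rw [← haq, proj_eq hab]
    have H' : ∀ c : ℂ, dist c a < min δ δ' → |(c - a).re| < δ' ∧ |(c - a).im| < δ' := by
      intro c hc
      rw [lt_min_iff, dist_eq] at hc
      exact ⟨(abs_re_le_norm _).trans_lt hc.2, (abs_im_le_norm _).trans_lt hc.2⟩
    have H'' : ∀ c : ℂ, dist c b < min δ δ' → |(c - b).re| < δ' ∧ |(c - b).im| < δ' := by
      intro c hc
      rw [lt_min_iff, dist_eq] at hc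
      exact ⟨(abs_re_le_norm _).trans_lt hc.2, (abs_im_le_norm _).trans_lt hc.2⟩
    let S : Set polygon := {p | dist (p : ℂ) a < min δ δ'} ∪ {p | dist (p : ℂ) b < min δ δ'}
    have hpos : 0 < min δ δ' := lt_min hδ hδ'
    have hopen : IsOpen S := by
      apply IsOpen.union
      · exact isOpen_lt (by fun_prop) continuous_const
      · exact isOpen_lt (by fun_prop) continuous_const
    -- The polygon lies on one side of the edge near a, so a boundary point there is on the edge
    -- itself and is glued to its translate near b; `glued_unique` then excludes any other partner.
    have hA : ∀ c : polygon, (c : ℂ) ∉ polygonInterior → dist (c : ℂ) a < min δ δ' →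
        Glued c (b + (c - a)) := by
      intro c hc hca
      obtain ⟨h1, h2, -, -, h3⟩ := H (c - a) (H' c hca).1 (H' c hca).2
      rw [add_sub_cancel] at h1 h2 h3
      exact h3 (le_antisymm (h1 c.2) (not_lt.1 fun h => hc (h2 h)))
    have hB : ∀ c : polygon, (c : ℂ) ∉ polygonInterior → dist (c : ℂ) b < min δ δ' →
        Glued (a + (c - b)) c := by
      intro c hc hca
      obtain ⟨-, -, h1, h2, h3⟩ := H (c - b) (H'' c hca).1 (H'' c hca).2
      rw [add_sub_cancel] at h1 h2 h3
      exact h3 (le_antisymm (not_lt.1 fun h => hc (h2 h)) (h1 c.2))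
    have hsat : ∀ p q : polygon, Glued p q → (p ∈ S ↔ q ∈ S) := by
      intro c d hcd
      obtain ⟨hci, hdi⟩ := glued_not_interior hcd
      constructor
      · rintro (h | h)
        · have := (glued_unique hcd (hA c hci h)).1.1 rfl
          refine Or.inr ?_
          rw [mem_ofPred_eq, this]
          simpa [dist_eq] using h
        · exact absurd rfl (glued_unique (hB c hci h) hcd).2
      · rintro (h | h)
        · exact absurd rfl (glued_unique hcd (hA d hdi h)).2
        · have := (glued_unique hcd (hB d hdi h)).1.2 rfl
          refine Or.inl ?_
          rw [mem_ofPred_eq, this]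
          simpa [dist_eq] using h
    have haS : a ∈ S := Or.inl (by simpa using hpos)
    obtain ⟨V, hV, hV'⟩ := image_mem_nhds_of_saturated hopen hsat haS
    rw [haq] at hV
    refine ⟨V, hV, fun p hp => ?_⟩
    rcases hV' p hp with h | h
    · exact ⟨a, ⟨a.2, haq⟩, h.trans_le (min_le_left _ _)⟩
    · exact ⟨b, ⟨b.2, hbq⟩, h.trans_le (min_le_left _ _)⟩
  rcases id q.2 with hq | ⟨w, h | h⟩
  · obtain ⟨δ', hδ', hball⟩ := Metric.isOpen_iff.1 isOpen_polygonInterior q hq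
    let S : Set polygon := {p | dist (p : ℂ) q < min δ δ'}
    have hopen : IsOpen S := isOpen_lt (by fun_prop) continuous_const
    have hint : ∀ p ∈ S, (p : ℂ) ∈ polygonInterior := fun p hp =>
        hball (Metric.mem_ball.2 (lt_of_lt_of_le hp (min_le_right _ _)))
    have hsat : ∀ p q : polygon, Glued p q → (p ∈ S ↔ q ∈ S) := fun c d hcd =>
      ⟨fun h => absurd (hint c h) (glued_not_interior hcd).1,
        fun h => absurd (hint d h) (glued_not_interior hcd).2⟩
    have hqS : q ∈ S := by simpa [S] using ⟨hδ, hδ'⟩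
    obtain ⟨V, hV, hV'⟩ := image_mem_nhds_of_saturated hopen hsat hqS
    exact ⟨V, hV, fun p hp => ⟨q, ⟨q.2, rfl⟩, lt_of_lt_of_le (hV' p hp) (min_le_left _ _)⟩⟩
  · exact aux q ⟨w, h.right_mem⟩ h rfl
  · exact aux ⟨w, h.left_mem⟩ q h (proj_eq h)

/-- Disjoint finite fibres have disjoint thickenings, and `nhds_proj` confines small neighbourhoods
of a point to the thickening of its fibre. -/
instance : T2Space Surface := by
  rw [t2Space_iff]
  intro x y hxy
  have hdis : Disjoint (fibre x) (fibre y) := by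
    rw [Set.disjoint_left]
    rintro z ⟨h, hx⟩ ⟨h', hy⟩
    exact hxy (hx.symm.trans hy)
  obtain ⟨δ, hδ, hd⟩ := hdis.exists_thickenings (finite_fibre x).isCompact
    (finite_fibre y).isClosed
  have key : ∀ x, ∃ V ∈ 𝓝 x, ∀ p, proj p ∈ V → (p : ℂ) ∈ Metric.thickening δ (fibre x) := by
    intro x
    obtain ⟨p, rfl⟩ := isQuotientMap_proj.surjective x
    obtain ⟨V, hV, h⟩ := nhds_proj p hδ
    exact ⟨V, hV, fun q hq => Metric.mem_thickening_iff.2 (h q hq)⟩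
  obtain ⟨U, hU, hU'⟩ := key x
  obtain ⟨V, hV, hV'⟩ := key y
  obtain ⟨U₁, h1, h2, h3⟩ := mem_nhds_iff.1 hU
  obtain ⟨V₁, k1, k2, k3⟩ := mem_nhds_iff.1 hV
  refine ⟨U₁, V₁, h2, k2, h3, k3, ?_⟩
  rw [Set.disjoint_left]
  intro z hz hz'
  obtain ⟨p, rfl⟩ := isQuotientMap_proj.surjective z
  exact Set.disjoint_left.1 hd (hU' p (h1 hz)) (hV' p (k1 hz'))

open Classical in
/-- The projection, extended to the whole plane by a constant. -/
noncomputable def pt (z : ℂ) : Surface :=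
  if h : z ∈ polygon then proj ⟨z, h⟩ else
    proj ⟨⟨1 / 4, 3 / 4⟩, Or.inl (Or.inl (Or.inl (by simp [mem_reProdIm]; norm_num)))⟩

lemma pt_of_mem {z : ℂ} (h : z ∈ polygon) : pt z = proj ⟨z, h⟩ := dif_pos h

lemma pt_coe (p : polygon) : pt p = proj p := pt_of_mem p.2

lemma exists_pt (x : Surface) : ∃ z ∈ polygon, pt z = x := by
  obtain ⟨p, rfl⟩ := isQuotientMap_proj.surjective x
  exact ⟨p, p.2, pt_coe p⟩

lemma Glued.pt_eq {z w : ℂ} (h : Glued z w) : pt z = pt w := by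
  rw [pt_of_mem h.left_mem, pt_of_mem h.right_mem]
  exact proj_eq h

lemma continuousOn_pt : ContinuousOn pt polygon := by
  rw [continuousOn_iff_continuous_domRestrict]
  exact isQuotientMap_proj.continuous.congr fun p => (pt_coe p).symm

/-- If points of the polygon converge in the plane, and their images converge in the surface,
then the limit lies in the polygon. -/
lemma mem_polygon_of_tendsto {α : Type*} {F : Filter α} [F.NeBot] {f : α → ℂ} {z : ℂ}
    {x : Surface} (hf : ∀ᶠ a in F, f a ∈ polygon) (h1 : Tendsto f F (𝓝 z))
    (h2 : Tendsto (fun a => pt (f a)) F (𝓝 x)) : z ∈ polygon ∧ pt z = x := by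
  -- The fibre is finite, hence closed, so it is enough to find points of the fibre arbitrarily
  -- close to z; `nhds_proj` supplies them along the filter.
  have : z ∈ fibre x := by
    rw [← (finite_fibre x).isClosed.closure_eq, Metric.mem_closure_iff]
    intro δ hδ
    obtain ⟨q, rfl⟩ := isQuotientMap_proj.surjective x
    obtain ⟨V, hV, h⟩ := nhds_proj q (half_pos hδ)
    obtain ⟨a, ha, ha1, ha2⟩ := (hf.and ((h1.eventually (Metric.ball_mem_nhds z (half_pos hδ))).and
      (h2.eventually hV))).exists
    have ha2 : pt (f a) ∈ V := ha2
    rw [pt_of_mem ha] at ha2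
    obtain ⟨w, hw, hw'⟩ := h ⟨_, ha⟩ ha2
    refine ⟨w, hw, ?_⟩
    rw [dist_comm] at ha1
    have := dist_triangle z (f a) w
    simp only at hw'
    linarith
  obtain ⟨hz, h⟩ := this
  exact ⟨hz, by rw [pt_of_mem hz, h]⟩

/-! ### Connectedness -/

lemma isPreconnected_polygonInterior : IsPreconnected polygonInterior := by
  have hc : ∀ a b c d : ℝ, IsPreconnected (Ioo a b ×ℂ Ioo c d) := fun a b c d => by
    refine Convex.isPreconnected (Convex.inter ?_ ?_)
    · exact (convex_Ioo a b).linear_preimage reLm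
    · exact (convex_Ioo c d).linear_preimage imLm
  -- The upper and lower open rectangles are disjoint, so the union is reordered to attach both of
  -- them to the central rectangle.
  rw [polygonInterior, union_assoc, union_comm, union_assoc]
  refine IsPreconnected.union ⟨1 / 4, 1 / 4⟩ ?_ ?_ (hc _ _ _ _) ?_
  · simp [mem_reProdIm]; norm_num
  · left; simp [mem_reProdIm]; norm_num
  refine IsPreconnected.union ⟨1 / 4, 3 / 4⟩ ?_ ?_ (hc _ _ _ _) (hc _ _ _ _)
  · simp [mem_reProdIm]; norm_num
  · simp [mem_reProdIm]; norm_num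

lemma polygon_subset_closure : polygon ⊆ closure polygonInterior := by
  intro z hz
  have cl : ∀ a b c d : ℝ, a < b → c < d →
      closure (Ioo a b ×ℂ Ioo c d) = Icc a b ×ℂ Icc c d := by
    intro a b c d h1 h2
    rw [closure_reProdIm, closure_Ioo h1.ne, closure_Ioo h2.ne]
  rcases polygon_subset hz with h | h
  · refine closure_mono (subset_union_left.trans subset_union_left) ?_
    rw [cl _ _ _ _ (by norm_num) (by norm_num)]
    exact ⟨⟨h.1, h.2.1⟩, h.2.2⟩
  · refine closure_mono (subset_union_right.trans subset_union_left) ?_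
    rw [cl _ _ _ _ (by norm_num) (by norm_num)]
    exact ⟨⟨h.1, h.2.1⟩, h.2.2⟩

/-- The polygon lies between its connected interior and the closure of that interior, and the
surface is its image. -/
instance : PreconnectedSpace Surface := by
  have h : IsPreconnected polygon :=
    isPreconnected_polygonInterior.subset_closure (fun z hz => Or.inl hz) polygon_subset_closure
  have : PreconnectedSpace polygon := Subtype.preconnectedSpace h
  constructor
  rw [← isQuotientMap_proj.surjective.range_eq]
  exact isPreconnected_range isQuotientMap_proj.continuous

/-! ### Locally affine maps into the surface -/

section LocAffine

variable {E : Type*} [NormedAddCommGroup E] [NormedSpace ℝ E]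

/-- In canonical charts, `f` has the constant derivative `L` on `K`. -/
def LocAffine (f : E → Surface) (L : E →L[ℝ] ℂ) (K : Set E) : Prop :=
  ∀ z ∈ K, ∀ e ∈ canonicalCharts, f z ∈ e.source →
    ∃ c, ∀ᶠ z' in 𝓝 z, f z' ∈ e.source ∧ e (f z') = L z' + c

lemma LocAffine.mono {f : E → Surface} {L : E →L[ℝ] ℂ} {K K' : Set E} (h : LocAffine f L K)
    (hK : K' ⊆ K) : LocAffine f L K' := fun z hz => h z (hK hz)

/-- `LocAffine` keeps f inside the domain of the chart near the point, so there f is the inverse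
chart applied to an affine map. -/
lemma LocAffine.continuousAt {f : E → Surface} {L : E →L[ℝ] ℂ} {K : Set E}
    (h : LocAffine f L K) {z : E} (hz : z ∈ K) : ContinuousAt f z := by
  obtain ⟨e, he, hx⟩ := exists_canonicalChart (f z)
  obtain ⟨c, hc⟩ := h z hz e he hx
  have h1 : ContinuousAt (fun z' => e.symm (L z' + c)) z := by
    have h3 : ContinuousAt e.symm (L z + c) := by
      rw [← hc.self_of_nhds.2]
      exact e.symm.continuousAt (e.map_source hx)
    exact ContinuousAt.comp (f := fun z' => L z' + c) (g := e.symm) h3 (by fun_prop)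
  refine h1.congr ?_
  filter_upwards [hc] with z' hz'
  rw [← hz'.2, e.left_inv hz'.1]

lemma LocAffine.comp {E' : Type*} [NormedAddCommGroup E'] [NormedSpace ℝ E'] {f : E → Surface}
    {L : E →L[ℝ] ℂ} {K : Set E} (h : LocAffine f L K) (A : E' →L[ℝ] E) (b : E) :
    LocAffine (fun z => f (A z + b)) (L.comp A) {z | A z + b ∈ K} := by
  intro z hz e he hx
  obtain ⟨c, hc⟩ := h _ hz e he hx
  refine ⟨L b + c, ?_⟩
  have : ContinuousAt (fun z => A z + b) z := by fun_prop
  filter_upwards [this.eventually hc] with z' hz'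
  refine ⟨hz'.1, ?_⟩
  rw [hz'.2]
  simp [add_assoc]

/-- The continuous linear map of the plane with a given matrix. -/
noncomputable def planeCLM (M : Matrix (Fin 2) (Fin 2) ℝ) : ℂ →L[ℝ] ℂ :=
  LinearMap.toContinuousLinearMap (planeMap M)

lemma planeMap_apply (M : Matrix (Fin 2) (Fin 2) ℝ) (z : ℂ) :
    planeMap M z = ⟨M 0 0 * z.re + M 0 1 * z.im, M 1 0 * z.re + M 1 1 * z.im⟩ := by
  rw [planeMap, Matrix.toLin_apply]
  apply Complex.ext <;> simp [Matrix.mulVec, dotProduct, Fin.sum_univ_two]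

lemma planeCLM_apply (M : Matrix (Fin 2) (Fin 2) ℝ) (z : ℂ) :
    planeCLM M z = ⟨M 0 0 * z.re + M 0 1 * z.im, M 1 0 * z.re + M 1 1 * z.im⟩ :=
  planeMap_apply M z

lemma LocAffine.map {f : E → Surface} {L : E →L[ℝ] ℂ} {K : Set E} (h : LocAffine f L K)
    {φ : Surface ≃ₜ Surface} {M : Matrix (Fin 2) (Fin 2) ℝ} (hφ : HasDerivative φ M) :
    LocAffine (fun z => φ (f z)) ((planeCLM M).comp L) K := by
  intro z hz e' he' hx'
  obtain ⟨e, he, hx⟩ := exists_canonicalChart (f z)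
  obtain ⟨c, hc⟩ := h z hz e he hx
  obtain ⟨d, hd⟩ := hφ e he e' he' _ hx hx'
  refine ⟨planeMap M c + d, ?_⟩
  have hcont := h.continuousAt hz
  have hcont' : ContinuousAt (fun z => φ (f z)) z := φ.continuous.continuousAt.comp hcont
  filter_upwards [hc, hcont.eventually hd,
    hcont'.eventually (e'.open_source.mem_nhds hx')] with y h1 h2 h3
  refine ⟨h3, ?_⟩
  rw [h2, h1.2, map_add, add_assoc]
  rfl

lemma locAffine_pt : LocAffine pt (ContinuousLinearMap.id ℝ ℂ) polygonInterior := by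
  intro z hz e he hx
  have hz' : z ∈ polygon := Or.inl hz
  rw [pt_of_mem hz'] at hx
  obtain ⟨c, hc⟩ := he _ hx
  refine ⟨c, ?_⟩
  rw [nhds_subtype_eq_comap] at hc
  have hc := (eventually_comap.1 hc)
  have h1 : ∀ᶠ w : ℂ in 𝓝 z, pt w ∈ e.source := by
    have : ContinuousAt pt z :=
      (continuousOn_pt.mono subset_union_left).continuousAt (isOpen_polygonInterior.mem_nhds hz)
    refine this.eventually (e.open_source.mem_nhds ?_)
    rwa [pt_of_mem hz']
  filter_upwards [hc, h1, isOpen_polygonInterior.mem_nhds hz] with w h2 h3 h4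
  refine ⟨h3, ?_⟩
  rw [pt_of_mem (Or.inl h4)]
  exact h2 ⟨w, Or.inl h4⟩ rfl

/-- Two locally affine maps with the same derivative that agree at a point agree near it. -/
lemma LocAffine.eventuallyEq {f g : E → Surface} {L : E →L[ℝ] ℂ} {K : Set E}
    (hf : LocAffine f L K) (hg : LocAffine g L K) {z : E} (hz : z ∈ K) (h : f z = g z) :
    ∀ᶠ w in 𝓝 z, f w = g w := by
  obtain ⟨e, he, hx⟩ := exists_canonicalChart (f z)
  obtain ⟨c, hc⟩ := hf z hz e he hx
  obtain ⟨d, hd⟩ := hg z hz e he (h ▸ hx)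
  have hcd : c = d := by
    have h1 := hc.self_of_nhds.2
    have h2 := hd.self_of_nhds.2
    rw [h, h2] at h1
    exact (add_left_cancel h1).symm
  filter_upwards [hc, hd] with w h1 h2
  exact e.injOn h1.1 h2.1 (by rw [h1.2, h2.2, hcd])

/-- Unique continuation: the set of agreement is open by `LocAffine.eventuallyEq`, and its
complement is open because the surface is Hausdorff. -/
lemma LocAffine.eqOn {f g : E → Surface} {L : E →L[ℝ] ℂ} {K : Set E}
    (hf : LocAffine f L K) (hg : LocAffine g L K) (hK : IsOpen K) (hK' : IsPreconnected K)
    {z : E} (hz : z ∈ K) (h : f z = g z) : EqOn f g K := by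
  have hA : IsOpen {w | w ∈ K ∧ f w = g w} := by
    rw [isOpen_iff_mem_nhds]
    rintro w ⟨hw, hw'⟩
    filter_upwards [hK.mem_nhds hw, hf.eventuallyEq hg hw hw'] with y h1 h2
    exact ⟨h1, h2⟩
  have hB : IsOpen {w | w ∈ K ∧ f w ≠ g w} := by
    rw [isOpen_iff_mem_nhds]
    rintro w ⟨hw, hw'⟩
    have := (hf.continuousAt hw).prodMk_nhds (hg.continuousAt hw)
    have h2 := this.eventually ((isClosed_diagonal.isOpen_compl).mem_nhds
      (show (f w, g w) ∈ (diagonal Surface)ᶜ from hw'))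
    filter_upwards [hK.mem_nhds hw, h2] with y h1 h2
    exact ⟨h1, h2⟩
  have := hK'.subset_left_of_subset_union hA hB
    (by rw [Set.disjoint_left]; rintro w ⟨-, h1⟩ ⟨-, h2⟩; exact h2 h1)
    (fun w hw => (em (f w = g w)).imp (fun h => ⟨hw, h⟩) (fun h => ⟨hw, h⟩)) ⟨z, hz, hz, h⟩
  exact fun w hw => (this hw).2

end LocAffine

/-! ### Global derivatives -/

lemma planeMap_injective {M N : Matrix (Fin 2) (Fin 2) ℝ} (h : planeMap M = planeMap N) :
    M = N := (Matrix.toLin basisOneI basisOneI).injective h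

/-- A local affine expression of a map determines the linear part. -/
lemma linear_unique {A B : ℂ →L[ℝ] ℂ} {c d z : ℂ}
    (h : ∀ᶠ w in 𝓝 z, A w + c = B w + d) : A = B := by
  have h1 : HasFDerivAt (fun w => A w + c) A z := A.hasFDerivAt.add_const c
  have h2 : HasFDerivAt (fun w => B w + d) B z := B.hasFDerivAt.add_const d
  exact h1.unique (h2.congr_of_eventuallyEq h)

lemma eventually_chart {e : OpenPartialHomeomorph Surface ℂ} {x : Surface} (hx : x ∈ e.source)
    {P : ℂ → Prop} (h : ∀ᶠ y in 𝓝 x, P (e y)) : ∀ᶠ w in 𝓝 (e x), P w := by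
  have := (e.symm.continuousAt (e.map_source hx)).eventually
    (show ∀ᶠ y in 𝓝 (e.symm (e x)), P (e y) by rwa [e.left_inv hx])
  filter_upwards [this, e.open_target.mem_nhds (e.map_source hx)] with w h1 h2
  rwa [e.right_inv h2] at h1

lemma planeCLM_injective {M N : Matrix (Fin 2) (Fin 2) ℝ} (h : planeCLM M = planeCLM N) :
    M = N := planeMap_injective (LinearMap.toContinuousLinearMap.injective h)

lemma HasDerivative.unique {φ : Surface ≃ₜ Surface} {M N : Matrix (Fin 2) (Fin 2) ℝ}
    (hM : HasDerivative φ M) (hN : HasDerivative φ N) : M = N := by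
  -- Any point will do; `pt 0` only shows that the surface is non-empty.
  obtain ⟨x⟩ : Nonempty Surface := ⟨pt 0⟩
  obtain ⟨e, he, hx⟩ := exists_canonicalChart x
  obtain ⟨e', he', hx'⟩ := exists_canonicalChart (φ x)
  obtain ⟨c, hc⟩ := hM e he e' he' x hx hx'
  obtain ⟨d, hd⟩ := hN e he e' he' x hx hx'
  have h1 : ∀ᶠ y in 𝓝 x, planeCLM M (e y) + c = planeCLM N (e y) + d := by
    filter_upwards [hc, hd] with y h1 h2
    exact h1.symm.trans h2
  exact planeCLM_injective (linear_unique (eventually_chart hx h1))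

/-- `φ` has the derivative `M` near the point `x`. -/
def HasDerivativeAt (φ : Surface ≃ₜ Surface) (M : Matrix (Fin 2) (Fin 2) ℝ) (x : Surface) : Prop :=
  ∀ e ∈ canonicalCharts, ∀ e' ∈ canonicalCharts, x ∈ e.source → φ x ∈ e'.source →
    ∃ c : ℂ, ∀ᶠ y in 𝓝 x, e' (φ y) = planeMap M (e y) + c

/-- It suffices to check the derivative in one pair of charts. -/
lemma hasDerivativeAt_of_charts {φ : Surface ≃ₜ Surface} {M : Matrix (Fin 2) (Fin 2) ℝ}
    {x : Surface} {e e' : OpenPartialHomeomorph Surface ℂ} (he : e ∈ canonicalCharts)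
    (he' : e' ∈ canonicalCharts) (hx : x ∈ e.source) (hx' : φ x ∈ e'.source) {c : ℂ}
    (hc : ∀ᶠ y in 𝓝 x, e' (φ y) = planeMap M (e y) + c) : HasDerivativeAt φ M x := by
  intro e₁ he₁ e₁' he₁' hx₁ hx₁'
  obtain ⟨d, hd⟩ := TranslationAtlas.eq_add_const e₁ he₁ e he x hx₁ hx
  obtain ⟨d', hd'⟩ := TranslationAtlas.eq_add_const e' he' e₁' he₁' _ hx' hx₁'
  refine ⟨planeMap M d + c + d', ?_⟩
  filter_upwards [hc, hd, φ.continuous.continuousAt.eventually hd'] with y h1 h2 h3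
  rw [h3, h1, h2, map_add]
  ring

/-- The linear part read in charts is independent of the charts and locally constant; connectedness
of the surface makes it global. -/
lemma exists_hasDerivative {φ : Surface ≃ₜ Surface} (hφ : φ ∈ affineGroup Surface) :
    ∃ M, HasDerivative φ M := by
  have hloc : ∀ x, ∃ M, ∀ᶠ y in 𝓝 x, HasDerivativeAt φ M y := by
    intro x
    obtain ⟨e, he, hx⟩ := exists_canonicalChart x
    obtain ⟨e', he', hx'⟩ := exists_canonicalChart (φ x)
    obtain ⟨A, hA⟩ := hφ e he e' he' x hx hx'
    refine ⟨LinearMap.toMatrix basisOneI basisOneI A.linear.toLinearMap, ?_⟩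
    have h1 : ∀ z, planeMap (LinearMap.toMatrix basisOneI basisOneI A.linear.toLinearMap) z =
        A.linear z := by
      intro z
      rw [planeMap, Matrix.toLin_toMatrix]
      rfl
    filter_upwards [hA.eventually_nhds, e.open_source.mem_nhds hx,
      φ.continuous.continuousAt.eventually (e'.open_source.mem_nhds hx')] with y h2 h3 h4
    refine hasDerivativeAt_of_charts he he' h3 h4 (c := A 0) ?_
    filter_upwards [h2] with w hw
    rw [hw, h1]
    have := A.map_vadd 0 (e w)
    simpa using this
  have huniq : ∀ x M N, HasDerivativeAt φ M x → HasDerivativeAt φ N x → M = N := by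
    intro x M N hM hN
    obtain ⟨e, he, hx⟩ := exists_canonicalChart x
    obtain ⟨e', he', hx'⟩ := exists_canonicalChart (φ x)
    obtain ⟨c, hc⟩ := hM e he e' he' hx hx'
    obtain ⟨d, hd⟩ := hN e he e' he' hx hx'
    have h1 : ∀ᶠ y in 𝓝 x, planeCLM M (e y) + c = planeCLM N (e y) + d := by
      filter_upwards [hc, hd] with y h1 h2
      exact h1.symm.trans h2
    exact planeCLM_injective (linear_unique (eventually_chart hx h1))
  choose D hD using hloc
  have hDloc : IsLocallyConstant D := by
    rw [IsLocallyConstant.iff_eventually_eq]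
    intro x
    filter_upwards [hD x] with y hy
    exact huniq y _ _ (hD y).self_of_nhds hy
  have : ∀ x y, D x = D y := fun x y =>
    hDloc.apply_eq_of_isPreconnected isPreconnected_univ (mem_univ x) (mem_univ y)
  refine ⟨D (pt 0), fun e he e' he' x hx hx' => ?_⟩
  rw [this (pt 0) x]
  exact (hD x).self_of_nhds e he e' he' hx hx'

lemma HasDerivative.comp {φ χ : Surface ≃ₜ Surface} {M N : Matrix (Fin 2) (Fin 2) ℝ}
    (hφ : HasDerivative φ M) (hχ : HasDerivative χ N) : HasDerivative (φ * χ) (M * N) := by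
  intro e he e' he' x hx hx'
  obtain ⟨e₁, he₁, hx₁⟩ := exists_canonicalChart (χ x)
  obtain ⟨c, hc⟩ := hχ e he e₁ he₁ x hx hx₁
  obtain ⟨d, hd⟩ := hφ e₁ he₁ e' he' _ hx₁ hx'
  refine ⟨planeMap M c + d, ?_⟩
  filter_upwards [hc, χ.continuous.continuousAt.eventually hd] with y h1 h2
  have : planeMap (M * N) (e y) = planeMap M (planeMap N (e y)) := by
    rw [planeMap, Matrix.toLin_mul basisOneI basisOneI basisOneI]
    rfl
  rw [Homeomorph.mul_apply, h2, h1, map_add, this, add_assoc]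

lemma hasDerivative_one : HasDerivative (1 : Surface ≃ₜ Surface) 1 := by
  intro e he e' he' x hx hx'
  obtain ⟨c, hc⟩ := TranslationAtlas.eq_add_const e he e' he' x hx hx'
  refine ⟨c, ?_⟩
  filter_upwards [hc] with y hy
  simpa [planeMap] using hy

lemma HasDerivative.mem_affineGroup {φ : Surface ≃ₜ Surface} {M : Matrix (Fin 2) (Fin 2) ℝ}
    (h : HasDerivative φ M) (hM : IsUnit M.det) : φ ∈ affineGroup Surface := by
  intro e he e' he' x hx hx'
  obtain ⟨c, hc⟩ := h e he e' he' x hx hx'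
  refine ⟨(Matrix.toLinearEquiv basisOneI M hM).toAffineEquiv.trans
    (AffineEquiv.constVAdd ℝ ℂ c), ?_⟩
  filter_upwards [hc] with y hy
  rw [hy]
  simp [planeMap, add_comm]

/-- The inverse is affine too, hence has a derivative of its own, and the two derivatives multiply
to 1. -/
lemma HasDerivative.isUnit_det {φ : Surface ≃ₜ Surface} {M : Matrix (Fin 2) (Fin 2) ℝ}
    (hφ : φ ∈ affineGroup Surface) (h : HasDerivative φ M) : IsUnit M.det := by
  obtain ⟨N, hN⟩ := exists_hasDerivative ((affineGroup Surface).inv_mem hφ)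
  have h1 := h.comp hN
  rw [mul_inv_cancel] at h1
  have h2 := h1.unique hasDerivative_one
  exact IsUnit.of_mul_eq_one N.det (by rw [← Matrix.det_mul, h2, Matrix.det_one])

/-! ### The two rectangles -/

/-- The open rectangle of width `1` and height `1 / 2` with lower left corner `k`. -/
def rect (k : ℂ) : Set ℂ :=
  {z | (k.re < z.re ∧ z.re < k.re + 1) ∧ k.im < z.im ∧ z.im < k.im + 1 / 2}

/-- `k` is the lower left corner of the upper or of the lower rectangle. -/
def IsCorner (k : ℂ) : Prop := (k.re = 0 ∧ k.im = 1 / 2) ∨ (k.re = -1 / 2 ∧ k.im = 0)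

lemma rect_subset {k : ℂ} (hk : IsCorner k) : rect k ⊆ polygonInterior := by
  rintro z ⟨⟨h1, h2⟩, h3, h4⟩
  rcases hk with ⟨a, b⟩ | ⟨a, b⟩
  · exact Or.inl (Or.inl ⟨⟨by linarith, by linarith⟩, by linarith, by linarith⟩)
  · exact Or.inl (Or.inr ⟨⟨by linarith, by linarith⟩, by linarith, by linarith⟩)

lemma rect_subset_polygon {k : ℂ} (hk : IsCorner k) : rect k ⊆ polygon :=
  (rect_subset hk).trans fun _ h => Or.inl h

lemma isOpen_rect (k : ℂ) : IsOpen (rect k) := by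
  exact ((isOpen_lt continuous_const continuous_re).inter
    (isOpen_lt continuous_re continuous_const)).inter
    ((isOpen_lt continuous_const continuous_im).inter (isOpen_lt continuous_im continuous_const))

lemma convex_rect (k : ℂ) : Convex ℝ (rect k) := by
  refine Convex.inter (Convex.inter ?_ ?_) (Convex.inter ?_ ?_)
  · exact (convex_Ioi k.re).linear_preimage reLm
  · exact (convex_Iio (k.re + 1)).linear_preimage reLm
  · exact (convex_Ioi k.im).linear_preimage imLm
  · exact (convex_Iio (k.im + 1 / 2)).linear_preimage imLm

/-- The ray from `p` in the direction `u` starts inside the rectangle at `k`. -/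
def Into (k p u : ℂ) : Prop :=
  ((k.re < p.re ∨ (k.re = p.re ∧ 0 < u.re)) ∧
    (p.re < k.re + 1 ∨ (p.re = k.re + 1 ∧ u.re < 0))) ∧
  (k.im < p.im ∨ (k.im = p.im ∧ 0 < u.im)) ∧
    (p.im < k.im + 1 / 2 ∨ (p.im = k.im + 1 / 2 ∧ u.im < 0))

/-! ### Germs of rays in a rectangle -/

lemma eventually_lt_add_mul {a b u : ℝ} :
    (∀ᶠ s in 𝓝[>] (0 : ℝ), a < b + s * u) ↔ a < b ∨ (a = b ∧ 0 < u) := by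
  constructor
  · intro h
    have h1 : Tendsto (fun s : ℝ => b + s * u) (𝓝[>] 0) (𝓝 b) := by
      have : Tendsto (fun s : ℝ => b + s * u) (𝓝 0) (𝓝 (b + 0 * u)) :=
        Continuous.tendsto (by fun_prop) _
      simp only [zero_mul, add_zero] at this
      exact this.mono_left nhdsWithin_le_nhds
    rcases (ge_of_tendsto h1 (h.mono fun _ => le_of_lt)).lt_or_eq with h2 | h2
    · exact Or.inl h2
    · refine Or.inr ⟨h2, ?_⟩
      obtain ⟨s, hs, hs'⟩ := (h.and self_mem_nhdsWithin).exists
      have hs' : 0 < s := hs'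
      have : 0 < s * u := by linarith
      exact (pos_iff_pos_of_mul_pos this).1 hs'
  · rintro (h | ⟨h, hu⟩)
    · have : Tendsto (fun s : ℝ => b + s * u) (𝓝 0) (𝓝 (b + 0 * u)) :=
        Continuous.tendsto (by fun_prop) _
      exact (this.mono_left nhdsWithin_le_nhds).eventually (lt_mem_nhds (by simpa using h))
    · filter_upwards [self_mem_nhdsWithin] with s hs
      have := mul_pos (show 0 < s from hs) hu
      linarith

lemma eventually_add_mul_lt {a b u : ℝ} :
    (∀ᶠ s in 𝓝[>] (0 : ℝ), b + s * u < a) ↔ b < a ∨ (b = a ∧ u < 0) := by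
  have := eventually_lt_add_mul (a := -a) (b := -b) (u := -u)
  rw [neg_lt_neg_iff, neg_inj, Left.neg_pos_iff] at this
  rw [eq_comm (a := b), ← this]
  refine eventually_congr (Eventually.of_forall fun s => ?_)
  constructor <;> intro h <;> linarith

/-- Each inequality defining `rect k` holds at small positive times exactly if it is strict at p, or
is an equality that the motion turns into a strict inequality. -/
lemma into_iff {k p u : ℂ} : Into k p u ↔ ∀ᶠ s : ℝ in 𝓝[>] 0, p + s * u ∈ rect k := by
  have h : ∀ s : ℝ, p + s * u ∈ rect k ↔ (k.re < p.re + s * u.re ∧ p.re + s * u.re < k.re + 1) ∧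
      k.im < p.im + s * u.im ∧ p.im + s * u.im < k.im + 1 / 2 := by
    intro s
    simp [rect]
  simp only [h, eventually_and, eventually_lt_add_mul, eventually_add_mul_lt]
  rfl

/-- `p` and `q` are the same point or are glued; `p` lies on the top or on the right side of the
rectangle at `k`, and `q` lies on the opposite side of the rectangle at `k'`. -/
def Opposite (k k' p q : ℂ) : Prop :=
  (p.im = k.im + 1 / 2 ∧ q.im = k'.im ∧ k.re < p.re ∧ p.re < k.re + 1 ∧ k'.re < q.re ∧
    q.re < k'.re + 1 ∧ -(1 / 2) ≤ (q.re - k'.re) - (p.re - k.re) ∧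
    (q.re - k'.re) - (p.re - k.re) ≤ 1 / 2) ∨
  (p.re = k.re + 1 ∧ q.re = k'.re ∧ k.im < p.im ∧ p.im < k.im + 1 / 2 ∧ k'.im < q.im ∧
    q.im < k'.im + 1 / 2)

/-! ### Crossings between the rectangles -/

set_option maxHeartbeats 1000000 in
lemma Glued.exists_opposite {p q : ℂ} (h : Glued p q) :
    ∃ k k', IsCorner k ∧ IsCorner k' ∧ Opposite k k' p q := by
  have hU : IsCorner ⟨0, 1 / 2⟩ := Or.inl ⟨rfl, rfl⟩
  have hL : IsCorner ⟨-1 / 2, 0⟩ := Or.inr ⟨rfl, rfl⟩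
  rcases glued_cases h with ⟨n, t, h⟩ | ⟨n, t, h⟩ | ⟨t, h⟩ | ⟨n, hn, t, h⟩ | ⟨n, hn, t, h⟩ |
      ⟨n, hn, t, h⟩ | ⟨n, hn, t, h⟩
  all_goals
    obtain ⟨a, b, c, d, e, f⟩ := h
    try have h0 := dyadic_pos n
    try have h1 := dyadic_odd hn
    try generalize ((1 : ℝ) / 2) ^ n = N at *
  · exact ⟨_, _, hU, hL, Or.inl (by refine ⟨?_, ?_, ?_, ?_, ?_, ?_, ?_, ?_⟩ <;> dsimp only <;>
      linarith)⟩
  · exact ⟨_, _, hU, hL, Or.inl (by refine ⟨?_, ?_, ?_, ?_, ?_, ?_, ?_, ?_⟩ <;> dsimp only <;>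
      linarith)⟩
  · exact ⟨_, _, hL, hU, Or.inl (by refine ⟨?_, ?_, ?_, ?_, ?_, ?_, ?_, ?_⟩ <;> dsimp only <;>
      linarith)⟩
  · exact ⟨_, _, hL, hU, Or.inr (by refine ⟨?_, ?_, ?_, ?_, ?_, ?_⟩ <;> dsimp only <;> linarith)⟩
  · exact ⟨_, _, hU, hU, Or.inr (by refine ⟨?_, ?_, ?_, ?_, ?_, ?_⟩ <;> dsimp only <;> linarith)⟩
  · exact ⟨_, _, hU, hL, Or.inr (by refine ⟨?_, ?_, ?_, ?_, ?_, ?_⟩ <;> dsimp only <;> linarith)⟩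
  · exact ⟨_, _, hL, hL, Or.inr (by refine ⟨?_, ?_, ?_, ?_, ?_, ?_⟩ <;> dsimp only <;> linarith)⟩

/-- Besides the glued edges there is the open segment common to the two closed rectangles. It is
treated as a crossing in which the point is its own partner. -/
lemma exists_opposite {z : ℂ} (hz : z ∈ polygon) (hz' : ∀ k, IsCorner k → z ∉ rect k) :
    ∃ k k' p q, IsCorner k ∧ IsCorner k' ∧ Opposite k k' p q ∧ p ∈ polygon ∧ q ∈ polygon ∧
      pt p = pt z ∧ pt q = pt z ∧ (z = p ∨ z = q) := by
  have hU : IsCorner ⟨0, 1 / 2⟩ := Or.inl ⟨rfl, rfl⟩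
  have hL : IsCorner ⟨-1 / 2, 0⟩ := Or.inr ⟨rfl, rfl⟩
  rcases id hz with ((h | h) | h) | ⟨w, h | h⟩
  · refine absurd ?_ (hz' _ hU)
    obtain ⟨⟨a, b⟩, c, d⟩ := h
    refine ⟨⟨?_, ?_⟩, ?_, ?_⟩ <;> dsimp only <;> linarith
  · refine absurd ?_ (hz' _ hL)
    obtain ⟨⟨a, b⟩, c, d⟩ := h
    refine ⟨⟨?_, ?_⟩, ?_, ?_⟩ <;> dsimp only <;> linarith
  · obtain ⟨⟨a, b⟩, c, d⟩ := h
    rcases lt_trichotomy z.im (1 / 2) with h | h | h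
    · refine absurd ?_ (hz' _ hL)
      refine ⟨⟨?_, ?_⟩, ?_, ?_⟩ <;> dsimp only <;> linarith
    · refine ⟨_, _, z, z, hL, hU, Or.inl ?_, hz, hz, rfl, rfl, Or.inl rfl⟩
      refine ⟨?_, ?_, ?_, ?_, ?_, ?_, ?_, ?_⟩ <;> dsimp only <;> linarith
    · refine absurd ?_ (hz' _ hU)
      refine ⟨⟨?_, ?_⟩, ?_, ?_⟩ <;> dsimp only <;> linarith
  · obtain ⟨k, k', hk, hk', hop⟩ := h.exists_opposite
    exact ⟨k, k', z, w, hk, hk', hop, h.left_mem, h.right_mem, rfl, h.pt_eq.symm, Or.inl rfl⟩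
  · obtain ⟨k, k', hk, hk', hop⟩ := h.exists_opposite
    exact ⟨k, k', w, z, hk, hk', hop, h.left_mem, h.right_mem, h.pt_eq, rfl, Or.inr rfl⟩

/-- A ray with no zero component is transverse to the side, so it enters the rectangle on one side
or the other. -/
lemma Opposite.into {k k' p q u : ℂ} (h : Opposite k k' p q) (h1 : u.re ≠ 0) (h2 : u.im ≠ 0) :
    Into k p u ∨ Into k' q u := by
  rcases h with ⟨a1, a2, a3, a4, a5, a6, -, -⟩ | ⟨a1, a2, a3, a4, a5, a6⟩
  · rcases h2.lt_or_gt with h | h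
    · exact Or.inl ⟨⟨Or.inl a3, Or.inl a4⟩, Or.inl (by linarith), Or.inr ⟨a1, h⟩⟩
    · exact Or.inr ⟨⟨Or.inl a5, Or.inl a6⟩, Or.inr ⟨a2.symm, h⟩, Or.inl (by linarith)⟩
  · rcases h1.lt_or_gt with h | h
    · exact Or.inl ⟨⟨Or.inl (by linarith), Or.inr ⟨a1, h⟩⟩, Or.inl a3, Or.inl a4⟩
    · exact Or.inr ⟨⟨Or.inr ⟨a2.symm, h⟩, Or.inl (by linarith)⟩, Or.inl a5, Or.inl a6⟩

/-- Every generic ray on the surface starts inside one of the two rectangles. -/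
lemma exists_into {z u : ℂ} (hz : z ∈ polygon) (h1 : u.re ≠ 0) (h2 : u.im ≠ 0) :
    ∃ k q, IsCorner k ∧ q ∈ polygon ∧ pt q = pt z ∧ Into k q u := by
  by_cases h : ∀ k, IsCorner k → z ∉ rect k
  · obtain ⟨k, k', p, q, hk, hk', hop, hp, hq, hpz, hqz, -⟩ := exists_opposite hz h
    rcases hop.into h1 h2 with h | h
    · exact ⟨k, p, hk, hp, hpz, h⟩
    · exact ⟨k', q, hk', hq, hqz, h⟩
  · push Not at h
    obtain ⟨k, hk, h⟩ := h
    exact ⟨k, z, hk, hz, rfl, ⟨⟨Or.inl h.1.1, Or.inl h.1.2⟩, Or.inl h.2.1, Or.inl h.2.2⟩⟩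

/-- A function that drops whenever a trajectory moves from one rectangle to another. -/
noncomputable def potential (s₁ s₂ : ℝ) (k p : ℂ) : ℝ :=
  4 * s₁ * (p.re - k.re) + 6 * s₂ * (p.im - k.im)

/-- Signs of the coordinates of a vector. -/
def IsSign (s x : ℝ) : Prop := (s = 1 ∧ 0 < x) ∨ (s = -1 ∧ x < 0)

lemma exists_isSign {x : ℝ} (h : x ≠ 0) : ∃ s, IsSign s x :=
  h.lt_or_gt.elim (fun h => ⟨-1, Or.inr ⟨rfl, h⟩⟩) (fun h => ⟨1, Or.inl ⟨rfl, h⟩⟩)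

set_option maxHeartbeats 4000000 in
-- The weights 4 and 6 are chosen for this drop. Crossing a horizontal side resets the vertical
-- term, a loss of 6 · 1/2 = 3, while the horizontal offset changes by at most 1/2, a gain of at
-- most 2. Crossing a vertical side loses 4, while the vertical offset varies within the height 1/2,
-- a gain of at most 3.
lemma exists_crossing {k z u : ℂ} {s₁ s₂ : ℝ} (h1 : IsSign s₁ u.re) (h2 : IsSign s₂ u.im)
    (hz : z ∈ polygon) (hk : IsCorner k) (hzk : z ∉ rect k) (hin : Into k z (-u)) :
    ∃ k' q, IsCorner k' ∧ q ∈ polygon ∧ pt q = pt z ∧ Into k' q u ∧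
      potential s₁ s₂ k' q ≤ potential s₁ s₂ k z - 1 := by
  obtain ⟨⟨a', b'⟩, c', d'⟩ := hin
  simp only [neg_re, neg_im] at a' b' c' d'
  have A1 : 0 < u.re → k.re < z.re := fun h => a'.resolve_right fun h' => by linarith
  have A2 : u.re < 0 → z.re < k.re + 1 := fun h => b'.resolve_right fun h' => by linarith
  have A3 : k.re ≤ z.re := a'.elim le_of_lt fun h => h.1.le
  have A4 : z.re ≤ k.re + 1 := b'.elim le_of_lt fun h => h.1.le
  have B1 : 0 < u.im → k.im < z.im := fun h => c'.resolve_right fun h' => by linarith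
  have B2 : u.im < 0 → z.im < k.im + 1 / 2 := fun h => d'.resolve_right fun h' => by linarith
  have B3 : k.im ≤ z.im := c'.elim le_of_lt fun h => h.1.le
  have B4 : z.im ≤ k.im + 1 / 2 := d'.elim le_of_lt fun h => h.1.le
  clear a' b' c' d'
  -- z is in the closed rectangle at k, which does not meet the other open rectangle.
  have hz' : ∀ k, IsCorner k → z ∉ rect k := by
    intro k' hk' h
    apply hzk
    obtain ⟨⟨a, b⟩, c, d⟩ := h
    rcases hk with ⟨e, f⟩ | ⟨e, f⟩ <;> rcases hk' with ⟨e', f'⟩ | ⟨e', f'⟩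
    · exact ⟨⟨by linarith, by linarith⟩, by linarith, by linarith⟩
    · exfalso
      linarith
    · exfalso
      linarith
    · exact ⟨⟨by linarith, by linarith⟩, by linarith, by linarith⟩
  obtain ⟨k₁, k₂, p, q, hk₁, hk₂, hop, hp, hq, hpz, hqz, hor⟩ := exists_opposite hz hz'
  clear hz' hzk hz
  have hinto := hop.into (u := u) (by rcases h1 with h | h <;> [exact h.2.ne'; exact h.2.ne])
    (by rcases h2 with h | h <;> [exact h.2.ne'; exact h.2.ne])
  suffices h : (Into k₁ p u → potential s₁ s₂ k₁ p ≤ potential s₁ s₂ k z - 1) ∧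
      (Into k₂ q u → potential s₁ s₂ k₂ q ≤ potential s₁ s₂ k z - 1) by
    rcases hinto with hi | hi
    · exact ⟨k₁, p, hk₁, hp, hpz, hi, h.1 hi⟩
    · exact ⟨k₂, q, hk₂, hq, hqz, hi, h.2 hi⟩
  clear hinto hpz hqz hp hq
  unfold potential Into
  rcases hop with ⟨a1, a2, a3, a4, a5, a6, a7, a8⟩ | ⟨a1, a2, a3, a4, a5, a6⟩
  · rcases h2 with ⟨rfl, h2⟩ | ⟨rfl, h2⟩
    · have B := B1 h2
      clear A1 A2 B1 B2
      constructor
      · rintro ⟨-, -, h | h⟩ <;> exfalso <;> linarith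
      rintro -
      rcases h1 with ⟨rfl, h1⟩ | ⟨rfl, h1⟩ <;>
      rcases hor with rfl | rfl <;> rcases hk with ⟨e, f⟩ | ⟨e, f⟩ <;>
      rcases hk₁ with ⟨e₁, f₁⟩ | ⟨e₁, f₁⟩ <;> rcases hk₂ with ⟨e₂, f₂⟩ | ⟨e₂, f₂⟩ <;>
      linarith
    · have B := B2 h2
      clear A1 A2 B1 B2
      constructor
      swap
      · rintro ⟨-, h | h, -⟩ <;> exfalso <;> linarith
      rintro -
      rcases h1 with ⟨rfl, h1⟩ | ⟨rfl, h1⟩ <;>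
      rcases hor with rfl | rfl <;> rcases hk with ⟨e, f⟩ | ⟨e, f⟩ <;>
      rcases hk₁ with ⟨e₁, f₁⟩ | ⟨e₁, f₁⟩ <;> rcases hk₂ with ⟨e₂, f₂⟩ | ⟨e₂, f₂⟩ <;>
      linarith
  · rcases h1 with ⟨rfl, h1⟩ | ⟨rfl, h1⟩
    · have A := A1 h1
      clear A1 A2 B1 B2
      constructor
      · rintro ⟨⟨-, h | h⟩, -⟩ <;> exfalso <;> linarith
      rintro -
      rcases h2 with ⟨rfl, h2⟩ | ⟨rfl, h2⟩ <;>
      rcases hor with rfl | rfl <;> rcases hk with ⟨e, f⟩ | ⟨e, f⟩ <;>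
      rcases hk₁ with ⟨e₁, f₁⟩ | ⟨e₁, f₁⟩ <;> rcases hk₂ with ⟨e₂, f₂⟩ | ⟨e₂, f₂⟩ <;>
      linarith
    · have A := A2 h1
      clear A1 A2 B1 B2
      constructor
      swap
      · rintro ⟨⟨h | h, -⟩, -⟩ <;> exfalso <;> linarith
      rintro -
      rcases h2 with ⟨rfl, h2⟩ | ⟨rfl, h2⟩ <;>
      rcases hor with rfl | rfl <;> rcases hk with ⟨e, f⟩ | ⟨e, f⟩ <;>
      rcases hk₁ with ⟨e₁, f₁⟩ | ⟨e₁, f₁⟩ <;> rcases hk₂ with ⟨e₂, f₂⟩ | ⟨e₂, f₂⟩ <;>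
      linarith

/-- A rectangle has width 1 and height 1/2, so the two terms exceed -4 and -3. -/
lemma potential_ge {k p : ℂ} {s₁ s₂ x y : ℝ} (h1 : IsSign s₁ x) (h2 : IsSign s₂ y)
    (hp : p ∈ rect k) : -7 < potential s₁ s₂ k p := by
  obtain ⟨⟨a, b⟩, c, d⟩ := hp
  unfold potential
  rcases h1 with ⟨rfl, -⟩ | ⟨rfl, -⟩ <;> rcases h2 with ⟨rfl, -⟩ | ⟨rfl, -⟩ <;> linarith

lemma potential_add {k p u : ℂ} {s₁ s₂ : ℝ} (h1 : IsSign s₁ u.re) (h2 : IsSign s₂ u.im) (s : ℝ) :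
    potential s₁ s₂ k (p + s * u) = potential s₁ s₂ k p + (4 * |u.re| + 6 * |u.im|) * s := by
  unfold potential
  rcases h1 with ⟨rfl, h1⟩ | ⟨rfl, h1⟩ <;> rcases h2 with ⟨rfl, h2⟩ | ⟨rfl, h2⟩ <;>
    simp [abs_of_pos, abs_of_neg, *] <;> ring

/-! ### Trajectories of finite length -/

/-- If a trajectory passes through `pt q` at time `b`, then it is given by the projection
of a segment as long as this segment stays in a rectangle. -/
lemma trajectory_local {γ : ℝ → Surface} {w : ℂ} {K : Set ℝ} {b : ℝ} {k q : ℂ}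
    (hγ : LocAffine γ (ContinuousLinearMap.toSpanSingleton ℝ w) K) (hb : b ∈ K) (hk : IsCorner k)
    (hq : q ∈ polygon) (hqb : pt q = γ b) (hin : Into k q (-w)) :
    ∀ᶠ s : ℝ in 𝓝[>] 0, γ (b - s) = pt (q + s * (-w)) := by
  obtain ⟨e, he, hx⟩ := exists_canonicalChart (γ b)
  obtain ⟨c, hc⟩ := hγ b hb e he hx
  rw [← hqb, pt_of_mem hq] at hx
  obtain ⟨d, hd⟩ := he _ hx
  rw [nhds_subtype_eq_comap] at hd
  have hd := eventually_comap.1 hd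
  have hin := into_iff.1 hin
  have t1 : Tendsto (fun s : ℝ => b - s) (𝓝[>] 0) (𝓝 b) := by
    have : Tendsto (fun s : ℝ => b - s) (𝓝 0) (𝓝 (b - 0)) := Continuous.tendsto (by fun_prop) _
    rw [sub_zero] at this
    exact this.mono_left nhdsWithin_le_nhds
  have t2 : Tendsto (fun s : ℝ => q + s * (-w)) (𝓝[>] 0) (𝓝 q) := by
    have : Tendsto (fun s : ℝ => q + s * (-w)) (𝓝 0) (𝓝 (q + (0 : ℝ) * (-w))) :=
      Continuous.tendsto (by fun_prop) _
    simp only [ofReal_zero, zero_mul, add_zero] at this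
    exact this.mono_left nhdsWithin_le_nhds
  have t3 : Tendsto (fun s : ℝ => pt (q + s * (-w))) (𝓝[>] 0) (𝓝 (pt q)) := by
    have : ContinuousWithinAt pt polygon q := continuousOn_pt q hq
    refine this.tendsto.comp (tendsto_nhdsWithin_iff.2 ⟨t2, ?_⟩)
    exact hin.mono fun s hs => rect_subset_polygon hk hs
  -- The two local expressions agree at time b, which relates their additive constants c and d.
  have h0 : e (γ b) = e (pt q) := by rw [hqb]
  rw [hc.self_of_nhds.2, pt_of_mem hq, hd.self_of_nhds ⟨q, hq⟩ rfl] at h0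
  have hsrc : pt q ∈ e.source := by rw [pt_of_mem hq]; exact hx
  filter_upwards [t1.eventually hc, t2.eventually hd, hin,
    t3.eventually (e.open_source.mem_nhds hsrc)] with s h1 h2 h3 h4
  refine e.injOn h1.1 h4 ?_
  rw [h1.2, pt_of_mem (rect_subset_polygon hk h3), h2 ⟨_, rect_subset_polygon hk h3⟩ rfl]
  simp only [ContinuousLinearMap.toSpanSingleton_apply, real_smul] at h0 ⊢
  push_cast
  linear_combination h0

/-- Unique continuation applies, since the times at which a straight segment lies in a convex
rectangle form an interval. -/
lemma trajectory_in_rect {γ : ℝ → Surface} {w : ℂ} {ε b : ℝ} {k p : ℂ}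
    (hγ : LocAffine γ (ContinuousLinearMap.toSpanSingleton ℝ w) (Ioo 0 ε)) (hb : b ∈ Ioo 0 ε)
    (hk : IsCorner k) (hp : p ∈ rect k) (hpb : pt p = γ b) {r : ℝ} (hr : r ∈ Ioo 0 ε)
    (h : p + (r - b) * w ∈ rect k) : γ r = pt (p + (r - b) * w) := by
  have hf : ∀ r : ℝ, p + ((r : ℂ) - b) * w =
      ContinuousLinearMap.toSpanSingleton ℝ w r + (p - b * w) := by
    intro r
    simp only [ContinuousLinearMap.toSpanSingleton_apply, real_smul]
    ring
  let J : Set ℝ := {r | r ∈ Ioo 0 ε ∧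
    ContinuousLinearMap.toSpanSingleton ℝ w r + (p - b * w) ∈ rect k}
  have hcont : Continuous fun r : ℝ => ContinuousLinearMap.toSpanSingleton ℝ w r + (p - b * w) := by
    fun_prop
  have hJ : IsOpen J := isOpen_Ioo.inter ((isOpen_rect k).preimage hcont)
  have hJ' : Convex ℝ J := by
    refine (convex_Ioo 0 ε).inter ?_
    have := ((convex_rect k).translate_preimage_left (p - b * w)).linear_preimage
      (ContinuousLinearMap.toSpanSingleton ℝ w).toLinearMap
    exact this
  have h2 : LocAffine (fun r => pt (ContinuousLinearMap.toSpanSingleton ℝ w r + (p - b * w)))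
      (ContinuousLinearMap.toSpanSingleton ℝ w) J := by
    have := locAffine_pt.comp (ContinuousLinearMap.toSpanSingleton ℝ w) (p - b * w)
    exact this.mono fun r hr => rect_subset hk hr.2
  rw [hf]
  refine (hγ.mono fun r hr => hr.1).eqOn h2 hJ hJ'.isPreconnected (z := b) ⟨hb, ?_⟩ ?_ ⟨hr, ?_⟩
  · rw [← hf]; simpa using hp
  · rw [← hf, ← hpb]; simp
  · rw [← hf]; exact h

/-- A generic trajectory of finite length is eventually given by a segment in a rectangle. -/
theorem exists_rect_lift {γ : ℝ → Surface} {w : ℂ} {ε : ℝ} (h1 : w.re ≠ 0) (h2 : w.im ≠ 0)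
    (hε : 0 < ε) (hγ : LocAffine γ (ContinuousLinearMap.toSpanSingleton ℝ w) (Ioo 0 ε)) :
    ∃ k p δ, IsCorner k ∧ 0 < δ ∧ δ ≤ ε ∧ ∀ r : ℝ, 0 < r → r < δ →
      p + r * w ∈ rect k ∧ γ r = pt (p + r * w) := by
  obtain ⟨s₁, hs₁⟩ := exists_isSign (x := (-w).re) (by simpa using h1)
  obtain ⟨s₂, hs₂⟩ := exists_isSign (x := (-w).im) (by simpa using h2)
  set K := 4 * |(-w).re| + 6 * |(-w).im| with hK
  have hK0 : 0 ≤ K := by positivity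
  -- Induction on a bound for K b + potential + 7, which is positive by `potential_ge`. Moving back
  -- in time within a rectangle leaves it unchanged, as the potential grows at the rate K, and every
  -- crossing lowers it by at least 1.
  have main : ∀ n : ℕ, ∀ b ∈ Ioo 0 ε, ∀ k p, IsCorner k → p ∈ rect k → pt p = γ b →
      K * b + potential s₁ s₂ k p + 7 < n → ∃ k p δ, IsCorner k ∧ 0 < δ ∧ δ ≤ ε ∧
      ∀ r : ℝ, 0 < r → r < δ → p + r * w ∈ rect k ∧ γ r = pt (p + r * w) := by
    intro n
    induction n with
    | zero =>
      intro b hb k p hk hp hpb h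
      have := potential_ge hs₁ hs₂ hp
      have := mul_nonneg hK0 hb.1.le
      simp only [CharP.cast_eq_zero] at h
      linarith
    | succ n ih =>
      intro b hb k p hk hp hpb h
      by_cases hall : ∀ r : ℝ, 0 < r → r ≤ b → p + (r - b) * w ∈ rect k
      · refine ⟨k, p - b * w, b, hk, hb.1, hb.2.le, fun r h0 h1 => ?_⟩
        have h2 := hall r h0 h1.le
        have h3 := trajectory_in_rect hγ hb hk hp hpb ⟨h0, h1.trans hb.2⟩ h2
        have h4 : p - b * w + r * w = p + (r - b) * w := by ring
        rw [h4]
        exact ⟨h2, h3⟩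
      push Not at hall
      obtain ⟨r₀, hr0, hr1, hr2⟩ := hall
      have hcont : Continuous fun r : ℝ => p + ((r : ℂ) - b) * w := by fun_prop
      -- The greatest element of Z is the last time before b at which the segment is outside the
      -- rectangle.
      let Z : Set ℝ := Icc 0 b ∩ {r : ℝ | p + ((r : ℂ) - b) * w ∈ rect k}ᶜ
      have hZ : IsCompact Z :=
        isCompact_Icc.inter_right ((isOpen_rect k).preimage hcont).isClosed_compl
      obtain ⟨r, hrZ, hmax⟩ := hZ.exists_isGreatest ⟨r₀, ⟨hr0.le, hr1⟩, hr2⟩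
      have hrpos : 0 < r := hr0.trans_le (hmax ⟨⟨hr0.le, hr1⟩, hr2⟩)
      have hrb : r < b := by
        refine lt_of_le_of_ne hrZ.1.2 ?_
        rintro rfl
        exact hrZ.2 (by simpa using hp)
      have hrε : r ∈ Ioo 0 ε := ⟨hrpos, hrb.trans hb.2⟩
      have hin : ∀ t : ℝ, r < t → t ≤ b → p + ((t : ℂ) - b) * w ∈ rect k := by
        intro t ht ht'
        by_contra hcon
        exact absurd (hmax ⟨⟨(hrpos.trans ht).le, ht'⟩, hcon⟩) (not_le.2 ht)
      set z := p + ((r : ℂ) - b) * w with hz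
      have hev : ∀ᶠ t in 𝓝[>] r, r < t ∧ t < b :=
        Ioo_mem_nhdsGT hrb
      -- Since γ is continuous at the positive time r, the exit point z belongs to the polygon: the
      -- trajectory crosses a side there and does not run into a missing point.
      have hlim := mem_polygon_of_tendsto (F := 𝓝[>] r) (f := fun t : ℝ => p + ((t : ℂ) - b) * w)
        (z := z) (x := γ r) ?_ ?_ ?_
      rotate_left
      · filter_upwards [hev] with t ht
        exact rect_subset_polygon hk (hin t ht.1 ht.2.le)
      · exact (hcont.tendsto r).mono_left nhdsWithin_le_nhds
      · have := (hγ.continuousAt hrε).tendsto.mono_left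
          (nhdsWithin_le_nhds : 𝓝[>] r ≤ 𝓝 r)
        refine this.congr' ?_
        filter_upwards [hev] with t ht
        exact trajectory_in_rect hγ hb hk hp hpb ⟨hrpos.trans ht.1, ht.2.trans hb.2⟩
          (hin t ht.1 ht.2.le)
      obtain ⟨hzp, hzr⟩ := hlim
      have hzin : Into k z (- -w) := by
        rw [into_iff, neg_neg]
        have : ∀ᶠ s : ℝ in 𝓝[>] 0, 0 < s ∧ s < b - r :=
          Ioo_mem_nhdsGT (by linarith)
        filter_upwards [this] with s hs
        have := hin (r + s) (by linarith) (by linarith)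
        convert this using 1
        rw [hz]; push_cast; ring
      obtain ⟨k', q, hk', hq, hqz, hqin, hpot⟩ := exists_crossing hs₁ hs₂ hzp hk hrZ.2 hzin
      have hloc := trajectory_local hγ hrε hk' hq (hqz.trans hzr) hqin
      have hsm : ∀ᶠ s : ℝ in 𝓝[>] 0, 0 < s ∧ s < r :=
        Ioo_mem_nhdsGT hrpos
      obtain ⟨s, h5, h6, h7, h8⟩ := (hloc.and ((into_iff.1 hqin).and hsm)).exists
      refine ih (r - s) ⟨by linarith, by linarith [hrε.2]⟩ k' _ hk' h6 h5.symm ?_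
      -- Accounting for the measure: the potential gained while moving back from b to r, and then to
      -- r - s, equals K times the time elapsed, so only the drop at the crossing remains.
      have e1 : potential s₁ s₂ k' (q + s * -w) = potential s₁ s₂ k' q + K * s :=
        potential_add hs₁ hs₂ s
      have e2 : potential s₁ s₂ k z = potential s₁ s₂ k p + K * (b - r) := by
        rw [hK, ← potential_add hs₁ hs₂, hz]
        congr 1
        push_cast
        ring
      rw [e1]
      push_cast at h
      linarith
  obtain ⟨b, hb⟩ : ∃ b, b ∈ Ioo 0 ε := ⟨ε / 2, by linarith, by linarith⟩
  obtain ⟨z, hz, hzb⟩ := exists_pt (γ b)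
  obtain ⟨k, q, hk, hq, hqz, hin⟩ := exists_into (u := -w) hz (by simpa using h1)
    (by simpa using h2)
  have hloc := trajectory_local hγ hb hk hq (hqz.trans hzb) hin
  have hsm : ∀ᶠ s : ℝ in 𝓝[>] 0, 0 < s ∧ s < b :=
    Ioo_mem_nhdsGT hb.1
  obtain ⟨s, h5, h6, h7, h8⟩ := (hloc.and ((into_iff.1 hin).and hsm)).exists
  obtain ⟨n, hn⟩ := exists_nat_gt (K * (b - s) + potential s₁ s₂ k (q + s * -w) + 7)
  exact main n (b - s) ⟨by linarith, by linarith [hb.2]⟩ k _ hk h6 h5.symm hn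

/-! ### Points on the horizontal and vertical sides -/

lemma exists_dyadic {x : ℝ} (h0 : 0 < x) (h1 : x ≤ 1) :
    ∃ n : ℕ, ((1 : ℝ) / 2) ^ n / 2 < x ∧ x ≤ (1 / 2) ^ n := by
  obtain ⟨n, h2, h3⟩ := exists_nat_pow_near_of_lt_one h0 h1 (by norm_num : (0 : ℝ) < 1 / 2)
    (by norm_num)
  refine ⟨n, ?_, h3⟩
  rw [pow_succ] at h2
  linarith

lemma top_mem_left (n : ℕ) {z : ℂ} (him : z.im = 1) (h1 : 1 - (1 / 2) ^ n < z.re)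
    (h2 : z.re < 1 - (1 / 2) ^ n * (3 / 4)) : z ∈ polygon := by
  obtain ⟨t, ht⟩ : ∃ t : ℝ, z.re = 1 - (1 / 2) ^ n + t := ⟨_, (add_sub_cancel _ _).symm⟩
  refine Or.inr ⟨_, Or.inl ⟨Edge.C₁ n, t, by linarith, ?_, ?_,
    rfl⟩⟩
  · simp only [Edge.len]; linarith
  · apply Complex.ext <;> simp [Edge.start₁, Edge.dir, him, ht]

lemma top_mem_right (n : ℕ) {z : ℂ} (him : z.im = 1) (h1 : 1 - (1 / 2) ^ n * (3 / 4) < z.re)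
    (h2 : z.re < 1 - (1 / 2) ^ n / 2) : z ∈ polygon := by
  obtain ⟨t, ht⟩ : ∃ t : ℝ, z.re = 1 - (1 / 2) ^ n * (3 / 4) + t := ⟨_, (add_sub_cancel _ _).symm⟩
  refine Or.inr ⟨_, Or.inl ⟨Edge.C₂ n, t, by linarith, ?_, ?_,
    rfl⟩⟩
  · simp only [Edge.len]; linarith
  · apply Complex.ext <;> simp [Edge.start₁, Edge.dir, him, ht]

lemma bottom_mem_left (n : ℕ) {z : ℂ} (him : z.im = 0) (h1 : 1 / 2 - (1 / 2) ^ n < z.re)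
    (h2 : z.re < 1 / 2 - (1 / 2) ^ n * (3 / 4)) : z ∈ polygon := by
  obtain ⟨t, ht⟩ : ∃ t : ℝ, z.re = 1 / 2 - (1 / 2) ^ n + t := ⟨_, (add_sub_cancel _ _).symm⟩
  refine Or.inr ⟨_, Or.inr ⟨Edge.C₂ n, t, by linarith, ?_,
    rfl, ?_⟩⟩
  · simp only [Edge.len]; linarith
  · apply Complex.ext <;> simp [Edge.start₂, Edge.dir, him, ht]

lemma bottom_mem_right (n : ℕ) {z : ℂ} (him : z.im = 0)
    (h1 : 1 / 2 - (1 / 2) ^ n * (3 / 4) < z.re) (h2 : z.re < 1 / 2 - (1 / 2) ^ n / 2) :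
    z ∈ polygon := by
  obtain ⟨t, ht⟩ : ∃ t : ℝ, z.re = 1 / 2 - (1 / 2) ^ n * (3 / 4) + t := ⟨_, (add_sub_cancel _ _).symm⟩
  refine Or.inr ⟨_, Or.inr ⟨Edge.C₁ n, t, by linarith, ?_,
    rfl, ?_⟩⟩
  · simp only [Edge.len]; linarith
  · apply Complex.ext <;> simp [Edge.start₂, Edge.dir, him, ht]

lemma middle_mem {z : ℂ} (him : z.im = 1 / 2) (h1 : -1 / 2 < z.re) (h2 : z.re < 1)
    (h3 : z.re ≠ 0) (h4 : z.re ≠ 1 / 2) : z ∈ polygon := by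
  rcases h3.lt_or_gt with h | h
  · refine Or.inr ⟨_, Or.inl ⟨Edge.S, z.re + 1 / 2, by linarith, ?_, ?_, rfl⟩⟩
    · simp only [Edge.len]; linarith
    · apply Complex.ext <;> simp [Edge.start₁, Edge.dir, him]
      ring
  rcases h4.lt_or_gt with h' | h'
  · exact Or.inl (Or.inr ⟨⟨h, h'⟩, by rw [him]; norm_num, by rw [him]; norm_num⟩)
  · refine Or.inr ⟨_, Or.inr ⟨Edge.S, z.re - 1 / 2, by linarith, ?_, rfl, ?_⟩⟩
    · simp only [Edge.len]; linarith
    · apply Complex.ext <;> simp [Edge.start₂, Edge.dir, him]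

/-- Vertices on the top and bottom sides lie at distances (1/2)^n and (1/2)^n · 3/4 from the right
end of the side. These numbers accumulate only at 0, so every positive x has a gap on either side;
`exists_gap'` is the gap above x. -/
lemma exists_gap {x : ℝ} (h0 : 0 < x) (h1 : x ≤ 1) : ∃ y < x, ∀ t : ℝ, y < t → t < x →
    ∃ n : ℕ, ((1 : ℝ) / 2) ^ n / 2 < t ∧ t < (1 / 2) ^ n ∧ t ≠ (1 / 2) ^ n * (3 / 4) := by
  obtain ⟨n, h2, h3⟩ := exists_dyadic h0 h1
  by_cases h : x ≤ (1 / 2) ^ n * (3 / 4)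
  · exact ⟨_, h2, fun t ht ht' => ⟨n, ht, ht'.trans_le h3, (ht'.trans_le h).ne⟩⟩
  · push Not at h
    exact ⟨_, h, fun t ht ht' => ⟨n, by linarith [dyadic_pos n], ht'.trans_le h3, ht.ne'⟩⟩

lemma exists_gap' {x : ℝ} (h0 : 0 < x) (h1 : x < 1) : ∃ y > x, ∀ t : ℝ, x < t → t < y →
    ∃ n : ℕ, ((1 : ℝ) / 2) ^ n / 2 < t ∧ t < (1 / 2) ^ n ∧ t ≠ (1 / 2) ^ n * (3 / 4) := by
  obtain ⟨n, h2, h3⟩ := exists_dyadic h0 h1.le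
  rcases h3.lt_or_eq with h3 | h3
  · by_cases h : (1 / 2) ^ n * (3 / 4) ≤ x
    · exact ⟨_, h3, fun t ht ht' => ⟨n, h2.trans ht, ht', (h.trans_lt ht).ne'⟩⟩
    · push Not at h
      exact ⟨_, h, fun t ht ht' => ⟨n, h2.trans ht, by linarith [dyadic_pos n], ht'.ne⟩⟩
  -- Here x is itself a power of 1/2, so the gap above it belongs to the preceding scale, which
  -- exists because x < 1.
  · rcases n with _ | n
    · simp at h3; linarith
    · rw [pow_succ] at h3
      have := (dyadic_pos n).1
      exact ⟨(1 / 2) ^ n * (3 / 4), by linarith, fun t ht ht' =>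
        ⟨n, by linarith, by linarith, ht'.ne⟩⟩

lemma top_mem {z : ℂ} (him : z.im = 1) (h : ∃ n : ℕ, ((1 : ℝ) / 2) ^ n / 2 < 1 - z.re ∧
    1 - z.re < (1 / 2) ^ n ∧ 1 - z.re ≠ (1 / 2) ^ n * (3 / 4)) : z ∈ polygon := by
  obtain ⟨n, h1, h2, h3⟩ := h
  rcases h3.lt_or_gt with h | h
  · exact top_mem_right n him (by linarith) (by linarith)
  · exact top_mem_left n him (by linarith) (by linarith)

lemma bottom_mem {z : ℂ} (him : z.im = 0) (h : ∃ n : ℕ, ((1 : ℝ) / 2) ^ n / 2 < 1 / 2 - z.re ∧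
    1 / 2 - z.re < (1 / 2) ^ n ∧ 1 / 2 - z.re ≠ (1 / 2) ^ n * (3 / 4)) : z ∈ polygon := by
  obtain ⟨n, h1, h2, h3⟩ := h
  rcases h3.lt_or_gt with h | h
  · exact bottom_mem_right n him (by linarith) (by linarith)
  · exact bottom_mem_left n him (by linarith) (by linarith)

lemma eventually_add_mul_mem {a b x u : ℝ} (ha : a < x ∨ (a = x ∧ 0 < u))
    (hb : x < b ∨ (x = b ∧ u < 0)) :
    ∀ᶠ r in 𝓝[>] (0 : ℝ), a < x + r * u ∧ x + r * u < b :=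
  (eventually_lt_add_mul.2 ha).and (eventually_add_mul_lt.2 hb)

/-- No singularity obstructs horizontal rays to the right on a horizontal side. -/
lemma eventually_mem_of_right {k p u : ℂ} (hk : IsCorner k) (h1 : k.re ≤ p.re)
    (h2 : p.re < k.re + 1) (h3 : p.im = k.im ∨ p.im = k.im + 1 / 2) (hu : u.im = 0)
    (hu' : 0 < u.re) : ∀ᶠ r : ℝ in 𝓝[>] 0, p + r * u ∈ polygon := by
  have hre : ∀ r : ℝ, (p + r * u).re = p.re + r * u.re := fun r => by simp
  have him : ∀ r : ℝ, (p + r * u).im = p.im := fun r => by simp [hu]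
  have hmid : p.im = 1 / 2 → -1 / 2 ≤ p.re → p.re < 1 → ∀ᶠ r : ℝ in 𝓝[>] 0,
      p + r * u ∈ polygon := by
    intro h h' h''
    have e1 : ∀ᶠ r : ℝ in 𝓝[>] 0, p.re < p.re + r * u.re :=
      eventually_lt_add_mul.2 (Or.inr ⟨rfl, hu'⟩)
    have e2 : ∀ c : ℝ, ∀ᶠ r : ℝ in 𝓝[>] 0, p.re + r * u.re ≠ c := by
      intro c
      rcases lt_or_ge p.re c with h | h
      · exact (eventually_add_mul_lt.2 (Or.inl h)).mono fun _ h => h.ne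
      · exact e1.mono fun r h' => (h.trans_lt h').ne'
    filter_upwards [e1, e2 0, e2 (1 / 2),
      eventually_add_mul_lt (u := u.re).2 (Or.inl h'')] with r h1 h2 h3 h4
    exact middle_mem (by rw [him, h]) (by rw [hre]; linarith) (by rw [hre]; exact h4)
      (by rw [hre]; exact h2) (by rw [hre]; exact h3)
  rcases hk with ⟨e, f⟩ | ⟨e, f⟩ <;> rcases h3 with h3 | h3
  · exact hmid (by linarith) (by linarith) (by linarith)
  · obtain ⟨y, hy, hy'⟩ := exists_gap (x := 1 - p.re) (by linarith) (by linarith)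
    filter_upwards [eventually_add_mul_mem (a := p.re) (b := 1 - y) (x := p.re) (u := u.re)
      (Or.inr ⟨rfl, hu'⟩) (Or.inl (by linarith))] with r hr
    refine top_mem (by rw [him]; linarith) ?_
    rw [hre]
    exact hy' _ (by linarith) (by linarith)
  · obtain ⟨y, hy, hy'⟩ := exists_gap (x := 1 / 2 - p.re) (by linarith) (by linarith)
    filter_upwards [eventually_add_mul_mem (a := p.re) (b := 1 / 2 - y) (x := p.re) (u := u.re)
      (Or.inr ⟨rfl, hu'⟩) (Or.inl (by linarith))] with r hr
    refine bottom_mem (by rw [him]; linarith) ?_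
    rw [hre]
    exact hy' _ (by linarith) (by linarith)
  · exact hmid (by linarith) (by linarith) (by linarith)

/-- Only the accumulation point `1 + I` of singularities obstructs horizontal rays to the left on
the top sides. -/
lemma eventually_mem_of_left {k p u : ℂ} (hk : IsCorner k) (h1 : k.re < p.re)
    (h2 : p.re ≤ k.re + 1) (h3 : p.im = k.im + 1 / 2) (hu : u.im = 0)
    (hu' : u.re < 0) (hp : p ≠ 1 + I) : ∀ᶠ r : ℝ in 𝓝[>] 0, p + r * u ∈ polygon := by
  have hre : ∀ r : ℝ, (p + r * u).re = p.re + r * u.re := fun r => by simp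
  have him : ∀ r : ℝ, (p + r * u).im = p.im := fun r => by simp [hu]
  rcases hk with ⟨e, f⟩ | ⟨e, f⟩
  · have hp' : p.re < 1 := by
      refine lt_of_le_of_ne (by linarith) fun h => hp ?_
      apply Complex.ext
      · simp [h]
      · simp; linarith
    obtain ⟨y, hy, hy'⟩ := exists_gap' (x := 1 - p.re) (by linarith) (by linarith)
    filter_upwards [eventually_add_mul_mem (a := 1 - y) (b := p.re) (x := p.re) (u := u.re)
      (Or.inl (by linarith)) (Or.inr ⟨rfl, hu'⟩)] with r hr
    refine top_mem (by rw [him]; linarith) ?_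
    rw [hre]
    exact hy' _ (by linarith) (by linarith)
  · have e1 : ∀ᶠ r : ℝ in 𝓝[>] 0, p.re + r * u.re < p.re :=
      eventually_add_mul_lt.2 (Or.inr ⟨rfl, hu'⟩)
    have e2 : ∀ c : ℝ, ∀ᶠ r : ℝ in 𝓝[>] 0, p.re + r * u.re ≠ c := by
      intro c
      rcases lt_or_ge c p.re with h | h
      · exact (eventually_lt_add_mul.2 (Or.inl h)).mono fun _ h => h.ne'
      · exact e1.mono fun r h' => (h'.trans_le h).ne
    filter_upwards [e1, e2 0, e2 (1 / 2),
      eventually_lt_add_mul (u := u.re).2 (Or.inl (show -1 / 2 < p.re by linarith))] with r h1 h2 h3 h4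
    exact middle_mem (by rw [him]; linarith) (by rw [hre]; exact h4) (by rw [hre]; linarith)
      (by rw [hre]; exact h2) (by rw [hre]; exact h3)

/-! ### Vertices do not belong to the polygon -/

lemma dyadic_cases (n m : ℕ) : n = m ∨ ((1 : ℝ) / 2) ^ m ≤ (1 / 2) ^ n / 2 ∨
    ((1 : ℝ) / 2) ^ n ≤ (1 / 2) ^ m / 2 := by
  rcases dyadic_trichotomy n m with h | h | h
  · exact Or.inl h
  · exact Or.inr (Or.inl h.2.1)
  · exact Or.inr (Or.inr h.2.1)

lemma polygon_boundary {z : ℂ} (h : z ∈ polygon) (h' : z ∉ polygonInterior) :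
    ∃ w, Glued z w ∨ Glued w z := h.resolve_left h'

/-- These are the left endpoints of the first edges of `C₁ n` and `C₂ n`. Edges of a different index
lie in a disjoint dyadic block. -/
lemma top_notMem_of_eq {r : ℝ} (n : ℕ) (hr : r = (1 / 2) ^ n ∨ r = (1 / 2) ^ n * (3 / 4)) :
    (⟨1 - r, 1⟩ : ℂ) ∉ polygon := by
  intro h
  have hpos := dyadic_pos n
  have hi : (⟨1 - r, 1⟩ : ℂ) ∉ polygonInterior := by
    rintro ((⟨-, -, h⟩ | ⟨-, -, h⟩) | ⟨-, -, h⟩) <;> simp at h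
    norm_num at h
  obtain ⟨w, hw | hw⟩ := polygon_boundary h hi
  all_goals
    rcases glued_cases hw with ⟨m, t, h⟩ | ⟨m, t, h⟩ | ⟨t, h⟩ | ⟨m, hm, t, h⟩ | ⟨m, hm, t, h⟩ |
      ⟨m, hm, t, h⟩ | ⟨m, hm, t, h⟩
    all_goals
      obtain ⟨a, b, c, d, e, f⟩ := h
      try have h0 := dyadic_pos m
      try have h1 := dyadic_odd hm
      try have h2 := dyadic_cases n m
      dsimp only at c d e f
      first
        | (exfalso; linarith)
        | (rcases hr with rfl | rfl <;> rcases h2 with rfl | h2 | h2 <;> linarith)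

/-- These are the lower endpoints of the second edges of `A n`. On each side of height 2/3 only one
parity occurs, so consecutive scales there differ by a factor 4; hence the parity clause of
`dyadic_trichotomy`. -/
lemma left_notMem_of_eq {y : ℝ} (n : ℕ) (hy : (Even n ∧ y = 2 / 3 + (1 / 2) ^ n / 12) ∨
    (¬ Even n ∧ y = 2 / 3 - (1 / 2) ^ n / 3)) : (⟨0, y⟩ : ℂ) ∉ polygon := by
  intro h
  have hpos := dyadic_pos n
  have hi : (⟨0, y⟩ : ℂ) ∉ polygonInterior := by
    rintro ((⟨h, -⟩ | ⟨-, -, h⟩) | ⟨h, -⟩)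
    · simp at h
    · rcases hy with ⟨hn, rfl⟩ | ⟨hn, rfl⟩
      · simp only at h; linarith
      · have := dyadic_odd hn; simp only at h; linarith
    · simp at h
  obtain ⟨w, hw | hw⟩ := polygon_boundary h hi
  all_goals
    rcases glued_cases hw with ⟨m, t, h⟩ | ⟨m, t, h⟩ | ⟨t, h⟩ | ⟨m, hm, t, h⟩ | ⟨m, hm, t, h⟩ |
      ⟨m, hm, t, h⟩ | ⟨m, hm, t, h⟩
    all_goals
      obtain ⟨a, b, c, d, e, f⟩ := h
      try have h0 := dyadic_pos m
      try have h1 := dyadic_odd hm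
      try have h2 := dyadic_trichotomy n m
      dsimp only at c d e f
      rcases hy with ⟨hn, hy⟩ | ⟨hn, hy⟩
      all_goals
        try have h1 := dyadic_odd hn
        first
          | (exfalso; linarith)
          | (rcases h2 with rfl | ⟨-, g, g'⟩ | ⟨-, g, g'⟩
             · first
                 | contradiction
                 | linarith
             all_goals
               first
                 | linarith
                 | (have g := g' (by tauto); linarith))

/-- Since 1/4 = 1/2 - (1/2)^2, this is the left endpoint of the second edge of `C₂ 2`. It is the
lower end of the saddle connection in `one_le_of_unit_expansion`. -/
lemma quarter_notMem : (⟨1 / 4, 0⟩ : ℂ) ∉ polygon := by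
  intro h
  have hi : (⟨1 / 4, 0⟩ : ℂ) ∉ polygonInterior := by
    rintro ((⟨-, h, -⟩ | ⟨-, h, -⟩) | ⟨-, h, -⟩) <;> simp at h
    norm_num at h
  obtain ⟨w, hw | hw⟩ := polygon_boundary h hi
  all_goals
    rcases glued_cases hw with ⟨m, t, h⟩ | ⟨m, t, h⟩ | ⟨t, h⟩ | ⟨m, hm, t, h⟩ | ⟨m, hm, t, h⟩ |
      ⟨m, hm, t, h⟩ | ⟨m, hm, t, h⟩
    all_goals
      obtain ⟨a, b, c, d, e, f⟩ := h
      try have h0 := dyadic_pos m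
      try have h1 := dyadic_odd hm
      try have h2 := dyadic_cases 2 m
      dsimp only at c d e f
      first
        | (exfalso; linarith)
        | (rcases h2 with rfl | h2 | h2 <;> norm_num at * <;> linarith)

/-! ### Wedges -/

/-- The linear map `(r, s) ↦ r u + s v`. -/
noncomputable def wedge (u v : ℂ) : ℝ × ℝ →L[ℝ] ℂ :=
  (ContinuousLinearMap.fst ℝ ℝ ℝ).smulRight u + (ContinuousLinearMap.snd ℝ ℝ ℝ).smulRight v

lemma wedge_apply (u v : ℂ) (x : ℝ × ℝ) : wedge u v x = x.1 * u + x.2 * v := by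
  simp [wedge]

/-- `w` has the sign of `u`, or the sign of `v` if `u = 0`. -/
def Refines (w u v : ℝ) : Prop :=
  (0 < u → 0 < w) ∧ (u < 0 → w < 0) ∧ (u = 0 → 0 < v → 0 < w) ∧ (u = 0 → v < 0 → w < 0)

lemma eventually_refines (u v : ℝ) : ∀ᶠ t in 𝓝[>] (0 : ℝ), Refines (u + t * v) u v := by
  have hT : Tendsto (fun t : ℝ => u + t * v) (𝓝[>] 0) (𝓝 u) := by
    have : Tendsto (fun t : ℝ => u + t * v) (𝓝 0) (𝓝 (u + 0 * v)) :=
      Continuous.tendsto (by fun_prop) _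
    simp only [zero_mul, add_zero] at this
    exact this.mono_left nhdsWithin_le_nhds
  rcases lt_trichotomy u 0 with h | rfl | h
  · filter_upwards [hT.eventually (gt_mem_nhds h)] with t ht
    exact ⟨fun h' => absurd h h'.not_gt, fun _ => ht, fun h' => absurd h' h.ne,
      fun h' => absurd h' h.ne⟩
  · filter_upwards [self_mem_nhdsWithin] with t ht
    have ht : 0 < t := ht
    exact ⟨fun h => absurd h (lt_irrefl _), fun h => absurd h (lt_irrefl _),
      fun _ h => by simpa using mul_pos ht h, fun _ h => by simpa using mul_neg_of_pos_of_neg ht h⟩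
  · filter_upwards [hT.eventually (lt_mem_nhds h)] with t ht
    exact ⟨fun _ => ht, fun h' => absurd h h'.not_gt, fun h' => absurd h' h.ne',
      fun h' => absurd h' h.ne'⟩

lemma Refines.ne_zero {w u v : ℝ} (h : Refines w u v) (h' : u ≠ 0 ∨ v ≠ 0) : w ≠ 0 := by
  obtain ⟨h1, h2, h3, h4⟩ := h
  rcases lt_trichotomy u 0 with hu | hu | hu
  · exact (h2 hu).ne
  · rcases (h'.resolve_left (not_not.2 hu)).lt_or_gt with hv | hv
    · exact (h4 hu hv).ne
    · exact (h3 hu hv).ne'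
  · exact (h1 hu).ne'

lemma Refines.neg {w u v : ℝ} (h : Refines w u v) : Refines (-w) (-u) (-v) := by
  obtain ⟨h1, h2, h3, h4⟩ := h
  simp only [Refines, Left.neg_pos_iff, Left.neg_neg_iff, neg_eq_zero]
  exact ⟨h2, h1, h4, h3⟩

/-- With s chosen after r, the increment r u + s v has the sign of u, or that of v if u = 0. This is
the sign recorded by w. -/
lemma Refines.eventually_lt {w u v a b : ℝ} (h : Refines w u v) (huv : u ≠ 0 ∨ v ≠ 0)
    (hab : a < b ∨ (a = b ∧ 0 < w)) :
    ∀ᶠ r in 𝓝[>] (0 : ℝ), ∀ᶠ s in 𝓝[>] (0 : ℝ), a < b + r * u + s * v := by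
  rcases hab with hab | ⟨rfl, hw⟩
  · filter_upwards [eventually_lt_add_mul.2 (Or.inl hab)] with r hr
    exact eventually_lt_add_mul.2 (Or.inl hr)
  obtain ⟨-, h2, -, h4⟩ := h
  rcases lt_trichotomy u 0 with hu | hu | hu
  · exact absurd (h2 hu) hw.not_gt
  · have hv : 0 < v := by
      rcases (huv.resolve_left (not_not.2 hu)).lt_or_gt with hv | hv
      · exact absurd (h4 hu hv) hw.not_gt
      · exact hv
    refine Eventually.of_forall fun r => eventually_lt_add_mul.2 (Or.inr ⟨by simp [hu], hv⟩)
  · filter_upwards [eventually_lt_add_mul.2 (Or.inr ⟨rfl, hu⟩)] with r hr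
    exact eventually_lt_add_mul.2 (Or.inl hr)

lemma Refines.eventually_gt {w u v a b : ℝ} (h : Refines w u v) (huv : u ≠ 0 ∨ v ≠ 0)
    (hab : b < a ∨ (b = a ∧ w < 0)) :
    ∀ᶠ r in 𝓝[>] (0 : ℝ), ∀ᶠ s in 𝓝[>] (0 : ℝ), b + r * u + s * v < a := by
  have := h.neg.eventually_lt (a := -a) (b := -b) (by simpa using huv)
    (by rcases hab with h | ⟨h, h'⟩ <;> [left; right] <;> [linarith; constructor] <;> linarith)
  filter_upwards [this] with r hr
  filter_upwards [hr] with s hs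
  linarith

/-- A wedge on the surface is given, near its apex, by a wedge in a rectangle. -/
theorem exists_wedge_lift {f : ℝ × ℝ → Surface} {u v : ℂ} {r₀ s₀ : ℝ} (hr₀ : 0 < r₀) (hs₀ : 0 < s₀)
    (huv : u.re * v.im ≠ u.im * v.re)
    (hf : LocAffine f (wedge u v) (Ioo 0 r₀ ×ˢ Ioo 0 s₀)) :
    ∃ k p w, IsCorner k ∧ Into k p w ∧ Refines w.re u.re v.re ∧ Refines w.im u.im v.im ∧
      (∀ r s : ℝ, r ∈ Ioo 0 r₀ → s ∈ Ioo 0 s₀ → p + r * u + s * v ∈ rect k →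
        f (r, s) = pt (p + r * u + s * v)) ∧
      ∀ᶠ r : ℝ in 𝓝[>] 0, ∀ᶠ s : ℝ in 𝓝[>] 0, p + r * u + s * v ∈ rect k := by
  have hre : u.re ≠ 0 ∨ v.re ≠ 0 := by
    by_contra! h
    exact huv (by rw [h.1, h.2]; ring)
  have him : u.im ≠ 0 ∨ v.im ≠ 0 := by
    by_contra! h
    exact huv (by rw [h.1, h.2]; ring)
  -- For small t the direction u + t v has no zero component and refines the signs of u, so
  -- `exists_rect_lift` applies to the diagonal r ↦ f (r, t r) of the wedge.
  obtain ⟨t, ⟨ht1, ht2⟩, ht⟩ := (((eventually_refines u.re v.re).and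
    (eventually_refines u.im v.im)).and self_mem_nhdsWithin).exists
  have ht : 0 < t := ht
  set w : ℂ := u + t * v with hw
  have hwre : w.re = u.re + t * v.re := by simp [hw]
  have hwim : w.im = u.im + t * v.im := by simp [hw]
  rw [← hwre] at ht1
  rw [← hwim] at ht2
  let A : ℝ →L[ℝ] ℝ × ℝ := (ContinuousLinearMap.id ℝ ℝ).prod (t • ContinuousLinearMap.id ℝ ℝ)
  have hA : ∀ r, A r + 0 = (r, t * r) := fun r => by simp [A]
  have hγ := hf.comp A 0
  have hε : 0 < min r₀ (s₀ / t) := lt_min hr₀ (div_pos hs₀ ht)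
  have hγ' : LocAffine (fun r => f (r, t * r)) (ContinuousLinearMap.toSpanSingleton ℝ w)
      (Ioo 0 (min r₀ (s₀ / t))) := by
    have e1 : (fun r => f (r, t * r)) = fun r => f (A r + 0) := by simp only [hA]
    have e2 : ContinuousLinearMap.toSpanSingleton ℝ w = (wedge u v).comp A := by
      ext
      simp [wedge_apply, A, hw]
    rw [e1, e2]
    refine hγ.mono ?_
    rintro r ⟨h1, h2⟩
    rw [lt_min_iff, lt_div_iff₀ ht] at h2
    change A r + 0 ∈ Ioo 0 r₀ ×ˢ Ioo 0 s₀
    rw [hA]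
    exact ⟨⟨h1, h2.1⟩, mul_pos ht h1, by rw [mul_comm]; exact h2.2⟩
  obtain ⟨k, p, δ, hk, hδ, hδ', hlift⟩ := exists_rect_lift (ht1.ne_zero hre) (ht2.ne_zero him) hε hγ'
  have hin : Into k p w := by
    rw [into_iff]
    filter_upwards [Ioo_mem_nhdsGT hδ] with r hr using (hlift r hr.1 hr.2).1
  refine ⟨k, p, w, hk, hin, ht1, ht2, ?_, ?_⟩
  · intro r s hr hs hrs
    let R : Set (ℝ × ℝ) := (Ioo 0 r₀ ×ˢ Ioo 0 s₀) ∩ {x | wedge u v x + p ∈ rect k}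
    have hR : IsOpen R := (isOpen_Ioo.prod isOpen_Ioo).inter
      ((isOpen_rect k).preimage (by fun_prop : Continuous fun x => wedge u v x + p))
    have hR' : Convex ℝ R := by
      refine ((convex_Ioo _ _).prod (convex_Ioo _ _)).inter ?_
      exact ((convex_rect k).translate_preimage_left p).linear_preimage (wedge u v).toLinearMap
    have h2 : LocAffine (fun x => pt (wedge u v x + p)) (wedge u v) R :=
      (locAffine_pt.comp (wedge u v) p).mono fun x hx => rect_subset hk hx.2
    have hval : ∀ r s : ℝ, wedge u v (r, s) + p = p + r * u + s * v := by
      intro r s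
      rw [wedge_apply]
      ring
    -- At one point of the diagonal f agrees with its planar lift; unique continuation spreads this
    -- over the convex set R.
    have h0 : 0 < δ / 2 ∧ δ / 2 < δ := ⟨by linarith, by linarith⟩
    obtain ⟨l1, l2⟩ := hlift (δ / 2) h0.1 h0.2
    have hb := lt_min_iff.1 (h0.2.trans_le hδ')
    rw [lt_div_iff₀ ht] at hb
    have hval' : wedge u v (δ / 2, t * (δ / 2)) + p = p + ((δ / 2 : ℝ) : ℂ) * w := by
      rw [hval, hw]; push_cast; ring
    have := (hf.mono fun x hx => hx.1).eqOn h2 hR hR'.isPreconnected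
      (z := (δ / 2, t * (δ / 2)))
      ⟨⟨⟨h0.1, hb.1⟩, mul_pos ht h0.1, by rw [mul_comm]; exact hb.2⟩, by
        change wedge u v (δ / 2, t * (δ / 2)) + p ∈ rect k
        rw [hval']; exact l1⟩
      (by rw [hval']; exact l2)
      (show (r, s) ∈ R from ⟨⟨hr, hs⟩, by
        change wedge u v (r, s) + p ∈ rect k
        rw [hval]; exact hrs⟩)
    rw [this]
    simp only [hval]
  · obtain ⟨⟨i1, i2⟩, i3, i4⟩ := hin
    filter_upwards [ht1.eventually_lt hre i1, ht1.eventually_gt hre i2, ht2.eventually_lt him i3,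
      ht2.eventually_gt him i4] with r h1 h2 h3 h4
    filter_upwards [h1, h2, h3, h4] with s g1 g2 g3 g4
    refine ⟨⟨?_, ?_⟩, ?_, ?_⟩ <;> simp <;> linarith

/-- `f` does not extend to the side `s = 0` of the wedge. -/
def IsSingular (f : ℝ × ℝ → Surface) : Prop :=
  ∃ᶠ r : ℝ in 𝓝[>] 0, ¬ ∃ x, Tendsto (fun s : ℝ => f (r, s)) (𝓝[>] 0) (𝓝 x)

/-- In the planar picture of the wedge, points missing from the polygon accumulate at p along u. A
ray into the open rectangle meets none, so u runs along a side; among horizontal rays, only those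
pointing left can meet missing points arbitrarily near their start. -/
theorem IsSingular.direction {f : ℝ × ℝ → Surface} {u v : ℂ} {r₀ s₀ : ℝ} (hr₀ : 0 < r₀)
    (hs₀ : 0 < s₀) (huv : u.re * v.im ≠ u.im * v.re)
    (hf : LocAffine f (wedge u v) (Ioo 0 r₀ ×ˢ Ioo 0 s₀)) (hsing : IsSingular f) :
    (u.re = 0 ∨ (u.im = 0 ∧ u.re < 0)) ∧ (u.im = 0 → u.re < 0 → v.re = 0 → v.im < 0 →
      ∀ r s : ℝ, r ∈ Ioo 0 r₀ → s ∈ Ioo 0 s₀ → 1 + I + r * u + s * v ∈ rect ⟨0, 1 / 2⟩ →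
        f (r, s) = pt (1 + I + r * u + s * v)) := by
  obtain ⟨k, p, w, hk, hin, hre, him, hlift, hev⟩ := exists_wedge_lift hr₀ hs₀ huv hf
  -- If p + r u were in the polygon, continuity of `pt` would give the limit at s = 0 that
  -- singularity denies.
  have hfreq : ∃ᶠ r : ℝ in 𝓝[>] 0, p + r * u ∉ polygon := by
    refine (hsing.and_eventually (hev.and (Ioo_mem_nhdsGT hr₀))).mono ?_
    rintro r ⟨h1, h2, h3⟩ hmem
    refine h1 ⟨pt (p + r * u), ?_⟩
    have hT : Tendsto (fun s : ℝ => p + r * u + s * v) (𝓝[>] 0) (𝓝 (p + r * u)) := by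
      have : Tendsto (fun s : ℝ => p + r * u + s * v) (𝓝 0) (𝓝 (p + r * u + (0 : ℝ) * v)) :=
        Continuous.tendsto (by fun_prop) _
      simp only [ofReal_zero, zero_mul, add_zero] at this
      exact this.mono_left nhdsWithin_le_nhds
    have hT' := (continuousOn_pt _ hmem).tendsto.comp
      (tendsto_nhdsWithin_iff.2 ⟨hT, h2.mono fun s hs => rect_subset_polygon hk hs⟩)
    refine hT'.congr' ?_
    filter_upwards [h2, Ioo_mem_nhdsGT hs₀] with s g1 g2
    exact (hlift r s h3 g2 g1).symm
  have hno : ¬ ∀ᶠ r : ℝ in 𝓝[>] 0, p + r * u ∈ polygon := fun h => by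
    obtain ⟨r, h1, h2⟩ := (hfreq.and_eventually h).exists
    exact h1 h2
  have hno' : ¬ Into k p u := fun h => hno ((into_iff.1 h).mono fun r hr =>
    rect_subset_polygon hk hr)
  obtain ⟨⟨i1, i2⟩, i3, i4⟩ := hin
  have him' : u.im = 0 → k.im ≤ p.im ∧ p.im ≤ k.im + 1 / 2 := fun _ =>
    ⟨i3.elim le_of_lt fun h => h.1.le, i4.elim le_of_lt fun h => h.1.le⟩
  -- A non-zero component of u has the sign of that component of w, so in this coordinate the ray
  -- along u enters the rectangle as the ray along w does.
  have key : u.re ≠ 0 → (k.re < p.re ∨ (k.re = p.re ∧ 0 < u.re)) ∧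
      (p.re < k.re + 1 ∨ (p.re = k.re + 1 ∧ u.re < 0)) := by
    intro h
    rcases h.lt_or_gt with h | h
    · exact ⟨Or.inl (i1.resolve_right fun h' => by linarith [hre.2.1 h]),
        i2.imp id fun h' => ⟨h'.1, h⟩⟩
    · exact ⟨i1.imp id fun h' => ⟨h'.1, h⟩,
        Or.inl (i2.resolve_right fun h' => by linarith [hre.1 h])⟩
  have key' : u.im ≠ 0 → (k.im < p.im ∨ (k.im = p.im ∧ 0 < u.im)) ∧
      (p.im < k.im + 1 / 2 ∨ (p.im = k.im + 1 / 2 ∧ u.im < 0)) := by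
    intro h
    rcases h.lt_or_gt with h | h
    · exact ⟨Or.inl (i3.resolve_right fun h' => by linarith [him.2.1 h]),
        i4.imp id fun h' => ⟨h'.1, h⟩⟩
    · exact ⟨i3.imp id fun h' => ⟨h'.1, h⟩,
        Or.inl (i4.resolve_right fun h' => by linarith [him.1 h])⟩
  constructor
  · by_contra! hcon
    obtain ⟨h1, h2⟩ := hcon
    by_cases h3 : u.im = 0
    · have h4 : 0 < u.re := lt_of_le_of_ne (h2 h3) h1.symm
      have h5 := key h1
      have h6 : p.im = k.im ∨ p.im = k.im + 1 / 2 := by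
        by_contra! h6
        exact hno' ⟨h5, Or.inl (lt_of_le_of_ne (him' h3).1 h6.1.symm),
          Or.inl (lt_of_le_of_ne (him' h3).2 h6.2)⟩
      exact hno (eventually_mem_of_right hk (h5.1.elim le_of_lt fun h => h.1.le)
        (h5.2.resolve_right fun h => by linarith) h6 h3 h4)
    · exact hno' ⟨key h1, key' h3⟩
  · intro h1 h2 h3 h4
    have h5 := key h2.ne
    have hw : w.im < 0 := him.2.2.2 h1 h4
    -- The wedge lies below its side u, so this side must be the top of the rectangle, where only 1
    -- + I is an obstruction to the left.
    have h6 : p.im = k.im + 1 / 2 := by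
      rcases i4 with h | h
      · exact absurd ⟨h5, Or.inl (i3.resolve_right fun h' => by linarith), Or.inl h⟩ hno'
      · exact h.1
    have hp : p = 1 + I := by
      by_contra hp
      exact hno (eventually_mem_of_left hk (h5.1.resolve_right fun h => by linarith)
        (h5.2.elim le_of_lt fun h => h.1.le) h6 h1 h2 hp)
    subst hp
    have hk' : k = ⟨0, 1 / 2⟩ := by
      rcases hk with ⟨a, b⟩ | ⟨a, b⟩
      · exact Complex.ext a b
      · simp [b] at h6
    subst hk'
    exact hlift

/-! ### Rigidity of affine homeomorphisms -/

lemma planeCLM_comp_wedge (M : Matrix (Fin 2) (Fin 2) ℝ) (u v : ℂ) :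
    (planeCLM M).comp (wedge u v) = wedge (planeCLM M u) (planeCLM M v) := by
  ext <;> simp [wedge_apply]

/-- Directions of singular boundaries of wedges are sent to such directions. -/
theorem image_direction {φ : Surface ≃ₜ Surface} {M : Matrix (Fin 2) (Fin 2) ℝ}
    (hφ : HasDerivative φ M) (hM : M.det ≠ 0) {z u v : ℂ} {r₀ s₀ : ℝ} (hr₀ : 0 < r₀) (hs₀ : 0 < s₀)
    (huv : u.re * v.im ≠ u.im * v.re)
    (hbox : ∀ r s : ℝ, r ∈ Ioo 0 r₀ → s ∈ Ioo 0 s₀ → z + r * u + s * v ∈ polygonInterior)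
    (hfreq : ∃ᶠ r : ℝ in 𝓝[>] 0, z + r * u ∉ polygon) :
    ((planeCLM M u).re = 0 ∨ ((planeCLM M u).im = 0 ∧ (planeCLM M u).re < 0)) ∧
    ((planeCLM M u).im = 0 → (planeCLM M u).re < 0 → (planeCLM M v).re = 0 →
      (planeCLM M v).im < 0 → ∀ r s : ℝ, r ∈ Ioo 0 r₀ → s ∈ Ioo 0 s₀ →
        1 + I + r * planeCLM M u + s * planeCLM M v ∈ rect ⟨0, 1 / 2⟩ →
        φ (pt (z + r * u + s * v)) = pt (1 + I + r * planeCLM M u + s * planeCLM M v)) := by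
  have h1 : LocAffine (fun x : ℝ × ℝ => pt (z + x.1 * u + x.2 * v)) (wedge u v)
      (Ioo 0 r₀ ×ˢ Ioo 0 s₀) := by
    have h := locAffine_pt.comp (wedge u v) z
    have e : (fun x : ℝ × ℝ => pt (z + x.1 * u + x.2 * v)) = fun x => pt (wedge u v x + z) := by
      funext x
      rw [wedge_apply]
      congr 1
      ring
    rw [e]
    refine h.mono ?_
    rintro ⟨r, s⟩ ⟨hr, hs⟩
    change wedge u v (r, s) + z ∈ polygonInterior
    rw [wedge_apply]
    convert hbox r s hr hs using 1
    simp only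
    ring
  have h2 := h1.map hφ
  rw [planeCLM_comp_wedge] at h2
  refine IsSingular.direction hr₀ hs₀ ?_ h2 ?_
  · intro h
    apply huv
    rw [planeCLM_apply, planeCLM_apply] at h
    rw [Matrix.det_fin_two] at hM
    apply mul_left_cancel₀ hM
    linear_combination h
  -- A limit of the image wedge is pulled back by the inverse homeomorphism to a limit on the
  -- surface, which would put z + r u in the polygon.
  · refine (hfreq.and_eventually (Ioo_mem_nhdsGT hr₀)).mono ?_
    rintro r ⟨hr, hr'⟩ ⟨x, hx⟩
    apply hr
    have hx' := (φ.symm.continuous.tendsto x).comp hx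
    have hT : Tendsto (fun s : ℝ => z + r * u + s * v) (𝓝[>] 0) (𝓝 (z + r * u)) := by
      have : Tendsto (fun s : ℝ => z + r * u + s * v) (𝓝 0) (𝓝 (z + r * u + (0 : ℝ) * v)) :=
        Continuous.tendsto (by fun_prop) _
      simp only [ofReal_zero, zero_mul, add_zero] at this
      exact this.mono_left nhdsWithin_le_nhds
    refine (mem_polygon_of_tendsto ?_ hT (x := φ.symm x) ?_).1
    · filter_upwards [Ioo_mem_nhdsGT hs₀] with s hs using Or.inl (hbox r s hr' hs)
    · refine hx'.congr fun s => ?_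
      simp

lemma frequently_of_seq {P : ℝ → Prop} {c : ℝ} (hc : 0 < c) {m : ℕ → ℕ}
    (hm : Tendsto m atTop atTop) (h : ∀ n, P ((1 / 2) ^ m n * c)) : ∃ᶠ r in 𝓝[>] 0, P r := by
  have h1 : Tendsto (fun n => ((1 : ℝ) / 2) ^ m n * c) atTop (𝓝[>] 0) := by
    refine tendsto_nhdsWithin_iff.2 ⟨?_, Eventually.of_forall fun n => ?_⟩
    · have := ((tendsto_pow_atTop_nhds_zero_of_lt_one (by norm_num : (0 : ℝ) ≤ 1 / 2)
        (by norm_num)).comp hm).mul_const c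
      simpa using this
    · exact mul_pos (by positivity) hc
  exact h1.frequently (Eventually.of_forall h).frequently

/-- Vertices on the left side of the upper rectangle accumulate at (0, 2/3) from both directions,
those of even index from above and those of odd index from below. The bound 1/6 is the distance from
height 2/3 down to 1/2. -/
theorem preserves_vertical {φ : Surface ≃ₜ Surface} {M : Matrix (Fin 2) (Fin 2) ℝ}
    (hφ : HasDerivative φ M) (hM : M.det ≠ 0) : M 0 1 = 0 := by
  have h1 := (image_direction hφ hM (z := ⟨0, 2 / 3⟩) (u := I) (v := 1) (r₀ := 1 / 6) (s₀ := 1)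
    (by norm_num) (by norm_num) (by simp) ?_ ?_).1
  have h2 := (image_direction hφ hM (z := ⟨0, 2 / 3⟩) (u := -I) (v := 1) (r₀ := 1 / 6) (s₀ := 1)
    (by norm_num) (by norm_num) (by simp) ?_ ?_).1
  · simp only [planeCLM_apply] at h1 h2
    simp at h1 h2
    -- The images of I and -I are opposite, so they cannot both point left; hence one, and so both,
    -- are vertical.
    rcases h1 with h1 | h1
    · exact h1
    · rcases h2 with h2 | h2
      · exact h2
      · linarith
  · rintro r s ⟨hr, hr'⟩ ⟨hs, hs'⟩
    refine rect_subset (k := ⟨0, 1 / 2⟩) (Or.inl ⟨rfl, rfl⟩) ⟨⟨?_, ?_⟩, ?_, ?_⟩ <;> simp <;> linarith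
  · refine frequently_of_seq (c := 1 / 3) (by norm_num) (m := fun n => 2 * n + 1)
      (tendsto_atTop_mono (fun n => show n ≤ 2 * n + 1 by lia) tendsto_id) fun n => ?_
    have := left_notMem_of_eq (2 * n + 1) (Or.inr ⟨by simp, rfl⟩)
    have e : ∀ r : ℝ, (⟨0, 2 / 3⟩ : ℂ) + r * -I = ⟨0, 2 / 3 - r⟩ := fun r => by
      apply Complex.ext <;> simp
      ring
    rwa [e, mul_one_div]
  · rintro r s ⟨hr, hr'⟩ ⟨hs, hs'⟩
    refine rect_subset (k := ⟨0, 1 / 2⟩) (Or.inl ⟨rfl, rfl⟩) ⟨⟨?_, ?_⟩, ?_, ?_⟩ <;> simp <;> linarith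
  · refine frequently_of_seq (c := 1 / 12) (by norm_num) (m := fun n => 2 * n)
      (tendsto_atTop_mono (fun n => show n ≤ 2 * n by lia) tendsto_id) fun n => ?_
    have := left_notMem_of_eq (2 * n) (Or.inl ⟨by simp, rfl⟩)
    have e : ∀ r : ℝ, (⟨0, 2 / 3⟩ : ℂ) + r * I = ⟨0, 2 / 3 + r⟩ := fun r => by
      apply Complex.ext <;> simp
    rwa [e, mul_one_div]

/-- The derivative is diagonal, and if it preserves the upward direction then `φ` maps the corner
at `1 + I` to itself. -/
theorem diagonal_and_corner {φ : Surface ≃ₜ Surface} {M : Matrix (Fin 2) (Fin 2) ℝ}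
    (hφ : HasDerivative φ M) (hM : M.det ≠ 0) : M 0 1 = 0 ∧ M 1 0 = 0 ∧ 0 < M 0 0 ∧
      (0 < M 1 1 → ∀ r s : ℝ, 0 < r → r < 1 → 0 < s → s < 1 / 2 → M 0 0 * r < 1 →
        M 1 1 * s < 1 / 2 → φ (pt ⟨1 - r, 1 - s⟩) = pt ⟨1 - M 0 0 * r, 1 - M 1 1 * s⟩) := by
  have h0 := preserves_vertical hφ hM
  -- The vertices at distances (1/2)^n to the left of 1 + I make the top side a singular side of the
  -- sector spanned by -1 and -I.
  have h1 := image_direction hφ hM (z := 1 + I) (u := -1) (v := -I) (r₀ := 1) (s₀ := 1 / 2)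
    (by norm_num) (by norm_num) (by simp) ?_ ?_
  · simp only [planeCLM_apply] at h1
    simp only [neg_re, one_re, neg_im, one_im, I_re, I_im, h0] at h1
    simp only [mul_neg, mul_one, neg_zero, mul_zero, add_zero, zero_add, neg_eq_zero,
      Left.neg_neg_iff] at h1
    obtain ⟨h1, h2⟩ := h1
    rw [Matrix.det_fin_two, h0, zero_mul, sub_zero] at hM
    -- A vertical image of -1 would force `M 0 0 = 0`, which is excluded by `M 0 1 = 0` and the
    -- non-zero determinant.
    have h3 := h1.resolve_left (left_ne_zero_of_mul hM)
    refine ⟨h0, h3.1, h3.2, fun hd r s hr hr' hs hs' hr1 hs1 => ?_⟩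
    have h4 := h2 h3.1 h3.2 trivial hd r s ⟨hr, hr'⟩ ⟨hs, hs'⟩ ?_
    · convert h4 using 2
      · congr 1
        apply Complex.ext <;> simp <;> ring
      · apply Complex.ext <;> simp [h3.1] <;> ring
    · have := mul_pos h3.2 hr
      have := mul_pos hd hs
      refine ⟨⟨?_, ?_⟩, ?_, ?_⟩ <;> simp [h3.1] <;> linarith
  · rintro r s ⟨hr, hr'⟩ ⟨hs, hs'⟩
    refine rect_subset (k := ⟨0, 1 / 2⟩) (Or.inl ⟨rfl, rfl⟩) ⟨⟨?_, ?_⟩, ?_, ?_⟩ <;> simp <;> linarith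
  · refine frequently_of_seq (c := 1) (by norm_num) (m := id) tendsto_id fun n => ?_
    have := top_notMem_of_eq n (Or.inl rfl)
    have e : ∀ r : ℝ, 1 + I + (r : ℂ) * -1 = ⟨1 - r, 1⟩ := fun r => by
      apply Complex.ext <;> simp
      ring
    rwa [e, mul_one]

/-! ### The diagonal entries of the derivative -/

lemma tendsto_vertical (x a c : ℝ) :
    Tendsto (fun s : ℝ => (⟨x, a - c * s⟩ : ℂ)) (𝓝[>] 0) (𝓝 ⟨x, a⟩) := by
  have h : Tendsto (fun s : ℝ => (⟨x, a - c * s⟩ : ℂ)) (𝓝 0) (𝓝 ⟨x, a - c * 0⟩) := by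
    have : Continuous fun s : ℝ => (⟨x, a - c * s⟩ : ℂ) := by
      have e : (fun s : ℝ => (⟨x, a - c * s⟩ : ℂ)) = fun s : ℝ => (x : ℂ) + (a - c * s) * I := by
        funext s
        apply Complex.ext <;> simp
      rw [e]
      fun_prop
    exact this.tendsto 0
  rw [mul_zero, sub_zero] at h
  exact h.mono_left nhdsWithin_le_nhds

lemma upper_mem {x y : ℝ} (h1 : 0 < x) (h2 : x < 1) (h3 : 1 / 2 < y) (h4 : y < 1) :
    (⟨x, y⟩ : ℂ) ∈ polygonInterior := Or.inl (Or.inl ⟨⟨h1, h2⟩, h3, h4⟩)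

/-- φ fixes the corner 1 + I in the sense of `diagonal_and_corner`, so multiplication by a carries
distances of missing points on the top side to distances of missing points, as long as they stay
below 1. -/
theorem expansion_eq_zpow {φ : Surface ≃ₜ Surface} {M : Matrix (Fin 2) (Fin 2) ℝ}
    (hφ : HasDerivative φ M) (hM : M.det ≠ 0) (hd : 0 < M 1 1) : ∃ k : ℤ, M 0 0 = 2 ^ k := by
  obtain ⟨-, -, ha, hcor⟩ := diagonal_and_corner hφ hM
  have hcor := hcor hd
  set a := M 0 0
  set d := M 1 1
  -- If the image point is present, descending to it vertically and pulling back by φ shows that the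
  -- original point is present.
  have key : ∀ r : ℝ, 0 < r → r < 1 → a * r < 1 → (⟨1 - a * r, 1⟩ : ℂ) ∈ polygon →
      (⟨1 - r, 1⟩ : ℂ) ∈ polygon := by
    intro r hr hr' har hmem
    have hpos := mul_pos ha hr
    have hsm : ∀ᶠ s : ℝ in 𝓝[>] 0, 0 < s ∧ s < 1 / 2 ∧ 0 < d * s ∧ d * s < 1 / 2 := by
      filter_upwards [Ioo_mem_nhdsGT (show (0 : ℝ) < min (1 / 2) (1 / 2 / d) by positivity)]
        with s hs
      have := lt_min_iff.1 hs.2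
      rw [lt_div_iff₀ hd] at this
      exact ⟨hs.1, this.1, mul_pos hd hs.1, by linarith⟩
    have h1 : Tendsto (fun s : ℝ => pt ⟨1 - a * r, 1 - d * s⟩) (𝓝[>] 0)
        (𝓝 (pt ⟨1 - a * r, 1⟩)) := by
      refine (continuousOn_pt _ hmem).tendsto.comp
        (tendsto_nhdsWithin_iff.2 ⟨tendsto_vertical _ 1 d, ?_⟩)
      filter_upwards [hsm] with s hs
      exact Or.inl (upper_mem (by linarith) (by linarith) (by linarith) (by linarith))
    have h2 := (φ.symm.continuous.tendsto _).comp h1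
    refine (mem_polygon_of_tendsto (F := 𝓝[>] (0 : ℝ)) (f := fun s : ℝ => ⟨1 - r, 1 - 1 * s⟩)
      ?_ (tendsto_vertical _ 1 1) (h2.congr' ?_)).1
    · filter_upwards [hsm] with s hs
      exact Or.inl (upper_mem (by linarith) (by linarith) (by linarith) (by linarith))
    · filter_upwards [hsm] with s hs
      simp only [Function.comp_apply, one_mul]
      rw [← hcor r s hr hr' hs.1 hs.2.1 har hs.2.2.2]
      simp
  -- n is so large that (1/2)^n and its image a (1/2)^n both lie strictly within the top side of
  -- length 1.
  obtain ⟨n, hn⟩ := exists_pow_lt_of_lt_one (show 0 < min 1 (1 / a) by positivity)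
    (by norm_num : (1 : ℝ) / 2 < 1)
  have hn := lt_min_iff.1 hn
  rw [lt_div_iff₀ ha] at hn
  have hpos := dyadic_pos n
  have hanpos := mul_pos ha hpos.1
  have hno := mt (key ((1 / 2) ^ n) hpos.1 hn.1 (by linarith)) (top_notMem_of_eq n (Or.inl rfl))
  obtain ⟨m, hm1, hm2⟩ := exists_dyadic hanpos (by linarith)
  have hno' := mt (top_mem (z := ⟨1 - a * (1 / 2) ^ n, 1⟩) rfl) hno
  simp only [sub_sub_cancel] at hno'
  have hor : a * (1 / 2) ^ n = (1 / 2) ^ m ∨ a * (1 / 2) ^ n = (1 / 2) ^ m * (3 / 4) := by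
    by_contra! h
    exact hno' ⟨m, hm1, lt_of_le_of_ne hm2 h.1, h.2⟩
  rcases hor with h | h
  · refine ⟨n - m, ?_⟩
    have h2 : ∀ j : ℕ, ((1 : ℝ) / 2) ^ j = (2 ^ j)⁻¹ := by simp
    rw [h2, h2] at h
    rw [zpow_sub₀ (by norm_num), zpow_natCast, zpow_natCast]
    field_simp at h ⊢
    linarith
  -- The vertex at distance (3/4) (1/2)^n would go to distance (9/16) (1/2)^m. As 1/2 < 9/16 < 3/4,
  -- no vertex lies there.
  · exfalso
    have hmpos := dyadic_pos m
    have := mt (key ((1 / 2) ^ n * (3 / 4)) (by linarith) (by linarith) (by linarith))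
      (top_notMem_of_eq n (Or.inr rfl))
    refine this (top_mem rfl ⟨m, ?_, ?_, ?_⟩)
    · simp only; linarith
    · simp only; linarith
    · simp only; intro h; linarith

lemma central_mem {y : ℝ} (h1 : 0 < y) (h2 : y < 1) : (⟨1 / 4, y⟩ : ℂ) ∈ polygonInterior :=
  Or.inr ⟨⟨by norm_num, by norm_num⟩, h1, h2⟩

/-- The vertical saddle connection from `1 / 4 + I` to `1 / 4` cannot be shortened. -/
theorem one_le_of_unit_expansion {φ : Surface ≃ₜ Surface} {M : Matrix (Fin 2) (Fin 2) ℝ}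
    (hφ : HasDerivative φ M) (ha : M 0 0 = 1) (hd : 0 < M 1 1) (hM : M.det ≠ 0) :
    1 ≤ M 1 1 := by
  obtain ⟨h01, -, -, hcor⟩ := diagonal_and_corner hφ hM
  have hcor := hcor hd
  rw [ha] at hcor
  set d := M 1 1 with hdef
  by_contra! hlt
  -- One known value on the segment x = 1/4, from which its whole image is found by continuation
  -- down to height 0.
  have hs0 := hcor (3 / 4) (1 / 4) (by norm_num) (by norm_num) (by norm_num) (by norm_num)
    (by norm_num) (by linarith)
  let c : ℂ := ⟨1 / 4, 1⟩
  have hc : ∀ s : ℝ, ContinuousLinearMap.toSpanSingleton ℝ (-I) s + c = ⟨1 / 4, 1 - s⟩ := by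
    intro s
    apply Complex.ext <;> simp [c]
    ring
  have h1 : LocAffine (fun s : ℝ => pt (ContinuousLinearMap.toSpanSingleton ℝ (-I) s + c))
      (ContinuousLinearMap.toSpanSingleton ℝ (-I)) (Ioo 0 1) := by
    refine (locAffine_pt.comp (ContinuousLinearMap.toSpanSingleton ℝ (-I)) c).mono ?_
    intro s hs
    change _ + c ∈ polygonInterior
    rw [hc]
    exact central_mem (by linarith [hs.2]) (by linarith [hs.1])
  have h2 := h1.map hφ
  have h3 := (h1.comp (d • ContinuousLinearMap.id ℝ ℝ) 0).mono (K' := Ioo 0 1) (by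
    rintro s ⟨hs, hs'⟩
    refine ⟨?_, ?_⟩
    · simpa using mul_pos hd hs
    · simp only [smul_apply, ContinuousLinearMap.id_apply, smul_eq_mul, add_zero]
      nlinarith)
  have hL : (planeCLM M).comp (ContinuousLinearMap.toSpanSingleton ℝ (-I)) =
      (ContinuousLinearMap.toSpanSingleton ℝ (-I)).comp (d • ContinuousLinearMap.id ℝ ℝ) := by
    ext
    simp only [ContinuousLinearMap.comp_apply, ContinuousLinearMap.toSpanSingleton_apply,
      planeCLM_apply]
    apply Complex.ext <;> simp [h01, hdef]
  rw [hL] at h2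
  have heq := h2.eqOn h3 isOpen_Ioo isPreconnected_Ioo (z := 1 / 4) ⟨by norm_num, by norm_num⟩ (by
    simp only [hc, smul_apply, ContinuousLinearMap.id_apply, smul_eq_mul,
      add_zero]
    convert hs0 using 3 <;> norm_num)
  have hcont : ContinuousAt pt ⟨1 / 4, 1 - d⟩ :=
    locAffine_pt.continuousAt (central_mem (by linarith) (by linarith))
  have t1 : Tendsto (fun t : ℝ => pt ⟨1 / 4, (1 - d) - (-d) * t⟩) (𝓝[>] 0)
      (𝓝 (pt ⟨1 / 4, 1 - d⟩)) := hcont.tendsto.comp (tendsto_vertical _ _ _)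
  have t2 := (φ.symm.continuous.tendsto _).comp t1
  -- As the height t = 1 - s tends to 0, the image tends to the point (1/4, 1 - d), which is
  -- interior because 0 < d < 1. Pulling back would place the missing point 1/4 in the polygon.
  refine quarter_notMem (mem_polygon_of_tendsto (F := 𝓝[>] (0 : ℝ))
    (f := fun t : ℝ => ⟨1 / 4, 0 - (-1) * t⟩) ?_ (tendsto_vertical _ 0 (-1)) (t2.congr' ?_)).1
  · filter_upwards [Ioo_mem_nhdsGT (show (0 : ℝ) < 1 by norm_num)] with t ht
    exact Or.inl (central_mem (by linarith [ht.1]) (by linarith [ht.2]))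
  · filter_upwards [Ioo_mem_nhdsGT (show (0 : ℝ) < 1 by norm_num)] with t ht
    have := heq (x := 1 - t) ⟨by linarith [ht.2], by linarith [ht.1]⟩
    simp only [hc, smul_apply, ContinuousLinearMap.id_apply, smul_eq_mul,
      add_zero] at this
    rw [Function.comp_apply, Homeomorph.symm_apply_eq]
    convert this.symm using 3
    · ring
    · congr 1; ring

/-! ### Faithfulness of the derivative -/

lemma HasDerivative.inv {φ : Surface ≃ₜ Surface} {M : Matrix (Fin 2) (Fin 2) ℝ}
    (hφ : φ ∈ affineGroup Surface) (h : HasDerivative φ M) : HasDerivative φ⁻¹ M⁻¹ := by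
  obtain ⟨N, hN⟩ := exists_hasDerivative ((affineGroup Surface).inv_mem hφ)
  have h1 := h.comp hN
  rw [mul_inv_cancel] at h1
  rw [Matrix.inv_eq_right_inv (h1.unique hasDerivative_one)]
  exact hN

/-- An affine homeomorphism with derivative `1` that fixes a point is the identity. -/
lemma eq_one_of_fixed {φ : Surface ≃ₜ Surface} (hφ : HasDerivative φ 1) {x : Surface}
    (hx : φ x = x) : φ = 1 := by
  have hopen : IsOpen {y | φ y = y} := by
    rw [isOpen_iff_mem_nhds]
    intro y hy
    have hy : φ y = y := hy
    obtain ⟨e, he, hye⟩ := exists_canonicalChart y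
    obtain ⟨c, hc⟩ := hφ e he e he y hye (by rwa [hy])
    have h0 := hc.self_of_nhds
    have hid : ∀ z, planeMap 1 z = z := fun z => by simp [planeMap]
    rw [hy, hid] at h0
    have hc0 : c = 0 := by linear_combination -h0
    filter_upwards [hc, e.open_source.mem_nhds hye,
      φ.continuous.continuousAt.eventually (e.open_source.mem_nhds (by rwa [hy]))] with z h1 h2 h3
    exact e.injOn h3 h2 (by rw [h1, hid, hc0, add_zero])
  have hclosed : IsClosed {y | φ y = y} := isClosed_eq φ.continuous continuous_id
  have := IsClopen.eq_univ ⟨hclosed, hopen⟩ ⟨x, hx⟩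
  ext y
  have hy : y ∈ {y | φ y = y} := this ▸ mem_univ y
  exact hy

/-- With derivative 1 the corner formula fixes the points near 1 + I; the values r = 1/2 and s = 1/4
pick one of them. -/
theorem eq_one_of_hasDerivative_one {φ : Surface ≃ₜ Surface} (hφ : HasDerivative φ 1) :
    φ = 1 := by
  obtain ⟨-, -, -, h⟩ := diagonal_and_corner hφ (by simp)
  refine eq_one_of_fixed hφ (h (by simp) (1 / 2) (1 / 4) ?_ ?_ ?_ ?_ ?_ ?_ |>.trans ?_) <;>
    norm_num

/-- The inverse has unit expansion as well, so both `M 1 1` and its inverse are at least 1. -/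
theorem eq_one_of_unit_expansion {φ : Surface ≃ₜ Surface} {M : Matrix (Fin 2) (Fin 2) ℝ}
    (hφ' : φ ∈ affineGroup Surface) (hφ : HasDerivative φ M) (ha : M 0 0 = 1)
    (hd : 0 < M 1 1) : φ = 1 := by
  have hM : M.det ≠ 0 := (hφ.isUnit_det hφ').ne_zero
  obtain ⟨h01, h10, -, -⟩ := diagonal_and_corner hφ hM
  have h1 := one_le_of_unit_expansion hφ ha hd hM
  have hM' : M = !![1, 0; 0, M 1 1] := by
    ext i j
    fin_cases i <;> fin_cases j <;> simp [ha, h01, h10]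
  have hinv : M⁻¹ = !![1, 0; 0, (M 1 1)⁻¹] := by
    apply Matrix.inv_eq_right_inv
    rw [hM']
    ext i j
    fin_cases i <;> fin_cases j <;> simp [hd.ne']
  have h2 := hφ.inv hφ'
  rw [hinv] at h2
  have h3 := one_le_of_unit_expansion h2 (by simp) (by simpa using hd)
    (by simp [Matrix.det_fin_two, hd.ne'])
  have h4 : M 1 1 = 1 := by
    simp at h3
    exact le_antisymm ((one_le_inv₀ hd).1 h3) h1
  refine eq_one_of_hasDerivative_one ?_
  convert hφ
  rw [hM', h4]
  ext i j
  fin_cases i <;> fin_cases j <;> simp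

/-! ### Piecewise affine maps of the polygon -/

/-- `a` and `b` represent the same point of the surface. -/
def SamePoint (a b : ℂ) : Prop := a ∈ polygon ∧ b ∈ polygon ∧ pt a = pt b

lemma Glued.samePoint {a b : ℂ} (h : Glued a b) : SamePoint a b :=
  ⟨h.left_mem, h.right_mem, h.pt_eq⟩

lemma SamePoint.symm {a b : ℂ} (h : SamePoint a b) : SamePoint b a := ⟨h.2.1, h.1, h.2.2.symm⟩

/-- The relation `R` is a piecewise affine map of the polygon with linear part `M` that is
compatible with the identifications. -/
structure IsPiecewise (R : ℂ → ℂ → Prop) (M : Matrix (Fin 2) (Fin 2) ℝ) : Prop where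
  pieces : ∃ (n : ℕ) (P : Fin n → Set ℂ) (c : Fin n → ℂ), (∀ i, IsClosed (P i)) ∧
    ∀ z a, R z a ↔ ∃ i, z ∈ P i ∧ a = planeCLM M z + c i
  total : ∀ z ∈ polygon, ∃ a, R z a
  interior : ∀ z ∈ polygonInterior, ∀ a b, R z a → R z b → SamePoint a b
  glued : ∀ z w, Glued z w → ∀ a b, R z a → R w b → SamePoint a b

namespace IsPiecewise

variable {R : ℂ → ℂ → Prop} {M : Matrix (Fin 2) (Fin 2) ℝ}

/-- For a boundary point, any two values are compared through a value at its partner. -/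
lemma samePoint (h : IsPiecewise R M) {z a b : ℂ} (hz : z ∈ polygon) (ha : R z a) (hb : R z b) :
    SamePoint a b := by
  rcases id hz with hz' | ⟨w, hw | hw⟩
  · exact h.interior z hz' a b ha hb
  · obtain ⟨d, hd⟩ := h.total w hw.right_mem
    have h1 := h.glued z w hw a d ha hd
    have h2 := h.glued z w hw b d hb hd
    exact ⟨h1.1, h2.1, h1.2.2.trans h2.2.2.symm⟩
  · obtain ⟨d, hd⟩ := h.total w hw.left_mem
    have h1 := h.glued w z hw d a hd ha
    have h2 := h.glued w z hw d b hd hb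
    exact ⟨h1.2.1, h2.2.1, h1.2.2.symm.trans h2.2.2⟩

/-- The choice of values is immaterial on the surface, and continuity follows by pasting over the
finite closed cover by pieces. -/
theorem exists_map (h : IsPiecewise R M) : ∃ F : Surface → Surface, Continuous F ∧
    ∀ z ∈ polygon, ∀ a, R z a → a ∈ polygon ∧ F (pt z) = pt a := by
  obtain ⟨n, P, c, hP, hR⟩ := h.pieces
  choose f hf using h.total
  let F : Surface → Surface := Quot.lift (fun p : polygon => pt (f p p.2))
    (fun p q hpq => (h.glued _ _ hpq _ _ (hf p p.2) (hf q q.2)).2.2)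
  have hF : ∀ z ∈ polygon, ∀ a, R z a → a ∈ polygon ∧ F (pt z) = pt a := by
    intro z hz a ha
    have h1 := h.samePoint hz (hf z hz) ha
    refine ⟨h1.2.1, ?_⟩
    rw [pt_of_mem hz]
    exact h1.2.2
  refine ⟨F, ?_, hF⟩
  rw [isQuotientMap_proj.continuous_iff]
  refine (locallyFinite_of_finite fun i => ((↑) : polygon → ℂ) ⁻¹' P i).continuous ?_ ?_ ?_
  · rw [eq_univ_iff_forall]
    intro p
    obtain ⟨i, hi, -⟩ := (hR _ _).1 (hf p p.2)
    exact mem_iUnion.2 ⟨i, hi⟩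
  · exact fun i => (hP i).preimage continuous_subtype_val
  · intro i p hp
    have hmem : ∀ q : polygon, (q : ℂ) ∈ P i →
        planeCLM M q + c i ∈ polygon ∧ F (pt q) = pt (planeCLM M q + c i) :=
      fun q hq => hF q q.2 _ ((hR _ _).2 ⟨i, hq, rfl⟩)
    have h1 : ContinuousWithinAt (fun q : polygon => pt (planeCLM M q + c i))
        (((↑) : polygon → ℂ) ⁻¹' P i) p := by
      have h2 : ContinuousWithinAt (fun q : polygon => planeCLM M q + c i)
          (((↑) : polygon → ℂ) ⁻¹' P i) p := Continuous.continuousWithinAt (by fun_prop)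
      exact ContinuousWithinAt.comp (g := pt) (f := fun q : polygon => planeCLM M q + c i)
        (t := polygon) (continuousOn_pt _ (hmem p hp).1) h2
        fun q hq => (hmem q hq).1
    refine h1.congr (fun q hq => ?_) ?_
    · rw [← (hmem q hq).2, pt_coe]; rfl
    · rw [← (hmem p hp).2, pt_coe]; rfl

/-- Pieces that avoid p stay away from a neighbourhood of p, as they are closed. On those through p
the map has linear part M, and the additive constants agree because all the expressions have the
same value at p. -/
theorem hasDerivative (h : IsPiecewise R M) {φ : Surface ≃ₜ Surface}
    (hφ : ∀ z ∈ polygon, ∀ a, R z a → a ∈ polygon ∧ φ (pt z) = pt a) : HasDerivative φ M := by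
  obtain ⟨n, P, c, hP, hR⟩ := h.pieces
  intro e he e' he' x hx hx'
  refine ⟨e' (φ x) - planeMap M (e x), ?_⟩
  let W : Set Surface := {y | y ∈ e.source ∧ φ y ∈ e'.source ∧
    e' (φ y) = planeMap M (e y) + (e' (φ x) - planeMap M (e x))}
  have hW : IsOpen W := by
    rw [← isQuotientMap_proj.isOpen_preimage, isOpen_iff_mem_nhds]
    rintro p ⟨h1, h2, h3⟩
    have hcont : ContinuousAt (fun q => φ (proj q)) p :=
      (φ.continuous.comp isQuotientMap_proj.continuous).continuousAt
    have hpiece : ∀ i, ∀ᶠ q : polygon in 𝓝 p, (q : ℂ) ∈ P i →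
        e' (φ (proj q)) = planeMap M (e (proj q)) + (e' (φ x) - planeMap M (e x)) := by
      intro i
      by_cases hpi : (p : ℂ) ∈ P i
      swap
      · have : ∀ᶠ q : polygon in 𝓝 p, (q : ℂ) ∈ (P i)ᶜ :=
          continuous_subtype_val.continuousAt.eventually ((hP i).isOpen_compl.mem_nhds hpi)
        filter_upwards [this] with q hq hq' using absurd hq' hq
      have hmem : ∀ q : polygon, (q : ℂ) ∈ P i → ∃ h : planeCLM M q + c i ∈ polygon,
          φ (proj q) = proj ⟨_, h⟩ := by
        intro q hq
        obtain ⟨m1, m2⟩ := hφ q q.2 _ ((hR _ _).2 ⟨i, hq, rfl⟩)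
        exact ⟨m1, by rw [← pt_coe, m2, pt_of_mem m1]⟩
      obtain ⟨m1, m2⟩ := hmem p hpi
      rw [m2] at h2
      obtain ⟨d, hd⟩ := he p h1
      obtain ⟨d', hd'⟩ := he' _ h2
      have h4 := hd.self_of_nhds
      have h5 := hd'.self_of_nhds
      rw [nhds_subtype_eq_comap] at hd'
      have hd' := eventually_comap.1 hd'
      have hlin : ContinuousAt (fun q : polygon => planeCLM M q + c i) p := by fun_prop
      filter_upwards [hd, hlin.eventually hd'] with q g1 g2 hq
      obtain ⟨k1, k2⟩ := hmem q hq
      rw [k2, g2 ⟨_, k1⟩ rfl, g1, map_add]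
      rw [m2, h4, h5, map_add] at h3
      change planeMap M q + c i + d' = _
      change planeMap M p + c i + d' = _ at h3
      linear_combination h3
    filter_upwards [eventually_all.2 hpiece,
      isQuotientMap_proj.continuous.continuousAt.eventually (e.open_source.mem_nhds h1),
      hcont.eventually (e'.open_source.mem_nhds h2)] with q g1 g2 g3
    refine ⟨g2, g3, ?_⟩
    obtain ⟨a, ha⟩ := h.total q q.2
    obtain ⟨i, hi, -⟩ := (hR _ _).1 ha
    exact g1 i hi
  filter_upwards [hW.mem_nhds ⟨hx, hx', by ring⟩] with y hy using hy.2.2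

/-- A piecewise affine bijection of the polygon induces an affine homeomorphism. -/
theorem exists_homeomorph {N : Matrix (Fin 2) (Fin 2) ℝ} (h : IsPiecewise R M)
    (h' : IsPiecewise (fun a z => R z a) N) : ∃ φ : Surface ≃ₜ Surface, HasDerivative φ M ∧
      ∀ z ∈ polygon, ∀ a, R z a → a ∈ polygon ∧ φ (pt z) = pt a := by
  obtain ⟨F, hF, hF'⟩ := h.exists_map
  obtain ⟨G, hG, hG'⟩ := h'.exists_map
  let φ : Surface ≃ₜ Surface :=
    { toFun := F
      invFun := G
      left_inv := by
        intro x
        obtain ⟨z, hz, rfl⟩ := exists_pt x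
        obtain ⟨a, ha⟩ := h.total z hz
        obtain ⟨h1, h2⟩ := hF' z hz a ha
        rw [h2, (hG' a h1 z ha).2]
      right_inv := by
        intro x
        obtain ⟨z, hz, rfl⟩ := exists_pt x
        obtain ⟨a, ha⟩ := h'.total z hz
        obtain ⟨h1, h2⟩ := hG' z hz a ha
        rw [h2, (hF' a h1 z ha).2]
      continuous_toFun := hF
      continuous_invFun := hG }
  exact ⟨φ, h.hasDerivative (φ := φ) hF', hF'⟩

end IsPiecewise

/-! ### Gluings in coordinates -/

section Coordinates

variable {z w : ℂ} (n : ℕ) (t : ℝ)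

lemma samePoint_C₁ (h0 : 0 < t) (h1 : t < (1 / 2) ^ n / 4) (h2 : z.re = 1 - (1 / 2) ^ n + t)
    (h3 : z.im = 1) (h4 : w.re = 1 / 2 - (1 / 2) ^ n * (3 / 4) + t) (h5 : w.im = 0) :
    SamePoint z w :=
  Glued.samePoint ⟨Edge.C₁ n, t, h0, h1, by apply Complex.ext <;> simp [Edge.start₁, Edge.dir, *],
    by apply Complex.ext <;> simp [Edge.start₂, Edge.dir, *]⟩

lemma samePoint_C₂ (h0 : 0 < t) (h1 : t < (1 / 2) ^ n / 4)
    (h2 : z.re = 1 - (1 / 2) ^ n * (3 / 4) + t)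
    (h3 : z.im = 1) (h4 : w.re = 1 / 2 - (1 / 2) ^ n + t) (h5 : w.im = 0) :
    SamePoint z w :=
  Glued.samePoint ⟨Edge.C₂ n, t, h0, h1, by apply Complex.ext <;> simp [Edge.start₁, Edge.dir, *],
    by apply Complex.ext <;> simp [Edge.start₂, Edge.dir, *]⟩

lemma samePoint_S (h0 : 0 < t) (h1 : t < 1 / 2) (h2 : z.re = -1 / 2 + t)
    (h3 : z.im = 1 / 2) (h4 : w.re = 1 / 2 + t) (h5 : w.im = 1 / 2) :
    SamePoint z w :=
  Glued.samePoint ⟨Edge.S, t, h0, h1, by apply Complex.ext <;> simp [Edge.start₁, Edge.dir, *],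
    by apply Complex.ext <;> simp [Edge.start₂, Edge.dir, *]⟩

lemma samePoint_A_even (hn : Even n) (h0 : 0 < t) (h1 : t < (1 / 2) ^ n / 4) (h2 : z.re = 1 / 2)
    (h3 : z.im = (1 / 2) ^ n / 4 + t) (h4 : w.re = 0)
    (h5 : w.im = 2 / 3 + (1 / 2) ^ n / 12 + t) : SamePoint z w :=
  Glued.samePoint ⟨Edge.A n, t, h0, h1,
    by apply Complex.ext <;> simp [Edge.start₁, Edge.dir, *],
    by apply Complex.ext <;> simp [Edge.start₂, Edge.dir, *]⟩

lemma samePoint_A_odd (hn : ¬ Even n) (h0 : 0 < t) (h1 : t < (1 / 2) ^ n / 4) (h2 : z.re = 1)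
    (h3 : z.im = 1 - (1 / 2) ^ n / 2 + t) (h4 : w.re = 0)
    (h5 : w.im = 2 / 3 - (1 / 2) ^ n / 3 + t) : SamePoint z w :=
  Glued.samePoint ⟨Edge.A n, t, h0, h1,
    by apply Complex.ext <;> simp [Edge.start₁, Edge.dir, h2, h3, hn],
    by apply Complex.ext <;> simp [Edge.start₂, Edge.dir, h4, h5, hn]⟩

lemma samePoint_B_even (hn : Even n) (h0 : 0 < t) (h1 : t < (1 / 2) ^ n / 4) (h2 : z.re = 1)
    (h3 : z.im = 1 - (1 / 2) ^ n / 2 + t) (h4 : w.re = -1 / 2)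
    (h5 : w.im = 1 / 3 - (1 / 2) ^ n / 3 + t) : SamePoint z w :=
  Glued.samePoint ⟨Edge.B n, t, h0, h1,
    by apply Complex.ext <;> simp [Edge.start₁, Edge.dir, *],
    by apply Complex.ext <;> simp [Edge.start₂, Edge.dir, *]⟩

lemma samePoint_B_odd (hn : ¬ Even n) (h0 : 0 < t) (h1 : t < (1 / 2) ^ n / 4) (h2 : z.re = 1 / 2)
    (h3 : z.im = (1 / 2) ^ n / 4 + t) (h4 : w.re = -1 / 2)
    (h5 : w.im = 1 / 3 + (1 / 2) ^ n / 12 + t) : SamePoint z w :=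
  Glued.samePoint ⟨Edge.B n, t, h0, h1,
    by apply Complex.ext <;> simp [Edge.start₁, Edge.dir, h2, h3, hn],
    by apply Complex.ext <;> simp [Edge.start₂, Edge.dir, h4, h5, hn]⟩

end Coordinates

lemma samePoint_of_eq {z w : ℂ} (h : z ∈ polygonInterior) (h1 : w.re = z.re) (h2 : w.im = z.im) :
    SamePoint z w := by
  obtain rfl : w = z := Complex.ext h1 h2
  exact ⟨Or.inl h, Or.inl h, rfl⟩

lemma mem_upper {z : ℂ} (h1 : 0 < z.re) (h2 : z.re < 1) (h3 : 1 / 2 < z.im) (h4 : z.im < 1) :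
    z ∈ polygonInterior := Or.inl (Or.inl ⟨⟨h1, h2⟩, h3, h4⟩)

lemma mem_lower {z : ℂ} (h1 : -1 / 2 < z.re) (h2 : z.re < 1 / 2) (h3 : 0 < z.im)
    (h4 : z.im < 1 / 2) : z ∈ polygonInterior := Or.inl (Or.inr ⟨⟨h1, h2⟩, h3, h4⟩)

lemma mem_central {z : ℂ} (h1 : 0 < z.re) (h2 : z.re < 1 / 2) (h3 : 0 < z.im) (h4 : z.im < 1) :
    z ∈ polygonInterior := Or.inr ⟨⟨h1, h2⟩, h3, h4⟩

/-- Coordinates of interior points. -/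
lemma interior_cases {z : ℂ} (h : z ∈ polygonInterior) :
    (0 < z.re ∧ z.re < 1 ∧ 1 / 2 < z.im ∧ z.im < 1) ∨
    (-1 / 2 < z.re ∧ z.re < 1 / 2 ∧ 0 < z.im ∧ z.im < 1 / 2) ∨
    (0 < z.re ∧ z.re < 1 / 2 ∧ z.im = 1 / 2) := by
  rcases h with (⟨⟨a, b⟩, c, d⟩ | ⟨⟨a, b⟩, c, d⟩) | ⟨⟨a, b⟩, c, d⟩
  · exact Or.inl ⟨a, b, c, d⟩
  · exact Or.inr (Or.inl ⟨a, b, c, d⟩)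
  · rcases lt_trichotomy z.im (1 / 2) with h | h | h
    · exact Or.inr (Or.inl ⟨by linarith, b, c, h⟩)
    · exact Or.inr (Or.inr ⟨a, b, h⟩)
    · exact Or.inl ⟨a, by linarith, h, d⟩

/-! ### The maps `ψ` and `ρ` -/

lemma exists_boxes {n : ℕ} {R : ℂ → ℂ → Prop} {M : Matrix (Fin 2) (Fin 2) ℝ}
    (l r b t : Fin n → ℝ) (c : Fin n → ℂ)
    (h : ∀ z a, R z a ↔ ∃ i, z ∈ Icc (l i) (r i) ×ℂ Icc (b i) (t i) ∧ a = planeCLM M z + c i) :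
    ∃ (n : ℕ) (P : Fin n → Set ℂ) (c : Fin n → ℂ), (∀ i, IsClosed (P i)) ∧
      ∀ z a, R z a ↔ ∃ i, z ∈ P i ∧ a = planeCLM M z + c i :=
  ⟨n, fun i => Icc (l i) (r i) ×ℂ Icc (b i) (t i), c,
    fun _ => isClosed_Icc.reProdIm isClosed_Icc, h⟩

/-- The graph of `ψ_∞` on the polygon. -/
def PsiGraph (z a : ℂ) : Prop :=
  (0 ≤ z.re ∧ z.re ≤ 1 / 2 ∧ 0 ≤ z.im ∧ z.im ≤ 1 ∧ a.re = 2 * z.re - 1 / 2 ∧ a.im = z.im / 2) ∨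
  (-1 / 2 ≤ z.re ∧ z.re ≤ 0 ∧ 0 ≤ z.im ∧ z.im ≤ 1 / 2 ∧ a.re = 2 * z.re + 1 ∧
    a.im = z.im / 2 + 1 / 2) ∨
  (1 / 2 ≤ z.re ∧ z.re ≤ 1 ∧ 1 / 2 ≤ z.im ∧ z.im ≤ 1 ∧ a.re = 2 * z.re - 1 ∧
    a.im = z.im / 2 + 1 / 2)

/-- The graph of `ρ_∞` on the polygon. -/
def RhoGraph (z a : ℂ) : Prop :=
  (-1 / 2 ≤ z.re ∧ z.re ≤ 1 / 2 ∧ 0 ≤ z.im ∧ z.im ≤ 1 / 2 ∧ a.re = z.re + 1 / 2 ∧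
    a.im = 1 - z.im) ∨
  (0 ≤ z.re ∧ z.re ≤ 1 ∧ 1 / 2 ≤ z.im ∧ z.im ≤ 1 ∧ a.re = z.re - 1 / 2 ∧ a.im = 1 - z.im)

lemma psiGraph_pieces (z a : ℂ) : PsiGraph z a ↔ ∃ i : Fin 3,
    z ∈ Icc ((![0, -1 / 2, 1 / 2] : Fin 3 → ℝ) i) ((![1 / 2, 0, 1] : Fin 3 → ℝ) i) ×ℂ
      Icc ((![0, 0, 1 / 2] : Fin 3 → ℝ) i) ((![1, 1 / 2, 1] : Fin 3 → ℝ) i) ∧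
    a = planeCLM !![2, 0; 0, 1 / 2] z +
      (![⟨-1 / 2, 0⟩, ⟨1, 1 / 2⟩, ⟨-1, 1 / 2⟩] : Fin 3 → ℂ) i := by
  simp only [Fin.exists_fin_succ, planeCLM_apply, mem_reProdIm, mem_Icc, Complex.ext_iff]
  simp [PsiGraph, and_assoc, sub_eq_add_neg, div_eq_inv_mul]

/-- The images of the three pieces are the lower rectangle and the lower and upper halves of the
upper rectangle, cut at height 3/4. -/
lemma psiGraph_pieces_inv (z a : ℂ) : PsiGraph a z ↔ ∃ i : Fin 3,
    z ∈ Icc ((![-1 / 2, 0, 0] : Fin 3 → ℝ) i) ((![1 / 2, 1, 1] : Fin 3 → ℝ) i) ×ℂ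
      Icc ((![0, 1 / 2, 3 / 4] : Fin 3 → ℝ) i) ((![1 / 2, 3 / 4, 1] : Fin 3 → ℝ) i) ∧
    a = planeCLM !![1 / 2, 0; 0, 2] z +
      (![⟨1 / 4, 0⟩, ⟨-1 / 2, -1⟩, ⟨1 / 2, -1⟩] : Fin 3 → ℂ) i := by
  simp only [Fin.exists_fin_succ, planeCLM_apply, mem_reProdIm, mem_Icc, Complex.ext_iff]
  simp only [PsiGraph, Matrix.cons_val_zero, Matrix.cons_val_succ, Matrix.of_apply,
    Matrix.cons_val_one, Matrix.cons_val_fin_one, add_re, add_im, IsEmpty.exists_iff, or_false,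
    Fin.succ_zero_eq_one, and_assoc]
  refine or_congr ?_ (or_congr ?_ ?_) <;>
    (constructor <;> rintro ⟨h1, h2, h3, h4, h5, h6⟩ <;>
      refine ⟨?_, ?_, ?_, ?_, ?_, ?_⟩ <;> linarith)

lemma rhoGraph_pieces (z a : ℂ) : RhoGraph z a ↔ ∃ i : Fin 2,
    z ∈ Icc ((![-1 / 2, 0] : Fin 2 → ℝ) i) ((![1 / 2, 1] : Fin 2 → ℝ) i) ×ℂ
      Icc ((![0, 1 / 2] : Fin 2 → ℝ) i) ((![1 / 2, 1] : Fin 2 → ℝ) i) ∧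
    a = planeCLM !![1, 0; 0, -1] z + (![⟨1 / 2, 1⟩, ⟨-1 / 2, 1⟩] : Fin 2 → ℂ) i := by
  simp only [Fin.exists_fin_succ, planeCLM_apply, mem_reProdIm, mem_Icc, Complex.ext_iff]
  simp only [RhoGraph, Matrix.cons_val_zero, Matrix.cons_val_succ, Matrix.of_apply,
    Matrix.cons_val_one, Matrix.cons_val_fin_one, add_re, add_im, IsEmpty.exists_iff, or_false,
    Fin.succ_zero_eq_one, and_assoc]
  refine or_congr ?_ ?_ <;>
    (constructor <;> rintro ⟨h1, h2, h3, h4, h5, h6⟩ <;>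
      refine ⟨?_, ?_, ?_, ?_, ?_, ?_⟩ <;> linarith)

lemma rhoGraph_symm (z a : ℂ) : RhoGraph z a ↔ RhoGraph a z := by
  unfold RhoGraph
  constructor
  all_goals
    rintro (⟨h1, h2, h3, h4, h5, h6⟩ | ⟨h1, h2, h3, h4, h5, h6⟩)
    · exact Or.inr ⟨by linarith, by linarith, by linarith, by linarith, by linarith, by linarith⟩
    · exact Or.inl ⟨by linarith, by linarith, by linarith, by linarith, by linarith, by linarith⟩

/-- Comparing a value with itself still requires its membership in the polygon, which is borrowed
from a known pair. -/
lemma samePoint_refl_of {a b c : ℂ} (h : SamePoint a b) (hc : c.re = a.re) (hc' : c.im = a.im) :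
    SamePoint a c := by
  obtain rfl : c = a := Complex.ext hc hc'
  exact ⟨h.1, h.1, rfl⟩

set_option maxHeartbeats 1000000 in
-- The common segment at height 1/2 is sent to both edges of `S`, and `S` is sent to that segment.
-- The reflection reverses vertical edges, so t becomes (1/2)^n / 4 - t when `A n` and `B n` are
-- exchanged.
lemma isPiecewise_rho : IsPiecewise RhoGraph !![1, 0; 0, -1] where
  pieces := exists_boxes _ _ _ _ _ rhoGraph_pieces
  total z hz := by
    rcases polygon_subset hz with ⟨h1, h2, h3, h4⟩ | ⟨h1, h2, h3, h4⟩
    · exact ⟨⟨z.re - 1 / 2, 1 - z.im⟩, Or.inr ⟨h1, h2, h3, h4, rfl, rfl⟩⟩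
    · exact ⟨⟨z.re + 1 / 2, 1 - z.im⟩, Or.inl ⟨h1, h2, h3, h4, rfl, rfl⟩⟩
  interior z hz a b ha hb := by
    rcases interior_cases hz with ⟨h1, h2, h3, h4⟩ | ⟨h1, h2, h3, h4⟩ | ⟨h1, h2, h3⟩
    · rcases ha with ⟨-, -, -, a1, a2, a3⟩ | ⟨-, -, -, a1, a2, a3⟩
      · linarith
      rcases hb with ⟨-, -, -, b1, b2, b3⟩ | ⟨-, -, -, b1, b2, b3⟩
      · linarith
      exact samePoint_of_eq (mem_lower (by linarith) (by linarith) (by linarith) (by linarith))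
        (by linarith) (by linarith)
    · rcases ha with ⟨-, -, a1, -, a2, a3⟩ | ⟨-, -, a1, -, a2, a3⟩
      swap
      · linarith
      rcases hb with ⟨-, -, b1, -, b2, b3⟩ | ⟨-, -, b1, -, b2, b3⟩
      swap
      · linarith
      exact samePoint_of_eq (mem_upper (by linarith) (by linarith) (by linarith) (by linarith))
        (by linarith) (by linarith)
    · have key : ∀ a b : ℂ, a.re = z.re + 1 / 2 → a.im = 1 - z.im → b.re = z.re - 1 / 2 →
          b.im = 1 - z.im → SamePoint b a := fun a b a1 a2 b1 b2 =>
        samePoint_S z.re h1 h2 (by linarith) (by linarith) (by linarith) (by linarith)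
      rcases ha with ⟨-, -, -, -, a2, a3⟩ | ⟨-, -, -, -, a2, a3⟩ <;>
        rcases hb with ⟨-, -, -, -, b2, b3⟩ | ⟨-, -, -, -, b2, b3⟩
      · exact samePoint_refl_of (key a ⟨z.re - 1 / 2, 1 - z.im⟩ a2 a3 rfl rfl).symm
          (by linarith) (by linarith)
      · exact (key a b a2 a3 b2 b3).symm
      · exact key b a b2 b3 a2 a3
      · exact samePoint_refl_of (key ⟨z.re + 1 / 2, 1 - z.im⟩ a rfl rfl a2 a3)
          (by linarith) (by linarith)
  glued z w h a b ha hb := by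
    rcases glued_cases h with ⟨n, t, h0, h1, h2, h3, h4, h5⟩ | ⟨n, t, h0, h1, h2, h3, h4, h5⟩ |
      ⟨t, h0, h1, h2, h3, h4, h5⟩ | ⟨n, hn, t, h0, h1, h2, h3, h4, h5⟩ |
      ⟨n, hn, t, h0, h1, h2, h3, h4, h5⟩ | ⟨n, hn, t, h0, h1, h2, h3, h4, h5⟩ |
      ⟨n, hn, t, h0, h1, h2, h3, h4, h5⟩
    all_goals
      try have hd := dyadic_pos n
      try have hd1 := dyadic_odd hn
      rcases ha with ⟨a1, a2, a3, a4, a5, a6⟩ | ⟨a1, a2, a3, a4, a5, a6⟩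
      all_goals
        try (exfalso; linarith)
      rcases hb with ⟨b1, b2, b3, b4, b5, b6⟩ | ⟨b1, b2, b3, b4, b5, b6⟩
      all_goals
        try (exfalso; linarith)
    · exact (samePoint_C₂ n t h0 h1 (by linarith) (by linarith) (by linarith) (by linarith)).symm
    · exact (samePoint_C₁ n t h0 h1 (by linarith) (by linarith) (by linarith) (by linarith)).symm
    · exact samePoint_of_eq (mem_central (by linarith) (by linarith) (by linarith) (by linarith))
        (by linarith) (by linarith)
    · exact samePoint_B_even n ((1 / 2) ^ n / 4 - t) hn (by linarith) (by linarith) (by linarith)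
        (by linarith) (by linarith) (by linarith)
    · exact samePoint_B_odd n ((1 / 2) ^ n / 4 - t) hn (by linarith) (by linarith) (by linarith)
        (by linarith) (by linarith) (by linarith)
    · exact samePoint_A_even n ((1 / 2) ^ n / 4 - t) hn (by linarith) (by linarith) (by linarith)
        (by linarith) (by linarith) (by linarith)
    · exact samePoint_A_odd n ((1 / 2) ^ n / 4 - t) hn (by linarith) (by linarith) (by linarith)
        (by linarith) (by linarith) (by linarith)

lemma isPiecewise_rho_inv : IsPiecewise (fun a z => RhoGraph z a) !![1, 0; 0, -1] := by
  have : (fun a z => RhoGraph z a) = RhoGraph := by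
    funext a z
    exact propext (rhoGraph_symm z a)
  rw [this]
  exact isPiecewise_rho

set_option maxHeartbeats 4000000 in
-- Horizontal edges double in length: `C₁ 0` becomes `S`, while `C₂ 0` and `S` become interior.
-- Vertical edges are halved, which raises the index and exchanges `A` with `B`; the new edges `B 0`
-- and `A 0` come from the cuts at abscissas 0 and 1/2.
lemma isPiecewise_psi : IsPiecewise PsiGraph !![2, 0; 0, 1 / 2] where
  pieces := exists_boxes _ _ _ _ _ psiGraph_pieces
  total z hz := by
    by_cases h : 0 ≤ z.re ∧ z.re ≤ 1 / 2
    · refine ⟨⟨2 * z.re - 1 / 2, z.im / 2⟩, Or.inl ⟨h.1, h.2, ?_, ?_, rfl, rfl⟩⟩ <;>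
      rcases polygon_subset hz with ⟨h1, h2, h3, h4⟩ | ⟨h1, h2, h3, h4⟩ <;> linarith
    rcases polygon_subset hz with ⟨h1, h2, h3, h4⟩ | ⟨h1, h2, h3, h4⟩
    · have h5 : ¬ z.re ≤ 1 / 2 := fun h' => h ⟨h1, h'⟩
      exact ⟨⟨2 * z.re - 1, z.im / 2 + 1 / 2⟩, Or.inr (Or.inr ⟨by linarith, h2, h3, h4, rfl, rfl⟩)⟩
    · have h5 : ¬ 0 ≤ z.re := fun h' => h ⟨h', h2⟩
      exact ⟨⟨2 * z.re + 1, z.im / 2 + 1 / 2⟩, Or.inr (Or.inl ⟨h1, by linarith, h3, h4, rfl, rfl⟩)⟩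
  interior z hz a b ha hb := by
    have hB : z.re = 0 → z.im < 1 / 2 → 0 < z.im → ∀ a b : ℂ, a.re = -1 / 2 → a.im = z.im / 2 →
        b.re = 1 → b.im = z.im / 2 + 1 / 2 → SamePoint b a := fun h1 h2 h3 a b a1 a2 b1 b2 =>
      samePoint_B_even 0 (z.im / 2) (by simp) (by linarith) (by norm_num; linarith) b1
        (by norm_num; linarith) a1 (by norm_num; linarith)
    have hA : z.re = 1 / 2 → z.im < 1 → 1 / 2 < z.im → ∀ a b : ℂ, a.re = 1 / 2 → a.im = z.im / 2 →
        b.re = 0 → b.im = z.im / 2 + 1 / 2 → SamePoint a b := fun h1 h2 h3 a b a1 a2 b1 b2 =>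
      samePoint_A_even 0 (z.im / 2 - 1 / 4) (by simp) (by linarith) (by norm_num; linarith) a1
        (by norm_num; linarith) b1 (by norm_num; linarith)
    have hz := interior_cases hz
    by_cases h0 : z.re = 0
    · have h0' : 0 < z.im ∧ z.im < 1 / 2 := by
        rcases hz with ⟨h1, h2, h3, h4⟩ | ⟨h1, h2, h3, h4⟩ | ⟨h1, h2, h3⟩
        · linarith
        · exact ⟨h3, h4⟩
        · linarith
      have hB := hB h0 h0'.2 h0'.1
      rcases ha with ⟨-, -, -, -, a2, a3⟩ | ⟨-, -, -, -, a2, a3⟩ | ⟨a1, -⟩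
      rotate_right
      · linarith
      all_goals
        rcases hb with ⟨-, -, -, -, b2, b3⟩ | ⟨-, -, -, -, b2, b3⟩ | ⟨b1, -⟩
        rotate_right
        · linarith
      · exact samePoint_refl_of (hB a ⟨1, z.im / 2 + 1 / 2⟩ (by linarith) a3 rfl rfl).symm
          (by linarith) (by linarith)
      · exact (hB a b (by linarith) a3 (by linarith) b3).symm
      · exact hB b a (by linarith) b3 (by linarith) a3
      · exact samePoint_refl_of (hB ⟨-1 / 2, z.im / 2⟩ a rfl rfl (by linarith) a3)
          (by linarith) (by linarith)
    by_cases h5 : z.re = 1 / 2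
    · have h0' : 1 / 2 < z.im ∧ z.im < 1 := by
        rcases hz with ⟨h1, h2, h3, h4⟩ | ⟨h1, h2, h3, h4⟩ | ⟨h1, h2, h3⟩
        · exact ⟨h3, h4⟩
        · linarith
        · linarith
      have hA := hA h5 h0'.2 h0'.1
      rcases ha with ⟨-, -, -, -, a2, a3⟩ | ⟨-, a1, -⟩ | ⟨-, -, -, -, a2, a3⟩
      rotate_left
      · linarith
      rotate_left
      all_goals
        rcases hb with ⟨-, -, -, -, b2, b3⟩ | ⟨-, b1, -⟩ | ⟨-, -, -, -, b2, b3⟩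
        rotate_left
        · linarith
        rotate_left
      · exact samePoint_refl_of (hA a ⟨0, z.im / 2 + 1 / 2⟩ (by linarith) a3 rfl rfl)
          (by linarith) (by linarith)
      · exact hA a b (by linarith) a3 (by linarith) b3
      · exact (hA b a (by linarith) b3 (by linarith) a3).symm
      · exact samePoint_refl_of (hA ⟨1 / 2, z.im / 2⟩ a rfl rfl (by linarith) a3).symm
          (by linarith) (by linarith)
    have hside : z.re < 0 ∨ (0 < z.re ∧ z.re < 1 / 2) ∨ 1 / 2 < z.re := by
      rcases lt_or_gt_of_ne h0 with g | g
      · exact Or.inl g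
      · exact Or.inr ((lt_or_gt_of_ne h5).imp (⟨g, ·⟩) id)
    rcases hside with g | ⟨g, g'⟩ | g
    · have hz' : -1 / 2 < z.re ∧ 0 < z.im ∧ z.im < 1 / 2 := by
        rcases hz with ⟨h1, -⟩ | ⟨h1, h2, h3, h4⟩ | ⟨h1, -⟩
        · linarith
        · exact ⟨h1, h3, h4⟩
        · linarith
      obtain ⟨h1, h2, h3⟩ := hz'
      rcases ha with ⟨a1, -⟩ | ⟨-, -, -, -, a5, a6⟩ | ⟨a1, -⟩
      · linarith
      swap
      · linarith
      rcases hb with ⟨b1, -⟩ | ⟨-, -, -, -, b5, b6⟩ | ⟨b1, -⟩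
      · linarith
      swap
      · linarith
      exact samePoint_of_eq (mem_upper (by linarith) (by linarith) (by linarith) (by linarith))
        (by linarith) (by linarith)
    · have hz' : 0 < z.im ∧ z.im < 1 := by
        rcases hz with ⟨h1, h2, h3, h4⟩ | ⟨h1, h2, h3, h4⟩ | ⟨h1, h2, h3⟩ <;>
          constructor <;> linarith
      rcases ha with ⟨-, -, -, -, a5, a6⟩ | ⟨-, a1, -⟩ | ⟨a1, -⟩
      rotate_left
      · linarith
      · linarith
      rcases hb with ⟨-, -, -, -, b5, b6⟩ | ⟨-, b1, -⟩ | ⟨b1, -⟩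
      rotate_left
      · linarith
      · linarith
      exact samePoint_of_eq (mem_lower (by linarith) (by linarith) (by linarith) (by linarith))
        (by linarith) (by linarith)
    · have hz' : z.re < 1 ∧ 1 / 2 < z.im ∧ z.im < 1 := by
        rcases hz with ⟨h1, h2, h3, h4⟩ | ⟨h1, h2, h3, h4⟩ | ⟨h1, h2, h3⟩
        · exact ⟨h2, h3, h4⟩
        · linarith
        · linarith
      obtain ⟨h1, h2, h3⟩ := hz'
      rcases ha with ⟨-, a1, -⟩ | ⟨-, a1, -⟩ | ⟨-, -, -, -, a5, a6⟩
      · linarith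
      · linarith
      rcases hb with ⟨-, b1, -⟩ | ⟨-, b1, -⟩ | ⟨-, -, -, -, b5, b6⟩
      · linarith
      · linarith
      exact samePoint_of_eq (mem_upper (by linarith) (by linarith) (by linarith) (by linarith))
        (by linarith) (by linarith)
  glued z w h a b ha hb := by
    rcases glued_cases h with ⟨n, t, h0, h1, h2, h3, h4, h5⟩ | ⟨n, t, h0, h1, h2, h3, h4, h5⟩ |
      ⟨t, h0, h1, h2, h3, h4, h5⟩ | ⟨n, hn, t, h0, h1, h2, h3, h4, h5⟩ |
      ⟨n, hn, t, h0, h1, h2, h3, h4, h5⟩ | ⟨n, hn, t, h0, h1, h2, h3, h4, h5⟩ |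
      ⟨n, hn, t, h0, h1, h2, h3, h4, h5⟩
    · rcases n with _ | n
      · simp only [pow_zero] at h1 h2 h4
        rcases ha with ⟨a1, a2, a3, a4, a5, a6⟩ | ⟨a1, a2, a3, a4, a5, a6⟩ |
          ⟨a1, a2, a3, a4, a5, a6⟩ <;> try (exfalso; linarith)
        rcases hb with ⟨b1, b2, b3, b4, b5, b6⟩ | ⟨b1, b2, b3, b4, b5, b6⟩ |
          ⟨b1, b2, b3, b4, b5, b6⟩ <;> try (exfalso; linarith)
        exact samePoint_S (2 * t) (by linarith) (by linarith) (by linarith) (by linarith)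
          (by linarith) (by linarith)
      · have hd := dyadic_pos n
        rw [pow_succ] at h1 h2 h4
        rcases ha with ⟨a1, a2, a3, a4, a5, a6⟩ | ⟨a1, a2, a3, a4, a5, a6⟩ |
          ⟨a1, a2, a3, a4, a5, a6⟩ <;> try (exfalso; linarith)
        rcases hb with ⟨b1, b2, b3, b4, b5, b6⟩ | ⟨b1, b2, b3, b4, b5, b6⟩ |
          ⟨b1, b2, b3, b4, b5, b6⟩ <;> try (exfalso; linarith)
        exact samePoint_C₁ n (2 * t) (by linarith) (by linarith) (by linarith) (by linarith)
          (by linarith) (by linarith)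
    · rcases n with _ | n
      · simp only [pow_zero] at h1 h2 h4
        rcases ha with ⟨a1, a2, a3, a4, a5, a6⟩ | ⟨a1, a2, a3, a4, a5, a6⟩ |
          ⟨a1, a2, a3, a4, a5, a6⟩ <;> try (exfalso; linarith)
        rcases hb with ⟨b1, b2, b3, b4, b5, b6⟩ | ⟨b1, b2, b3, b4, b5, b6⟩ |
          ⟨b1, b2, b3, b4, b5, b6⟩ <;> try (exfalso; linarith)
        exact samePoint_of_eq (mem_central (by linarith) (by linarith) (by linarith) (by linarith))
          (by linarith) (by linarith)
      · have hd := dyadic_pos n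
        rw [pow_succ] at h1 h2 h4
        rcases ha with ⟨a1, a2, a3, a4, a5, a6⟩ | ⟨a1, a2, a3, a4, a5, a6⟩ |
          ⟨a1, a2, a3, a4, a5, a6⟩ <;> try (exfalso; linarith)
        rcases hb with ⟨b1, b2, b3, b4, b5, b6⟩ | ⟨b1, b2, b3, b4, b5, b6⟩ |
          ⟨b1, b2, b3, b4, b5, b6⟩ <;> try (exfalso; linarith)
        exact samePoint_C₂ n (2 * t) (by linarith) (by linarith) (by linarith) (by linarith)
          (by linarith) (by linarith)
    · rcases ha with ⟨a1, a2, a3, a4, a5, a6⟩ | ⟨a1, a2, a3, a4, a5, a6⟩ |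
        ⟨a1, a2, a3, a4, a5, a6⟩ <;> try (exfalso; linarith)
      rcases hb with ⟨b1, b2, b3, b4, b5, b6⟩ | ⟨b1, b2, b3, b4, b5, b6⟩ |
        ⟨b1, b2, b3, b4, b5, b6⟩ <;> try (exfalso; linarith)
      exact samePoint_of_eq (mem_upper (by linarith) (by linarith) (by linarith) (by linarith))
        (by linarith) (by linarith)
    all_goals
      have hd := dyadic_pos n
      try have hd1 := dyadic_odd hn
      have hs := pow_succ ((1 : ℝ) / 2) n
      have hp := Nat.even_add_one (n := n)
      rcases ha with ⟨a1, a2, a3, a4, a5, a6⟩ | ⟨a1, a2, a3, a4, a5, a6⟩ |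
        ⟨a1, a2, a3, a4, a5, a6⟩ <;> try (exfalso; linarith)
      rcases hb with ⟨b1, b2, b3, b4, b5, b6⟩ | ⟨b1, b2, b3, b4, b5, b6⟩ |
        ⟨b1, b2, b3, b4, b5, b6⟩ <;> try (exfalso; linarith)
    · exact samePoint_B_odd (n + 1) (t / 2) (by tauto) (by linarith) (by linarith) (by linarith)
        (by linarith) (by linarith) (by linarith)
    · exact samePoint_B_even (n + 1) (t / 2) (by tauto) (by linarith) (by linarith) (by linarith)
        (by linarith) (by linarith) (by linarith)
    · exact samePoint_A_odd (n + 1) (t / 2) (by tauto) (by linarith) (by linarith) (by linarith)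
        (by linarith) (by linarith) (by linarith)
    · exact samePoint_A_even (n + 1) (t / 2) (by tauto) (by linarith) (by linarith) (by linarith)
        (by linarith) (by linarith) (by linarith)

lemma psiGraph_swap {z a : ℂ} (h : PsiGraph a z) :
    (-1 / 2 ≤ z.re ∧ z.re ≤ 1 / 2 ∧ 0 ≤ z.im ∧ z.im ≤ 1 / 2 ∧ a.re = z.re / 2 + 1 / 4 ∧
      a.im = 2 * z.im) ∨
    (0 ≤ z.re ∧ z.re ≤ 1 ∧ 1 / 2 ≤ z.im ∧ z.im ≤ 3 / 4 ∧ a.re = z.re / 2 - 1 / 2 ∧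
      a.im = 2 * z.im - 1) ∨
    (0 ≤ z.re ∧ z.re ≤ 1 ∧ 3 / 4 ≤ z.im ∧ z.im ≤ 1 ∧ a.re = z.re / 2 + 1 / 2 ∧
      a.im = 2 * z.im - 1) := by
  refine Or.imp ?_ (Or.imp ?_ ?_) h <;>
    (rintro ⟨h1, h2, h3, h4, h5, h6⟩
     refine ⟨?_, ?_, ?_, ?_, ?_, ?_⟩ <;> linarith)

/-- A positive even index is at least 2. This puts the second edge of `A (n + 1)` below the cut at
height 3/4 and the first edge of `B (n + 1)` above it. -/
lemma dyadic_quarter {n : ℕ} (hn : Even (n + 1)) : ((1 : ℝ) / 2) ^ (n + 1) ≤ 1 / 4 := by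
  have h := dyadic_odd (Nat.even_add_one.1 hn)
  rw [pow_succ]
  linarith

set_option maxHeartbeats 4000000 in
-- The edge correspondence of `ψ` reversed: the cut at height 3/4 opens to `S`, the common segment
-- at height 1/2 opens to `C₂ 0`, `S` becomes `C₁ 0`, and `A 0` and `B 0` become interior.
lemma isPiecewise_psi_inv : IsPiecewise (fun a z => PsiGraph z a) !![1 / 2, 0; 0, 2] where
  pieces := exists_boxes _ _ _ _ _ psiGraph_pieces_inv
  total z hz := by
    rcases polygon_subset hz with ⟨h1, h2, h3, h4⟩ | ⟨h1, h2, h3, h4⟩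
    · rcases le_total z.im (3 / 4) with h5 | h5
      · exact ⟨⟨z.re / 2 - 1 / 2, 2 * z.im - 1⟩, Or.inr (Or.inl ⟨by linarith, by linarith,
          by linarith, by linarith, by dsimp only; ring, by dsimp only; ring⟩)⟩
      · exact ⟨⟨z.re / 2 + 1 / 2, 2 * z.im - 1⟩, Or.inr (Or.inr ⟨by linarith, by linarith,
          by linarith, by linarith, by dsimp only; ring, by dsimp only; ring⟩)⟩
    · exact ⟨⟨z.re / 2 + 1 / 4, 2 * z.im⟩, Or.inl ⟨by linarith, by linarith,
          by linarith, by linarith, by dsimp only; ring, by dsimp only; ring⟩⟩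
  interior z hz a b ha hb := by
    replace ha := psiGraph_swap ha
    replace hb := psiGraph_swap hb
    rcases interior_cases hz with ⟨h1, h2, h3, h4⟩ | ⟨h1, h2, h3, h4⟩ | ⟨h1, h2, h3⟩
    · have hS : ∀ a b : ℂ, z.im = 3 / 4 → a.re = z.re / 2 - 1 / 2 → a.im = 2 * z.im - 1 →
          b.re = z.re / 2 + 1 / 2 → b.im = 2 * z.im - 1 → SamePoint a b :=
        fun a b h a1 a2 b1 b2 => samePoint_S (z.re / 2) (by linarith) (by linarith) (by linarith)
          (by linarith) (by linarith) (by linarith)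
      rcases ha with ⟨-, -, -, a4, -⟩ | ⟨-, -, -, a4, a5, a6⟩ | ⟨-, -, a4, -, a5, a6⟩
      · linarith
      · rcases hb with ⟨-, -, -, b4, -⟩ | ⟨-, -, -, b4, b5, b6⟩ | ⟨-, -, b4, -, b5, b6⟩
        · linarith
        · rcases b4.lt_or_eq with g | g
          · exact samePoint_of_eq (mem_lower (by linarith) (by linarith) (by linarith)
              (by linarith)) (by linarith) (by linarith)
          · exact samePoint_refl_of (hS a ⟨z.re / 2 + 1 / 2, 2 * z.im - 1⟩ g a5 a6 rfl rfl)
              (by linarith) (by linarith)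
        · exact hS a b (by linarith) a5 a6 b5 b6
      · rcases hb with ⟨-, -, -, b4, -⟩ | ⟨-, -, -, b4, b5, b6⟩ | ⟨-, -, b4, -, b5, b6⟩
        · linarith
        · exact (hS b a (by linarith) b5 b6 a5 a6).symm
        · rcases b4.lt_or_eq with g | g
          · exact samePoint_of_eq (mem_upper (by linarith) (by linarith) (by linarith)
              (by linarith)) (by linarith) (by linarith)
          · exact samePoint_refl_of
              (hS ⟨z.re / 2 - 1 / 2, 2 * z.im - 1⟩ a g.symm rfl rfl a5 a6).symm
              (by linarith) (by linarith)
    · rcases ha with ⟨-, -, -, -, a5, a6⟩ | ⟨-, -, a4, -⟩ | ⟨-, -, a4, -⟩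
      rotate_left
      · linarith
      · linarith
      rcases hb with ⟨-, -, -, -, b5, b6⟩ | ⟨-, -, b4, -⟩ | ⟨-, -, b4, -⟩
      rotate_left
      · linarith
      · linarith
      exact samePoint_of_eq (mem_central (by linarith) (by linarith) (by linarith) (by linarith))
        (by linarith) (by linarith)
    · have hC : ∀ a b : ℂ, a.re = z.re / 2 + 1 / 4 → a.im = 2 * z.im → b.re = z.re / 2 - 1 / 2 →
          b.im = 2 * z.im - 1 → SamePoint a b := fun a b a1 a2 b1 b2 =>
        samePoint_C₂ 0 (z.re / 2) (by linarith) (by norm_num; linarith) (by norm_num; linarith)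
          (by linarith) (by norm_num; linarith) (by linarith)
      rcases ha with ⟨-, -, -, -, a5, a6⟩ | ⟨-, -, -, -, a5, a6⟩ | ⟨-, -, a4, -⟩
      rotate_right
      · linarith
      all_goals
        rcases hb with ⟨-, -, -, -, b5, b6⟩ | ⟨-, -, -, -, b5, b6⟩ | ⟨-, -, b4, -⟩
        rotate_right
        · linarith
      · exact samePoint_refl_of (hC a ⟨z.re / 2 - 1 / 2, 2 * z.im - 1⟩ a5 a6 rfl rfl)
          (by linarith) (by linarith)
      · exact hC a b a5 a6 b5 b6
      · exact (hC b a b5 b6 a5 a6).symm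
      · exact samePoint_refl_of (hC ⟨z.re / 2 + 1 / 4, 2 * z.im⟩ a rfl rfl a5 a6).symm
          (by linarith) (by linarith)
  glued z w h a b ha hb := by
    replace ha := psiGraph_swap ha
    replace hb := psiGraph_swap hb
    rcases glued_cases h with ⟨n, t, h0, h1, h2, h3, h4, h5⟩ | ⟨n, t, h0, h1, h2, h3, h4, h5⟩ |
      ⟨t, h0, h1, h2, h3, h4, h5⟩ | ⟨n, hn, t, h0, h1, h2, h3, h4, h5⟩ |
      ⟨n, hn, t, h0, h1, h2, h3, h4, h5⟩ | ⟨n, hn, t, h0, h1, h2, h3, h4, h5⟩ |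
      ⟨n, hn, t, h0, h1, h2, h3, h4, h5⟩
    · have hs := pow_succ ((1 : ℝ) / 2) n
      rcases ha with ⟨-, -, -, a1, -⟩ | ⟨-, -, -, a1, -⟩ | ⟨-, -, -, -, a1, a2⟩
      · linarith
      · linarith
      rcases hb with ⟨-, -, -, -, b1, b2⟩ | ⟨-, -, b1, -⟩ | ⟨-, -, b1, -⟩
      rotate_left
      · linarith
      · linarith
      exact samePoint_C₁ (n + 1) (t / 2) (by linarith) (by linarith) (by linarith)
        (by linarith) (by linarith) (by linarith)
    · have hs := pow_succ ((1 : ℝ) / 2) n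
      rcases ha with ⟨-, -, -, a1, -⟩ | ⟨-, -, -, a1, -⟩ | ⟨-, -, -, -, a1, a2⟩
      · linarith
      · linarith
      rcases hb with ⟨-, -, -, -, b1, b2⟩ | ⟨-, -, b1, -⟩ | ⟨-, -, b1, -⟩
      rotate_left
      · linarith
      · linarith
      exact samePoint_C₂ (n + 1) (t / 2) (by linarith) (by linarith) (by linarith)
        (by linarith) (by linarith) (by linarith)
    · rcases ha with ⟨-, -, -, -, a1, a2⟩ | ⟨a1, -⟩ | ⟨a1, -⟩
      rotate_left
      · linarith
      · linarith
      rcases hb with ⟨-, b1, -⟩ | ⟨-, -, -, -, b1, b2⟩ | ⟨-, -, b1, -⟩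
      · linarith
      swap
      · linarith
      exact samePoint_C₁ 0 (t / 2) (by linarith) (by norm_num; linarith) (by norm_num; linarith)
        (by linarith) (by norm_num; linarith) (by linarith)
    all_goals
      have hd := dyadic_pos n
      rcases n with _ | n
    · simp only [pow_zero] at h1 h3 h5
      rcases ha with ⟨-, -, -, -, a1, a2⟩ | ⟨-, -, a1, -⟩ | ⟨-, -, a1, -⟩
      rotate_left
      · linarith
      · linarith
      rcases hb with ⟨-, -, -, b1, -⟩ | ⟨-, -, -, b1, -⟩ | ⟨-, -, -, -, b1, b2⟩
      · linarith
      · linarith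
      exact samePoint_of_eq (mem_upper (by linarith) (by linarith) (by linarith) (by linarith))
        (by linarith) (by linarith)
    · have hq := dyadic_quarter hn
      have hp := Nat.even_add_one.1 hn
      have hs := pow_succ ((1 : ℝ) / 2) n
      rcases ha with ⟨-, -, -, -, a1, a2⟩ | ⟨-, -, a1, -⟩ | ⟨-, -, a1, -⟩
      rotate_left
      · linarith
      · linarith
      rcases hb with ⟨-, -, -, b1, -⟩ | ⟨-, -, -, -, b1, b2⟩ | ⟨-, -, b1, -⟩
      · linarith
      swap
      · linarith
      exact samePoint_B_odd n (2 * t) hp (by linarith) (by linarith) (by linarith) (by linarith)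
        (by linarith) (by linarith)
    · simp at hn
    · have hp : Even n := by by_contra h; exact hn (Nat.even_add_one.2 h)
      have hq := dyadic_odd hn
      have hs := pow_succ ((1 : ℝ) / 2) n
      rcases ha with ⟨-, -, -, a1, -⟩ | ⟨-, -, -, a1, -⟩ | ⟨-, -, -, -, a1, a2⟩
      · linarith
      · linarith
      rcases hb with ⟨-, -, -, b1, -⟩ | ⟨-, -, -, -, b1, b2⟩ | ⟨-, -, b1, -⟩
      rotate_left
      rotate_left
      · linarith
      rotate_left
      · exact samePoint_B_even n (2 * t) hp (by linarith) (by linarith) (by linarith)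
          (by linarith) (by linarith) (by linarith)
      · linarith
    · simp only [pow_zero] at h1 h3 h5
      rcases ha with ⟨-, -, -, a1, -⟩ | ⟨-, -, -, -, a1, a2⟩ | ⟨-, -, a1, -⟩
      · linarith
      swap
      · linarith
      rcases hb with ⟨-, -, -, -, b1, b2⟩ | ⟨b1, -⟩ | ⟨b1, -⟩
      rotate_left
      · linarith
      · linarith
      exact samePoint_of_eq (mem_lower (by linarith) (by linarith) (by linarith) (by linarith))
        (by linarith) (by linarith)
    · have hq := dyadic_quarter hn
      have hp := Nat.even_add_one.1 hn
      have hs := pow_succ ((1 : ℝ) / 2) n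
      rcases ha with ⟨-, -, -, a1, -⟩ | ⟨-, -, -, a1, -⟩ | ⟨-, -, -, -, a1, a2⟩
      · linarith
      · linarith
      rcases hb with ⟨-, -, -, -, b1, b2⟩ | ⟨b1, -⟩ | ⟨b1, -⟩
      rotate_left
      · linarith
      · linarith
      exact samePoint_A_odd n (2 * t) hp (by linarith) (by linarith) (by linarith) (by linarith)
        (by linarith) (by linarith)
    · simp at hn
    · have hp : Even n := by by_contra h; exact hn (Nat.even_add_one.2 h)
      have hq := dyadic_odd hn
      have hs := pow_succ ((1 : ℝ) / 2) n
      rcases ha with ⟨-, -, -, -, a1, a2⟩ | ⟨-, -, a1, -⟩ | ⟨-, -, a1, -⟩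
      rotate_left
      · linarith
      · linarith
      rcases hb with ⟨-, -, -, -, b1, b2⟩ | ⟨b1, -⟩ | ⟨b1, -⟩
      rotate_left
      · linarith
      · linarith
      exact samePoint_A_even n (2 * t) hp (by linarith) (by linarith) (by linarith) (by linarith)
        (by linarith) (by linarith)

lemma exists_proj_eq {R : ℂ → ℂ → Prop} {φ : Surface ≃ₜ Surface}
    (h : ∀ z ∈ polygon, ∀ a, R z a → a ∈ polygon ∧ φ (pt z) = pt a) (p : polygon) {a : ℂ}
    (ha : R p a) : ∃ q : polygon, (q : ℂ) = a ∧ φ (proj p) = proj q := by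
  obtain ⟨h1, h2⟩ := h p p.2 a ha
  exact ⟨⟨a, h1⟩, rfl, by rw [← pt_coe, h2, pt_of_mem h1]⟩

theorem exists_psi : ∃ ψ : affineGroup Surface, IsPsi ψ.1 ∧
    HasDerivative ψ.1 !![2, 0; 0, 1 / 2] := by
  obtain ⟨ψ, hd, h⟩ := isPiecewise_psi.exists_homeomorph isPiecewise_psi_inv
  refine ⟨⟨ψ, hd.mem_affineGroup (by norm_num [Matrix.det_fin_two_of])⟩, ⟨?_, ?_, ?_⟩, hd⟩
  · rintro p ⟨⟨h1, h2⟩, h3, h4⟩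
    exact exists_proj_eq h p (Or.inl ⟨h1, h2, h3, h4, rfl, rfl⟩)
  · rintro p ⟨⟨h1, h2⟩, h3, h4⟩
    exact exists_proj_eq h p (Or.inr (Or.inl ⟨h1, h2, h3, h4, rfl, rfl⟩))
  · rintro p ⟨⟨h1, h2⟩, h3, h4⟩
    exact exists_proj_eq h p (Or.inr (Or.inr ⟨h1, h2, h3, h4, rfl, rfl⟩))

theorem exists_rho : ∃ ρ : affineGroup Surface, IsRho ρ.1 ∧
    HasDerivative ρ.1 !![1, 0; 0, -1] := by
  obtain ⟨ρ, hd, h⟩ := isPiecewise_rho.exists_homeomorph isPiecewise_rho_inv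
  refine ⟨⟨ρ, hd.mem_affineGroup (by norm_num [Matrix.det_fin_two_of])⟩, ⟨?_, ?_⟩, hd⟩
  · rintro p ⟨⟨h1, h2⟩, h3, h4⟩
    exact exists_proj_eq h p (Or.inl ⟨h1, h2, h3, h4, rfl, rfl⟩)
  · rintro p ⟨⟨h1, h2⟩, h3, h4⟩
    exact exists_proj_eq h p (Or.inr ⟨h1, h2, h3, h4, rfl, rfl⟩)

/-! ### The structure of the affine group -/

lemma diagonal_of_mem {φ : Surface ≃ₜ Surface} (hφ : φ ∈ affineGroup Surface)
    {M : Matrix (Fin 2) (Fin 2) ℝ} (h : HasDerivative φ M) :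
    M = !![M 0 0, 0; 0, M 1 1] ∧ 0 < M 0 0 ∧ M 1 1 ≠ 0 := by
  have hdet : M.det ≠ 0 := (h.isUnit_det hφ).ne_zero
  obtain ⟨h1, h2, h3, -⟩ := diagonal_and_corner h hdet
  refine ⟨?_, h3, fun h4 => hdet ?_⟩
  · ext i j
    fin_cases i <;> fin_cases j <;> simp [h1, h2]
  · rw [Matrix.det_fin_two, h1, h4]
    ring

variable {ψ ρ : affineGroup Surface}

lemma hasDerivative_zpow (hψ : HasDerivative ψ.1 !![2, 0; 0, 1 / 2]) (k : ℤ) :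
    HasDerivative (ψ ^ k).1 !![2 ^ k, 0; 0, (1 / 2) ^ k] := by
  have hinv : HasDerivative (ψ⁻¹).1 !![1 / 2, 0; 0, 2] := by
    have h := hψ.inv ψ.2
    have h' : (!![2, 0; 0, 1 / 2] : Matrix (Fin 2) (Fin 2) ℝ)⁻¹ = !![1 / 2, 0; 0, 2] := by
      refine Matrix.inv_eq_right_inv ?_
      rw [Matrix.mul_fin_two, Matrix.one_fin_two]
      norm_num
    rwa [h'] at h
  induction k with
  | zero =>
    simp only [zpow_zero]
    rw [← Matrix.one_fin_two]
    exact hasDerivative_one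
  | succ n ih =>
    rw [zpow_add_one, zpow_add_one₀ two_ne_zero, zpow_add_one₀ (by norm_num)]
    have h := ih.comp hψ
    rw [Matrix.mul_fin_two] at h
    simpa using h
  | pred n ih =>
    rw [zpow_sub_one, zpow_sub_one₀ two_ne_zero, zpow_sub_one₀ (by norm_num)]
    have h := ih.comp hinv
    rw [Matrix.mul_fin_two] at h
    simpa using h

/-- Because the derivative is faithful, the relations in the affine group, such as ρ² = 1 and ψρ =
ρψ, become identities between diagonal matrices. -/
lemma eq_of_hasDerivative {φ χ : affineGroup Surface} {M : Matrix (Fin 2) (Fin 2) ℝ}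
    (hφ : HasDerivative φ.1 M) (hχ : HasDerivative χ.1 M) : φ = χ := by
  have h := (hχ.inv χ.2).comp hφ
  rw [Matrix.nonsing_inv_mul _ (hφ.isUnit_det φ.2)] at h
  exact (inv_mul_eq_one.1 (Subtype.ext (eq_one_of_hasDerivative_one h) : χ⁻¹ * φ = 1)).symm

lemma sq_eq_one (hρ : HasDerivative ρ.1 !![1, 0; 0, -1]) : ρ * ρ = 1 := by
  have h := hρ.comp hρ
  rw [Matrix.mul_fin_two] at h
  refine eq_of_hasDerivative (M := 1) ?_ hasDerivative_one
  rw [Matrix.one_fin_two]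
  simpa using h

lemma commute_of_hasDerivative (hψ : HasDerivative ψ.1 !![2, 0; 0, 1 / 2])
    (hρ : HasDerivative ρ.1 !![1, 0; 0, -1]) : Commute ψ ρ := by
  refine eq_of_hasDerivative (hψ.comp hρ) ?_
  have h := hρ.comp hψ
  rw [Matrix.mul_fin_two] at h ⊢
  simpa using h

/-- With `M 0 0 = 2 ^ k`, the product `ψ ^ (-k) * φ` has unit expansion and a positive lower entry,
hence is 1. -/
lemma eq_zpow_of_pos (hψ : HasDerivative ψ.1 !![2, 0; 0, 1 / 2]) (φ : affineGroup Surface)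
    {M : Matrix (Fin 2) (Fin 2) ℝ} (h : HasDerivative φ.1 M) (hd : 0 < M 1 1) :
    ∃ k : ℤ, φ = ψ ^ k := by
  obtain ⟨k, hk⟩ := expansion_eq_zpow h (h.isUnit_det φ.2).ne_zero hd
  refine ⟨k, ?_⟩
  have h' := (hasDerivative_zpow hψ (-k)).comp h
  rw [(diagonal_of_mem φ.2 h).1, Matrix.mul_fin_two] at h'
  have h1 : ψ ^ (-k) * φ = 1 := by
    refine Subtype.ext (eq_one_of_unit_expansion (ψ ^ (-k) * φ).2 h' ?_ ?_)
    · simp only [Matrix.of_apply, Matrix.cons_val_zero, hk, mul_zero, add_zero]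
      rw [← zpow_add₀ two_ne_zero, neg_add_cancel, zpow_zero]
    · simp only [Matrix.of_apply, Matrix.cons_val_one, Matrix.cons_val_fin_one]
      have := zpow_pos (show (0 : ℝ) < 1 / 2 by norm_num) (-k)
      nlinarith [mul_pos this hd]
  rw [zpow_neg] at h1
  exact (inv_mul_eq_one.1 h1).symm

lemma eq_zpow_mul (hψ : HasDerivative ψ.1 !![2, 0; 0, 1 / 2])
    (hρ : HasDerivative ρ.1 !![1, 0; 0, -1]) (φ : affineGroup Surface) :
    ∃ k : ℤ, φ = ψ ^ k ∨ φ = ψ ^ k * ρ := by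
  obtain ⟨M, h⟩ := exists_hasDerivative φ.2
  obtain ⟨hM, -, hd⟩ := diagonal_of_mem φ.2 h
  -- If `M 1 1 < 0`, composing with ρ makes this entry positive without changing `M 0 0`.
  rcases hd.lt_or_gt with hd | hd
  · have h' := h.comp hρ
    rw [hM, Matrix.mul_fin_two] at h'
    obtain ⟨k, hk⟩ := eq_zpow_of_pos hψ (φ * ρ) h' (by simpa using hd)
    refine ⟨k, Or.inr ?_⟩
    rw [← hk, mul_assoc, sq_eq_one hρ, mul_one]
  · obtain ⟨k, hk⟩ := eq_zpow_of_pos hψ φ h hd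
    exact ⟨k, Or.inl hk⟩

lemma closure_eq_top (hψ : HasDerivative ψ.1 !![2, 0; 0, 1 / 2])
    (hρ : HasDerivative ρ.1 !![1, 0; 0, -1]) : Subgroup.closure {ψ, ρ} = ⊤ := by
  rw [eq_top_iff]
  rintro φ -
  have h1 : ψ ∈ Subgroup.closure {ψ, ρ} := Subgroup.subset_closure (by simp)
  have h2 : ρ ∈ Subgroup.closure {ψ, ρ} := Subgroup.subset_closure (by simp)
  obtain ⟨k, rfl | rfl⟩ := eq_zpow_mul hψ hρ φ
  · exact zpow_mem h1 k
  · exact mul_mem (zpow_mem h1 k) h2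

lemma zpow_eq_one (hψ : HasDerivative ψ.1 !![2, 0; 0, 1 / 2]) {k : ℤ} (h : ψ ^ k = 1) :
    k = 0 := by
  have h1 := hasDerivative_zpow hψ k
  rw [h] at h1
  have h2 := congrFun (congrFun (h1.unique hasDerivative_one) 0) 0
  simp only [Matrix.of_apply, Matrix.cons_val_zero, Matrix.one_apply_eq] at h2
  exact (zpow_eq_one_iff_right₀ two_pos.le (by norm_num)).1 h2

/-- The lower right entry of the derivative is negative. -/
lemma zpow_mul_ne_one (hψ : HasDerivative ψ.1 !![2, 0; 0, 1 / 2])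
    (hρ : HasDerivative ρ.1 !![1, 0; 0, -1]) (k : ℤ) : ψ ^ k * ρ ≠ 1 := by
  intro h
  have h1 : HasDerivative (ψ ^ k * ρ).1 _ := (hasDerivative_zpow hψ k).comp hρ
  rw [h, Matrix.mul_fin_two] at h1
  have h2 := congrFun (congrFun (h1.unique hasDerivative_one) 1) 1
  simp at h2
  have := zpow_pos (show (0 : ℝ) < 2 by norm_num) k
  have := inv_pos.2 this
  linarith

theorem exists_mulEquiv (hψ : HasDerivative ψ.1 !![2, 0; 0, 1 / 2])
    (hρ : HasDerivative ρ.1 !![1, 0; 0, -1]) :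
    ∃ Φ : Multiplicative (ℤ × ZMod 2) ≃* affineGroup Surface,
      Φ (Multiplicative.ofAdd (1, 0)) = ψ ∧ Φ (Multiplicative.ofAdd (0, 1)) = ρ := by
  have hρ2 := sq_eq_one hρ
  have hcomm := commute_of_hasDerivative hψ hρ
  have hval : ∀ a b : ZMod 2, ρ ^ (a + b).val = ρ ^ a.val * ρ ^ b.val := by
    intro a b
    fin_cases a <;> fin_cases b
    · exact (mul_one _).symm
    · exact (one_mul _).symm
    · exact (mul_one _).symm
    · change ρ ^ 0 = ρ ^ 1 * ρ ^ 1
      rw [pow_zero, pow_one, hρ2]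
  let f : Multiplicative (ℤ × ZMod 2) →* affineGroup Surface :=
    { toFun := fun x => ψ ^ x.toAdd.1 * ρ ^ x.toAdd.2.val
      map_one' := by simp
      map_mul' := fun x y => by
        rw [toAdd_mul, Prod.fst_add, Prod.snd_add, hval, zpow_add]
        exact ((hcomm.zpow_left _).pow_right _).mul_mul_mul_comm _ _ }
  have hf : ∀ (k : ℤ) (b : ZMod 2), f (Multiplicative.ofAdd (k, b)) = ψ ^ k * ρ ^ b.val :=
    fun _ _ => rfl
  have hv : (1 : ZMod 2).val = 1 := rfl
  have hbij : Function.Bijective f := by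
    constructor
    · rw [injective_iff_map_eq_one]
      intro x
      obtain ⟨⟨k, b⟩, rfl⟩ := Multiplicative.ofAdd.surjective x
      rw [hf]
      fin_cases b
      · intro h
        have h' : ψ ^ k = 1 := (mul_one _).symm.trans h
        rw [zpow_eq_one hψ h']
        rfl
      · intro h
        have h' : ψ ^ k * ρ ^ 1 = 1 := h
        rw [pow_one] at h'
        exact (zpow_mul_ne_one hψ hρ k h').elim
    · intro φ
      obtain ⟨k, h | h⟩ := eq_zpow_mul hψ hρ φ
      · exact ⟨Multiplicative.ofAdd (k, 0), by rw [hf, ZMod.val_zero, pow_zero, mul_one, h]⟩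
      · exact ⟨Multiplicative.ofAdd (k, 1), by rw [hf, hv, pow_one, h]⟩
  refine ⟨MulEquiv.ofBijective f hbij, ?_, ?_⟩
  · rw [MulEquiv.ofBijective_apply, hf, ZMod.val_zero, pow_zero, mul_one, zpow_one]
  · rw [MulEquiv.ofBijective_apply, hf, hv, pow_one, zpow_zero, one_mul]

end ArnouxYoccoz

/-! ### The main theorem -/

theorem theoremT :
    ∃ ψ ρ : ArnouxYoccoz.affineGroup ArnouxYoccoz.Surface,
      -- `ψ` and `ρ` are the maps `ψ_∞` and `ρ_∞`
      ArnouxYoccoz.IsPsi ψ.1 ∧ ArnouxYoccoz.IsRho ρ.1 ∧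
      ArnouxYoccoz.HasDerivative ψ.1 !![2, 0; 0, 1 / 2] ∧
      ArnouxYoccoz.HasDerivative ρ.1 !![1, 0; 0, -1] ∧
      -- they generate the affine group, which is `ℤ × ℤ/2ℤ`
      Subgroup.closure {ψ, ρ} = ⊤ ∧
      (∃ Φ : Multiplicative (ℤ × ZMod 2) ≃* ArnouxYoccoz.affineGroup ArnouxYoccoz.Surface,
        Φ (Multiplicative.ofAdd (1, 0)) = ψ ∧ Φ (Multiplicative.ofAdd (0, 1)) = ρ) ∧
      -- derivatives: the vertical direction is preserved, there are no parabolic elements and no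
      -- non-trivial translations
      (∀ φ ∈ ArnouxYoccoz.affineGroup ArnouxYoccoz.Surface,
        ∃! M : Matrix (Fin 2) (Fin 2) ℝ, ArnouxYoccoz.HasDerivative φ M) ∧
      (∀ φ ∈ ArnouxYoccoz.affineGroup ArnouxYoccoz.Surface, ∀ M : Matrix (Fin 2) (Fin 2) ℝ,
        ArnouxYoccoz.HasDerivative φ M →
          M 0 1 = 0 ∧ ¬ M.IsParabolic ∧ (M = 1 → φ = 1)) := by
  obtain ⟨ψ, h1, hψ⟩ := ArnouxYoccoz.exists_psi
  obtain ⟨ρ, h2, hρ⟩ := ArnouxYoccoz.exists_rho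
  refine ⟨ψ, ρ, h1, h2, hψ, hρ, ArnouxYoccoz.closure_eq_top hψ hρ,
    ArnouxYoccoz.exists_mulEquiv hψ hρ, fun φ hφ => ?_, fun φ hφ M hM => ?_⟩
  · obtain ⟨M, hM⟩ := ArnouxYoccoz.exists_hasDerivative hφ
    exact ⟨M, hM, fun N hN => hN.unique hM⟩
  · obtain ⟨h3, -⟩ := ArnouxYoccoz.diagonal_of_mem hφ hM
    have h01 : M 0 1 = 0 := by rw [h3]; rfl
    have h10 : M 1 0 = 0 := by rw [h3]; rfl
    refine ⟨h01, fun h => ?_, ?_⟩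
    -- A triangular parabolic matrix has a non-zero off-diagonal entry, whereas M is diagonal.
    · exact ((Matrix.isParabolic_iff_of_upperTriangular h10).1 h).2 h01
    · rintro rfl
      exact ArnouxYoccoz.eq_one_of_hasDerivative_one hM
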